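/- Let $K$ be a field and let $\mathbf C$ be a $K$-linear abelian category which is semisimple (every short exact sequence splits) and cocomplete, with exact filtered colimits. Suppose that $\mathbf C$ carries a $K$-bilinear monoidal structure $\otimes$ (not assumed braided) such that, for every object $X$, the functors $X\otimes-$ and $-\otimes X$ are exact and commute with filtered colimits. (For instance, $\mathbf C$ is the category of $K$-vector spaces.) A graded object is a family $M=(M^p)_{p\in\mathbb Z}$ of objects of $\mathbf C$; a graded morphism $f:M\to L$ of degree $r$ is a family of morphisms $f^p:M^p\to L^{p+r}$, $p\in\mathbb Z$. The tensor product is $(M\otimes L)^n=\bigoplus_{p+q=n}M^p\otimes L^q$, and $f\otimes g$ is $(-1)^{ps}f^p\otimes g^q$ on $M^p\otimes L^q$, where $s$ is the degree of $g$. An $A_\infty$-algebra (in $\mathbf C$) is a graded object $A$ with graded morphisms $m_i:A^{\otimes i}\to A$ of degree $2-i$, $i\ge 1$, such that for all $n\ge 1$ $$\sum_{j+k+l=n}(-1)^{jk+l}\,m_{j+1+l}\circ(\mathbf 1^{\otimes j}\otimes m_k\otimes \mathbf 1^{\otimes l})=0 ,$$ where $j,l\ge 0$ and $k\ge 1$.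 In particular $(A,m_1)$ is a complex. A morphism of $A_\infty$-algebras $f:A\to B$ is a family of graded morphisms $f_i:A^{\otimes i}\to B$ of degree $1-i$, $i\ge 1$, such that for all $n\ge 1$ $$\sum_{j+k+l=n}(-1)^{jk+l}f_{j+1+l}\circ(\mathbf 1^{\otimes j}\otimes m_k\otimes\mathbf 1^{\otimes l})=\sum_{r\ge 1}\ \sum_{i_1+\dots+i_r=n}(-1)^{s}\,m_r\circ(f_{i_1}\otimes\cdots\otimes f_{i_r}),$$ where $i_1,\dots,i_r\ge 1$ and $s=\sum_{2\le u\le r}(1-i_u)\sum_{1\le v\le u}i_v$. In particular $f_1$ is a morphism of complexes. The composite $g\circ f$ has components $(g\circ f)_n=\sum_{r\ge 1}\sum_{i_1+\dots+i_r=n}(-1)^s g_r\circ(f_{i_1}\otimes\cdots\otimes f_{i_r})$ with the same $s$, and the identity has $f_1=\mathbf 1$ and $f_i=0$ for $i\geq 2$. This defines the category $\mathbf{Alg}_\infty$ of $A_\infty$-algebras. A morphism $f$ of $\mathbf{Alg}_\infty$ is a *weak equivalence* if $f_1$ is a quasi-isomorphism of complexes, a *cofibration* if $f_1$ is a monomorphism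 (in each degree), and a *fibration* if $f_1$ is an epimorphism (in each degree). **Theorem.** The category $\mathbf{Alg}_\infty$ with these three classes has the following properties. * (A) If $q:A\to A'$ is a fibration and $f:A''\to A'$ is any morphism, then the fibre product of $A\xrightarrow{q}A'\xleftarrow{f}A''$ exists in $\mathbf{Alg}_\infty$. * (CM2) If $f$, $g$ are composable morphisms and two of $f$, $g$, $g\circ f$ are weak equivalences, then so is the third. * (CM3) Each of the three classes is stable under retracts (in the category of morphisms). * (CM4) If $i$ is a cofibration, $p$ is a fibration, and $i$ or $p$ is a weak equivalence, then $i$ has the left lifting property with respect to $p$. * (CM5) Every morphism $f$ factors as $f=p\circ i$ with $i$ a cofibration and weak equivalence and $p$ a fibration; and it also factors as $f=p\circ i$ with $i$ a cofibration and $p$ a fibration and weak equivalence. Moreover, $\mathbf{Alg}_\infty$ has an initial and a terminal object, and all objects are fibrant and cofibrant: every morphism to a terminal object is a fibration, and every morphism from an initial object is a cofibration. -/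

import Mathlib

open CategoryTheory Limits MonoidalCategory

universe v u

set_option linter.unusedSectionVars false

namespace AInf

section Base

variable {C : Type u} [Category.{v} C]

/-- An additive functor commuting with filtered colimits commutes with coproducts. -/
theorem preservesCoproducts_of_filtered [Preadditive C] [HasFiniteBiproducts C]
    [HasColimitsOfSize.{0, 0} C] (F : C ⥤ C) [F.Additive]
    [PreservesFilteredColimitsOfSize.{0, 0} F] (α : Type) :
    PreservesColimitsOfShape (Discrete α) F where
  preservesColimit {K} := by
    classical
    obtain ⟨L, incl, hmap, hfac, hext, t, ht, hι⟩ :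
        ∃ (L : Finset (Discrete α) ⥤ C)
          (incl : ∀ (S : Finset (Discrete α)) (x : S), K.obj x.1 ⟶ L.obj S),
          (∀ (S T : Finset (Discrete α)) (h : S ⟶ T) (x : S),
            incl S x ≫ L.map h = incl T ⟨x.1, h.down.down x.2⟩) ∧
          (∀ (S : Finset (Discrete α)) (Z : C) (g : ∀ x : S, F.obj (K.obj x.1) ⟶ Z),
            ∃ d : F.obj (L.obj S) ⟶ Z, ∀ x, F.map (incl S x) ≫ d = g x) ∧
          (∀ (S : Finset (Discrete α)) (Z : C) (d d' : F.obj (L.obj S) ⟶ Z),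
            (∀ x, F.map (incl S x) ≫ d = F.map (incl S x) ≫ d') → d = d') ∧
          ∃ (t : K ⟶ (Functor.const _).obj (colimit L))
            (_ : IsColimit (Cocone.mk (colimit L) t)),
            ∀ j, t.app j = incl {j} ⟨j, by simp⟩ ≫ colimit.ι L {j} := by
      have hfin (S : Finset (Discrete α)) : IsColimit (F.mapCocone
          (colimit.cocone (Discrete.functor fun x : S => K.obj x.1))) :=
        isColimitOfPreserves F (colimit.isColimit _)
      refine ⟨CoproductsFromFiniteFiltered.liftToFinsetObj K,
        fun S x => Sigma.ι (fun x : S => K.obj x.1) x, ?_, ?_, ?_,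
        (CoproductsFromFiniteFiltered.liftToFinsetColimitCocone K).cocone.ι,
        (CoproductsFromFiniteFiltered.liftToFinsetColimitCocone K).isColimit, fun j => rfl⟩
      · intro S T h x
        exact colimit.ι_desc _ _
      · intro S Z g
        exact ⟨(hfin S).desc { pt := Z, ι := Discrete.natTrans fun x => g x.as },
          fun x => (hfin S).fac { pt := Z, ι := Discrete.natTrans fun x => g x.as } ⟨x⟩⟩
      · intro S Z d d' h
        exact (hfin S).hom_ext fun x => h x.as
    refine preservesColimit_of_preserves_colimit_cocone ht ?_
    let hL := isColimitOfPreserves F (colimit.isColimit L)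
    have hw (S : Finset (Discrete α)) (x : S) :
        t.app x.1 = incl S x ≫ colimit.ι L S := by
      rw [hι, ← colimit.w L (homOfLE (x := {x.1}) (y := S) (by simp)), ← Category.assoc, hmap]
    choose d hd using hfac
    refine
      { desc := fun s => hL.desc
          { pt := s.pt
            ι :=
              { app := fun S => d S s.pt fun x => s.ι.app x.1
                naturality := ?_ } }
        fac := ?_
        uniq := ?_ }
    · intro S T h
      apply hext
      intro x
      have h4 := congrArg F.map (hmap S T h x)
      rw [F.map_comp] at h4
      dsimp
      rw [Category.comp_id, hd, reassoc_of% h4, hd]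
    · intro s j
      have h5 := fun c => hL.fac c {j}
      dsimp at h5 ⊢
      rw [hι, F.map_comp, Category.assoc, h5]
      exact hd {j} _ _ ⟨j, _⟩
    · intro s m hm
      apply hL.hom_ext
      intro S
      apply hext
      intro x
      have h3 := hm x.1
      rw [hL.fac]
      dsimp at h3 ⊢
      rw [hd, ← h3, hw S x, F.map_comp, Category.assoc]

end Base

section Inst

variable (C : Type u) [Category.{v} C] [Preadditive C] [HasFiniteBiproducts C]
  [MonoidalCategory C] [MonoidalPreadditive C] [HasColimits C]
  [∀ X : C, PreservesFilteredColimits (tensorLeft X)]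
  [∀ X : C, PreservesFilteredColimits (tensorRight X)]

instance preservesCoproducts_tensorLeft (X : C) (α : Type) :
    PreservesColimitsOfShape (Discrete α) ((curriedTensor C).obj X) :=
  haveI := preservesSmallestFilteredColimits_of_preservesFilteredColimits.{v, v} (tensorLeft X)
  preservesCoproducts_of_filtered (tensorLeft X) α

instance preservesCoproducts_tensorRight (X : C) (α : Type) :
    PreservesColimitsOfShape (Discrete α) ((curriedTensor C).flip.obj X) :=
  haveI := preservesSmallestFilteredColimits_of_preservesFilteredColimits.{v, v} (tensorRight X)
  preservesCoproducts_of_filtered (tensorRight X) α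

noncomputable instance gradedMonoidal : MonoidalCategory (GradedObject ℤ C) :=
  GradedObject.monoidalCategory

end Inst
end AInf

namespace AInf

section Graded

variable {C : Type u} [Category.{v} C] [Preadditive C]

/-- Graded morphisms of degree `r`: families of morphisms `M^p ⟶ L^{p+r}`. -/
def GHom (M L : GradedObject ℤ C) (r : ℤ) : Type v :=
  ∀ p : ℤ, M p ⟶ L (p + r)

instance (M L : GradedObject ℤ C) (r : ℤ) : AddCommGroup (GHom M L r) :=
  inferInstanceAs (AddCommGroup (∀ p : ℤ, M p ⟶ L (p + r)))

namespace GHom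

variable {M L N K : GradedObject ℤ C} {r s t : ℤ}

/-- The component `M^p ⟶ L^q` of a graded morphism of degree `r`, where `q = p + r`. -/
def v (f : GHom M L r) (p q : ℤ) (h : p + r = q) : M p ⟶ L q :=
  f p ≫ eqToHom (by rw [h])

/-- The graded morphism with given components. -/
def mk (f : ∀ p q : ℤ, p + r = q → (M p ⟶ L q)) : GHom M L r := fun p => f p _ rfl

@[simp] theorem mk_v (f : ∀ p q : ℤ, p + r = q → (M p ⟶ L q)) (p q : ℤ) (h : p + r = q) :
    (mk f).v p q h = f p q h := by
  subst h
  simp [mk, v]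

theorem v_rfl (f : GHom M L r) (p : ℤ) : f.v p _ rfl = f p := by simp [v]

theorem ext {f g : GHom M L r} (h : ∀ p q hq, f.v p q hq = g.v p q hq) : f = g :=
  funext fun p => by simpa only [v_rfl] using h p _ rfl

@[simp] theorem zero_v (p q : ℤ) (h : p + r = q) : (0 : GHom M L r).v p q h = 0 :=
  zero_comp
@[simp] theorem add_v (f g : GHom M L r) (p q : ℤ) (h : p + r = q) :
    (f + g).v p q h = f.v p q h + g.v p q h := Preadditive.add_comp _ _ _ _ _ _
@[simp] theorem neg_v (f : GHom M L r) (p q : ℤ) (h : p + r = q) :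
    (-f).v p q h = -f.v p q h := Preadditive.neg_comp _ _
@[simp] theorem units_smul_v (n : ℤˣ) (f : GHom M L r) (p q : ℤ) (h : p + r = q) :
    (n • f).v p q h = n • f.v p q h :=
  Linear.units_smul_comp n (show M p ⟶ L (p + r) from f p) _

/-- A morphism of graded objects as a graded morphism of degree `0`. -/
def ofHom (φ : M ⟶ L) (hr : r = 0) : GHom M L r :=
  mk fun p q h => φ p ≫ eqToHom (by rw [← h, hr, add_zero])

theorem ofHom_v (φ : M ⟶ L) (hr : r = 0) (p : ℤ) (h : p + r = p) :
    (ofHom φ hr).v p p h = φ p := by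
  simp [ofHom]

/-- The composition of graded morphisms, in diagrammatic order. -/
def comp (f : GHom M L r) (g : GHom L N s) (h : r + s = t) : GHom M N t :=
  mk fun p q hq => f.v p (p + r) rfl ≫ g.v (p + r) q (by omega)

theorem comp_v (f : GHom M L r) (g : GHom L N s) (h : r + s = t) (p p' q : ℤ)
    (hp : p + r = p') (hq : p' + s = q) :
    (comp f g h).v p q (by omega) = f.v p p' hp ≫ g.v p' q hq := by
  subst hp
  simp [comp]

theorem comp_assoc {M L N K : GradedObject ℤ C} {a b c ab bc abc : ℤ} (f : GHom M L a)
    (g : GHom L N b) (h : GHom N K c) (hab : a + b = ab) (hbc : b + c = bc) (h1 : ab + c = abc) :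
    comp (comp f g hab) h h1 = comp f (comp g h hbc) (by omega) := by
  apply ext
  intro p q hq
  rw [comp_v _ _ _ p (p + ab) q rfl (by omega), comp_v _ _ _ p (p + a) _ rfl (by omega),
    comp_v _ _ _ p (p + a) q rfl (by omega), comp_v _ _ _ (p + a) (p + ab) q (by omega) (by omega),
    Category.assoc]

theorem ofHom_comp (φ : M ⟶ L) (ψ : L ⟶ N) (hr : r = 0) (hs : s = 0) (h : r + s = t) :
    comp (ofHom φ hr) (ofHom ψ hs) h = ofHom (φ ≫ ψ) (by omega) := by
  subst hr hs h
  apply ext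
  intro p q hq
  obtain rfl : q = p := by omega
  rw [comp_v _ _ _ q q q (by omega) (by omega)]
  simp only [ofHom_v]
  rfl

theorem id_comp (f : GHom M L r) (hs : s = 0) (h : s + r = t) (p q : ℤ) (hq : p + t = q) :
    (comp (ofHom (𝟙 M) hs) f h).v p q hq = f.v p q (by omega) := by
  rw [comp_v _ _ _ p p q (by omega) (by omega), ofHom_v]
  exact Category.id_comp _

theorem comp_id (f : GHom M L r) (hs : s = 0) (h : r + s = t) (p q : ℤ) (hq : p + t = q) :
    (comp f (ofHom (𝟙 L) hs) h).v p q hq = f.v p q (by omega) := by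
  rw [comp_v _ _ _ p q q (by omega) (by omega), ofHom_v]
  exact Category.comp_id _

theorem add_comp (f f' : GHom M L r) (g : GHom L N s) (h : r + s = t) :
    comp (f + f') g h = comp f g h + comp f' g h := by
  apply ext
  intro p q hq
  rw [add_v]
  simp only [comp_v _ _ h p (p + r) q rfl (by omega)]
  rw [add_v, Preadditive.add_comp]

theorem comp_add (f : GHom M L r) (g g' : GHom L N s) (h : r + s = t) :
    comp f (g + g') h = comp f g h + comp f g' h := by
  apply ext
  intro p q hq
  rw [add_v]
  simp only [comp_v _ _ h p (p + r) q rfl (by omega)]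
  rw [add_v, Preadditive.comp_add]

theorem smul_comp (n : ℤˣ) (f : GHom M L r) (g : GHom L N s) (h : r + s = t) :
    comp (n • f) g h = n • comp f g h := by
  apply ext
  intro p q hq
  rw [units_smul_v]
  simp only [comp_v _ _ h p (p + r) q rfl (by omega)]
  rw [units_smul_v, Linear.units_smul_comp]

theorem comp_smul (n : ℤˣ) (f : GHom M L r) (g : GHom L N s) (h : r + s = t) :
    comp f (n • g) h = n • comp f g h := by
  apply ext
  intro p q hq
  rw [units_smul_v]
  simp only [comp_v _ _ h p (p + r) q rfl (by omega)]
  rw [units_smul_v, Linear.comp_units_smul]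

end GHom
end Graded

section Tensor

variable {C : Type u} [Category.{v} C] [Preadditive C] [HasFiniteBiproducts C]
  [MonoidalCategory C] [MonoidalPreadditive C] [HasColimits C]
  [∀ X : C, PreservesFilteredColimits (tensorLeft X)]
  [∀ X : C, PreservesFilteredColimits (tensorRight X)]

open GradedObject.Monoidal

namespace GHom

variable {M M' M'' L L' L'' N N' : GradedObject ℤ C} {r s t r' s' t' : ℤ}

/-- The inclusion of a summand in a tensor product of graded objects. -/
noncomputable def inc (M L : GradedObject ℤ C) (p q n : ℤ) (h : p + q = n) :
    M p ⊗ L q ⟶ (M ⊗ L) n := ιTensorObj M L p q n h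

/-- The tensor product of graded morphisms, with the Koszul sign: on `M^p ⊗ L^q` it is
`(-1)^{ps} f^p ⊗ g^q`, where `s` is the degree of `g`. -/
noncomputable def tensor (f : GHom M M' r) (g : GHom L L' s) (h : r + s = t) :
    GHom (M ⊗ L) (M' ⊗ L') t :=
  mk fun n n' hn => tensorObjDesc (X₁ := M) (X₂ := L) fun p q hpq =>
    (p * s).negOnePow • ((f.v p (p + r) rfl ⊗ₘ g.v q (q + s) rfl) ≫
      inc M' L' (p + r) (q + s) n' (by omega))

theorem units_smul_tensor {W X Y Z : C} (n : ℤˣ) (f : W ⟶ X) (g : Y ⟶ Z) :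
    (n • f) ⊗ₘ g = n • (f ⊗ₘ g) := by
  obtain rfl | rfl := Int.units_eq_one_or n
  · simp
  · have := MonoidalPreadditive.add_tensor f (-f) g
    rw [add_neg_cancel, MonoidalPreadditive.zero_tensor] at this
    simpa using (neg_eq_of_add_eq_zero_right this.symm).symm

theorem tensor_units_smul {W X Y Z : C} (n : ℤˣ) (f : W ⟶ X) (g : Y ⟶ Z) :
    f ⊗ₘ (n • g) = n • (f ⊗ₘ g) := by
  obtain rfl | rfl := Int.units_eq_one_or n
  · simp
  · have := MonoidalPreadditive.tensor_add f g (-g)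
    rw [add_neg_cancel, MonoidalPreadditive.tensor_zero] at this
    simpa using (neg_eq_of_add_eq_zero_right this.symm).symm

theorem tensor_hom_ext {A : C} {n : ℤ} {a b : (M ⊗ L) n ⟶ A}
    (h : ∀ p q hq, inc M L p q n hq ≫ a = inc M L p q n hq ≫ b) : a = b :=
  tensorObj_ext a b h

theorem inc_tensor (f : GHom M M' r) (g : GHom L L' s) (h : r + s = t) (p q n n' p' q' : ℤ)
    (hpq : p + q = n) (hn : n + t = n') (hp : p + r = p') (hq : q + s = q') :
    inc M L p q n hpq ≫ (tensor f g h).v n n' hn =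
      (p * s).negOnePow • ((f.v p p' hp ⊗ₘ g.v q q' hq) ≫ inc M' L' p' q' n' (by omega)) := by
  subst hp hq
  rw [tensor, mk_v]
  exact ι_tensorObjDesc (X₁ := M) (X₂ := L) _ _ _ _

theorem inc_tensor_assoc (f : GHom M M' r) (g : GHom L L' s) (h : r + s = t)
    (p q n n' p' q' : ℤ) (hpq : p + q = n) (hn : n + t = n') (hp : p + r = p') (hq : q + s = q')
    {Z : C} (z : (M' ⊗ L') n' ⟶ Z) :
    inc M L p q n hpq ≫ (tensor f g h).v n n' hn ≫ z =
      ((p * s).negOnePow • ((f.v p p' hp ⊗ₘ g.v q q' hq) ≫ inc M' L' p' q' n' (by omega))) ≫ z := by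
  rw [← inc_tensor f g h p q n n' p' q' hpq hn hp hq, Category.assoc]

theorem inc_map (φ : M ⟶ M') (ψ : L ⟶ L') (p q n : ℤ) (h : p + q = n) :
    inc M L p q n h ≫ (φ ⊗ₘ ψ) n = (φ p ⊗ₘ ψ q) ≫ inc M' L' p q n h :=
  ι_tensorHom _ _ _ _ _ _

theorem tensor_hom_ext₃ {A : C} {n : ℤ} {a b : ((M ⊗ L) ⊗ N) n ⟶ A}
    (h : ∀ i j k hijk, (inc M L i j _ rfl ▷ N k) ≫ inc (M ⊗ L) N (i + j) k n hijk ≫ a =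
      (inc M L i j _ rfl ▷ N k) ≫ inc (M ⊗ L) N (i + j) k n hijk ≫ b) : a = b := by
  apply tensorObj₃'_ext (X₁ := M) (X₂ := L) (X₃ := N)
  intro i j k hijk
  exact (Category.assoc _ _ _).trans ((h i j k hijk).trans (Category.assoc _ _ _).symm)

theorem inc_assoc (i j k n ij jk : ℤ) (hij : i + j = ij) (hjk : j + k = jk) (h : ij + k = n) :
    (inc M L i j ij hij ▷ N k) ≫ inc (M ⊗ L) N ij k n h ≫ (α_ M L N).hom n =
      (α_ _ _ _).hom ≫ (M i ◁ inc L N j k jk hjk) ≫ inc M (L ⊗ N) i jk n (by omega) := by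
  subst hij hjk
  exact (Category.assoc _ _ _).symm.trans
    (ιTensorObj₃'_associator_hom (X₁ := M) (X₂ := L) (X₃ := N) i j k n h)

theorem inc_assoc_assoc (i j k n ij jk : ℤ) (hij : i + j = ij) (hjk : j + k = jk)
    (h : ij + k = n) {Z : C} (z : (M ⊗ L ⊗ N) n ⟶ Z) :
    (inc M L i j ij hij ▷ N k) ≫ inc (M ⊗ L) N ij k n h ≫ (α_ M L N).hom n ≫ z =
      (α_ _ _ _).hom ≫ (M i ◁ inc L N j k jk hjk) ≫ inc M (L ⊗ N) i jk n (by omega) ≫ z := by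
  have h1 := congrArg (fun x => x ≫ z) (inc_assoc (M := M) (L := L) (N := N) i j k n ij jk hij hjk h)
  simpa only [Category.assoc] using h1

theorem ofHom_tensor (φ : M ⟶ M') (ψ : L ⟶ L') (hr : r = 0) (hs : s = 0) (h : r + s = t) :
    tensor (ofHom φ hr) (ofHom ψ hs) h = ofHom (φ ⊗ₘ ψ) (by omega) := by
  subst hr hs h
  apply ext
  intro n n' hn
  obtain rfl : n' = n := by omega
  apply tensor_hom_ext
  intro p q hpq
  rw [inc_tensor _ _ _ p q n' n' p q hpq hn (by omega) (by omega), ofHom_v, ofHom_v, ofHom_v,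
    inc_map]
  simp

theorem tensor_comp_tensor (f : GHom M M' r) (f' : GHom M' M'' r') (g : GHom L L' s)
    (g' : GHom L' L'' s') (h : r + s = t) (h' : r' + s' = t') {u a b : ℤ} (hu : t + t' = u)
    (ha : r + r' = a) (hb : s + s' = b) :
    comp (tensor f g h) (tensor f' g' h') hu =
      (r * s').negOnePow • tensor (comp f f' ha) (comp g g' hb) (by omega) := by
  apply ext
  intro n n' hn
  apply tensor_hom_ext
  intro p q hpq
  rw [comp_v _ _ _ n (n + t) n' rfl (by omega),
    inc_tensor_assoc _ _ _ p q n (n + t) (p + r) (q + s) hpq rfl rfl rfl, units_smul_v,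
    Linear.comp_units_smul,
    inc_tensor _ _ _ p q n n' (p + a) (q + b) hpq hn rfl rfl,
    comp_v _ _ _ p (p + r) (p + a) rfl (by omega), comp_v _ _ _ q (q + s) (q + b) rfl (by omega),
    Linear.units_smul_comp, Category.assoc,
    inc_tensor _ _ _ (p + r) (q + s) (n + t) n' (p + a) (q + b) (by omega) (by omega) (by omega)
      (by omega), Linear.comp_units_smul, smul_smul, smul_smul, ← Int.negOnePow_add,
    ← Int.negOnePow_add, ← MonoidalCategory.tensorHom_comp_tensorHom, Category.assoc]
  congr 2
  subst hb
  ring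

theorem add_tensor (f f' : GHom M M' r) (g : GHom L L' s) (h : r + s = t) :
    tensor (f + f') g h = tensor f g h + tensor f' g h := by
  apply ext
  intro n n' hn
  apply tensor_hom_ext
  intro p q hpq
  rw [add_v, Preadditive.comp_add]
  simp only [inc_tensor _ _ _ p q n n' _ _ hpq hn rfl rfl]
  rw [add_v, MonoidalPreadditive.add_tensor, Preadditive.add_comp, smul_add]

theorem tensor_add (f : GHom M M' r) (g g' : GHom L L' s) (h : r + s = t) :
    tensor f (g + g') h = tensor f g h + tensor f g' h := by
  apply ext
  intro n n' hn
  apply tensor_hom_ext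
  intro p q hpq
  rw [add_v, Preadditive.comp_add]
  simp only [inc_tensor _ _ _ p q n n' _ _ hpq hn rfl rfl]
  rw [add_v, MonoidalPreadditive.tensor_add, Preadditive.add_comp, smul_add]

theorem tensor_assoc {a b c ab bc abc : ℤ} {M M' L L' N N' : GradedObject ℤ C} (f : GHom M M' a)
    (g : GHom L L' b) (h : GHom N N' c) (hab : a + b = ab) (hbc : b + c = bc) (habc : ab + c = abc)
    {z : ℤ} (hz : z = 0) :
    comp (tensor (tensor f g hab) h habc) (ofHom (α_ M' L' N').hom hz) (t := abc) (by omega) =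
      comp (ofHom (α_ M L N).hom hz) (tensor f (tensor g h hbc) (t := abc) (by omega))
        (by omega) := by
  apply ext
  intro n n' hn
  apply tensor_hom_ext₃
  intro i j k hijk
  rw [comp_v _ _ _ n n' n' hn (by omega), comp_v _ _ _ n n n' (by omega) hn, ofHom_v, ofHom_v]
  rw [inc_tensor_assoc _ _ _ (i + j) k n n' (i + j + ab) (k + c) hijk hn rfl rfl]
  rw [inc_assoc_assoc i j k n _ _ rfl rfl hijk]
  rw [inc_tensor _ _ _ i (j + k) n n' (i + a) (j + k + bc) (by omega) hn rfl rfl]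
  simp only [Linear.comp_units_smul, Linear.units_smul_comp, Category.assoc]
  rw [← MonoidalCategory.tensorHom_id, MonoidalCategory.tensorHom_comp_tensorHom_assoc,
    inc_tensor _ _ _ i j (i + j) _ (i + a) (j + b) rfl rfl rfl rfl,
    ← MonoidalCategory.id_tensorHom, MonoidalCategory.tensorHom_comp_tensorHom_assoc,
    inc_tensor _ _ _ j k (j + k) _ (j + b) (k + c) rfl rfl rfl rfl]
  rw [units_smul_tensor, tensor_units_smul]
  simp only [Linear.units_smul_comp, Linear.comp_units_smul, smul_smul, ← Int.negOnePow_add]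
  have e1 : ((f.v i (i + a) rfl ⊗ₘ g.v j (j + b) rfl) ≫
      inc M' L' (i + a) (j + b) (i + j + ab) (by omega) ⊗ₘ 𝟙 (N k) ≫ h.v k (k + c) rfl) =
      ((f.v i (i + a) rfl ⊗ₘ g.v j (j + b) rfl) ⊗ₘ h.v k (k + c) rfl) ≫
        (inc M' L' (i + a) (j + b) (i + j + ab) (by omega) ▷ N' (k + c)) := by
    rw [← MonoidalCategory.tensorHom_id, MonoidalCategory.tensorHom_comp_tensorHom,
      Category.id_comp, Category.comp_id]
  have e2 : (𝟙 (M i) ≫ f.v i (i + a) rfl ⊗ₘ (g.v j (j + b) rfl ⊗ₘ h.v k (k + c) rfl) ≫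
      inc L' N' (j + b) (k + c) (j + k + bc) (by omega)) =
      (f.v i (i + a) rfl ⊗ₘ g.v j (j + b) rfl ⊗ₘ h.v k (k + c) rfl) ≫
        (M' (i + a) ◁ inc L' N' (j + b) (k + c) (j + k + bc) (by omega)) := by
    rw [← MonoidalCategory.id_tensorHom, MonoidalCategory.tensorHom_comp_tensorHom,
      Category.id_comp, Category.comp_id]
  rw [e1, e2, Category.assoc, Category.assoc,
    inc_assoc (i + a) (j + b) (k + c) n' (i + j + ab) (j + k + bc) (by omega) (by omega)
      (by omega), MonoidalCategory.associator_naturality_assoc]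
  congr 2
  subst hbc
  ring

theorem smul_tensor (u : ℤˣ) (f : GHom M M' r) (g : GHom L L' s) (h : r + s = t) :
    tensor (u • f) g h = u • tensor f g h := by
  apply ext
  intro n n' hn
  apply tensor_hom_ext
  intro p q hpq
  rw [units_smul_v, Linear.comp_units_smul, inc_tensor _ _ h p q n n' _ _ hpq hn rfl rfl,
    inc_tensor _ _ h p q n n' _ _ hpq hn rfl rfl, units_smul_v, units_smul_tensor,
    Linear.units_smul_comp, smul_comm]

theorem tensor_smul (u : ℤˣ) (f : GHom M M' r) (g : GHom L L' s) (h : r + s = t) :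
    tensor f (u • g) h = u • tensor f g h := by
  apply ext
  intro n n' hn
  apply tensor_hom_ext
  intro p q hpq
  rw [units_smul_v, Linear.comp_units_smul, inc_tensor _ _ h p q n n' _ _ hpq hn rfl rfl,
    inc_tensor _ _ h p q n n' _ _ hpq hn rfl rfl, units_smul_v, tensor_units_smul,
    Linear.units_smul_comp, smul_comm]

/-- The canonical morphism from the unit to the degree zero part of the graded unit. -/
noncomputable def unit₀ : 𝟙_ C ⟶ (𝟙_ (GradedObject ℤ C)) 0 := tensorUnit₀.inv

theorem leftUnitor_inv_eq (M : GradedObject ℤ C) (n : ℤ) :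
    (λ_ M).inv n = (λ_ (M n)).inv ≫ unit₀ ▷ (M n) ≫
      inc (𝟙_ (GradedObject ℤ C)) M 0 n n (zero_add n) :=
  leftUnitor_inv_apply M n

theorem rightUnitor_inv_eq (M : GradedObject ℤ C) (n : ℤ) :
    (ρ_ M).inv n = (ρ_ (M n)).inv ≫ (M n) ◁ unit₀ ≫
      inc M (𝟙_ (GradedObject ℤ C)) n 0 n (add_zero n) :=
  rightUnitor_inv_apply M n

theorem leftUnitor_inv_nat (f : GHom M L r) {z : ℤ} (hz : z = 0) :
    comp f (ofHom (λ_ L).inv hz) (t := r) (by omega) =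
      comp (ofHom (λ_ M).inv hz) (tensor (ofHom (𝟙 (𝟙_ (GradedObject ℤ C))) hz) f (t := r)
        (by omega)) (by omega) := by
  apply ext
  intro p q hq
  rw [comp_v _ _ _ p q q hq (by omega), comp_v _ _ _ p p q (by omega) hq, ofHom_v, ofHom_v,
    leftUnitor_inv_eq, leftUnitor_inv_eq]
  simp only [Category.assoc]
  rw [inc_tensor _ _ _ 0 p p q 0 q (by omega) hq (by omega) hq, ofHom_v]
  simp only [zero_mul, Int.negOnePow_zero, one_smul]
  have e : (𝟙 (𝟙_ (GradedObject ℤ C)) : 𝟙_ (GradedObject ℤ C) ⟶ _) 0 = 𝟙 _ := rfl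
  rw [e, MonoidalCategory.id_tensorHom, ← MonoidalCategory.whisker_exchange_assoc,
    MonoidalCategory.leftUnitor_inv_naturality_assoc]

theorem rightUnitor_inv_nat (f : GHom M L r) {z : ℤ} (hz : z = 0) :
    comp f (ofHom (ρ_ L).inv hz) (t := r) (by omega) =
      comp (ofHom (ρ_ M).inv hz) (tensor f (ofHom (𝟙 (𝟙_ (GradedObject ℤ C))) hz) (t := r)
        (by omega)) (by omega) := by
  apply ext
  intro p q hq
  rw [comp_v _ _ _ p q q hq (by omega), comp_v _ _ _ p p q (by omega) hq, ofHom_v, ofHom_v,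
    rightUnitor_inv_eq, rightUnitor_inv_eq]
  simp only [Category.assoc]
  rw [inc_tensor _ _ _ p 0 p q q 0 (by omega) hq hq (by omega), ofHom_v]
  subst hz
  simp only [mul_zero, Int.negOnePow_zero, one_smul]
  have e : (𝟙 (𝟙_ (GradedObject ℤ C)) : 𝟙_ (GradedObject ℤ C) ⟶ _) 0 = 𝟙 _ := rfl
  rw [e, MonoidalCategory.tensorHom_id, MonoidalCategory.whisker_exchange_assoc,
    MonoidalCategory.rightUnitor_inv_naturality_assoc]

end GHom
end Tensor
end AInf

namespace AInf

namespace GHom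

section

variable {C : Type u} [Category.{v} C] [Preadditive C] {M L N : GradedObject ℤ C} {r s t : ℤ}

theorem zero_comp (g : GHom L N s) (h : r + s = t) : comp (0 : GHom M L r) g h = 0 := by
  have e := add_comp (0 : GHom M L r) 0 g h
  rw [add_zero] at e
  exact left_eq_add.mp e

theorem comp_zero (f : GHom M L r) (h : r + s = t) : comp f (0 : GHom L N s) h = 0 := by
  have e := comp_add f (0 : GHom L N s) 0 h
  rw [add_zero] at e
  exact left_eq_add.mp e

end

section

variable {C : Type u} [Category.{v} C] [Preadditive C] [HasFiniteBiproducts C]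
  [MonoidalCategory C] [MonoidalPreadditive C] [HasColimits C]
  [∀ X : C, PreservesFilteredColimits (tensorLeft X)]
  [∀ X : C, PreservesFilteredColimits (tensorRight X)]
  {M M' M'' L L' L'' N N' : GradedObject ℤ C} {r s t r' s' t' : ℤ}

theorem zero_tensor (g : GHom L L' s) (h : r + s = t) : tensor (0 : GHom M M' r) g h = 0 := by
  have e := add_tensor (0 : GHom M M' r) 0 g h
  rw [add_zero] at e
  exact left_eq_add.mp e

theorem tensor_zero (f : GHom M M' r) (h : r + s = t) : tensor f (0 : GHom L L' s) h = 0 := by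
  have e := tensor_add f (0 : GHom L L' s) 0 h
  rw [add_zero] at e
  exact left_eq_add.mp e

theorem comp_aux (f : GHom M M' r) (f' : GHom M' M'' r') (g : GHom L L' s)
    (g' : GHom L' L'' s') (h : r + s = t) (h' : r' + s' = t') {u a b : ℤ} (hu : t + t' = u)
    (ha : r + r' = a) (hb : s + s' = b) (hab : a + b = u) {x x' x'' : ℤ}
    (hx : Even (x + x' + r * s' - x'')) :
    comp (x.negOnePow • tensor f g h) (x'.negOnePow • tensor f' g' h') hu =
      x''.negOnePow • tensor (comp f f' ha) (comp g g' hb) hab := by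
  rw [smul_comp, comp_smul, tensor_comp_tensor f f' g g' h h' hu ha hb, smul_smul, smul_smul,
    ← Int.negOnePow_add, ← Int.negOnePow_add, (Int.negOnePow_eq_iff _ _).2]
  convert hx using 1

theorem assoc_aux {a b c ab bc z z' w : ℤ}
    (f : GHom M M' a) (g : GHom L L' b) (h : GHom N N' c) (hab : a + b = ab) (hbc : b + c = bc)
    (ht : ab + c = t) (ht' : a + bc = t') (hz : z = 0) (hz' : z' = 0) (hw : t + z = w)
    (hw' : z' + t' = w) {x x' y y' : ℤ} (hx : Even (x + x' - (y + y'))) :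
    comp (x.negOnePow • tensor (x'.negOnePow • tensor f g hab) h ht)
        (ofHom (α_ M' L' N').hom hz) hw =
      comp (ofHom (α_ M L N).hom hz')
        (y.negOnePow • tensor f (y'.negOnePow • tensor g h hbc) ht') hw' := by
  subst hz hz'
  obtain rfl : t = w := by omega
  obtain rfl : t = t' := by omega
  rw [smul_tensor, tensor_smul, smul_smul, smul_smul, smul_comp, comp_smul,
    ← Int.negOnePow_add, ← Int.negOnePow_add, tensor_assoc f g h hab hbc ht rfl,
    (Int.negOnePow_eq_iff _ _).2 hx]

theorem left_aux {z z' w : ℤ} (f : GHom M L r) (hz : z = 0)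
    (hz' : z' = 0) (hw : r + z = w) (ht' : t' + r = t) (ht'' : t' = 0) (hw' : z' + t = w)
    {x : ℤ} (hx : Even x) :
    comp f (ofHom (λ_ L).inv hz) hw =
      comp (ofHom (λ_ M).inv hz') (x.negOnePow • tensor
        (ofHom (𝟙 (𝟙_ (GradedObject ℤ C))) ht'') f ht') hw' := by
  subst hz hz' ht''
  obtain rfl : r = w := by omega
  obtain rfl : t = r := by omega
  rw [Int.negOnePow_even x hx, one_smul]
  exact leftUnitor_inv_nat f rfl

theorem right_aux {z z' w : ℤ} (f : GHom M L r) (hz : z = 0)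
    (hz' : z' = 0) (hw : r + z = w) (ht' : r + t' = t) (ht'' : t' = 0) (hw' : z' + t = w)
    {x : ℤ} (hx : Even x) :
    comp f (ofHom (ρ_ L).inv hz) hw =
      comp (ofHom (ρ_ M).inv hz') (x.negOnePow • tensor f
        (ofHom (𝟙 (𝟙_ (GradedObject ℤ C))) ht'') ht') hw' := by
  subst hz hz' ht''
  obtain rfl : r = w := by omega
  obtain rfl : t = r := by omega
  rw [Int.negOnePow_even x hx, one_smul]
  exact rightUnitor_inv_nat f rfl

end

end GHom

/-- A graded object together with an integer, thought of as the graded object shifted by that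
integer. Morphisms are pairs `f + ε d` with `f` of degree zero and `d` of degree one (with respect
to the shifts), `ε` being an odd variable of square zero. This is an auxiliary device that absorbs
the Koszul signs and makes coderivations into morphisms. -/
structure Lab (C : Type u) [Category.{v} C] where
  obj : GradedObject ℤ C
  deg : ℤ

section Lab

variable {C : Type u} [Category.{v} C] [Preadditive C]

/-- The morphisms between labelled graded objects. -/
structure LabHom (X Y : Lab C) where
  e : GHom X.obj Y.obj (Y.deg - X.deg)
  o : GHom X.obj Y.obj (Y.deg - X.deg + 1)

theorem LabHom.ext' {X Y : Lab C} {f g : LabHom X Y} (h : f.e = g.e) (h' : f.o = g.o) : f = g := by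
  cases f; cases g; cases h; cases h'; rfl

instance (X Y : Lab C) : Add (LabHom X Y) := ⟨fun f g => ⟨f.e + g.e, f.o + g.o⟩⟩
instance (X Y : Lab C) : Zero (LabHom X Y) := ⟨⟨0, 0⟩⟩
instance (X Y : Lab C) : Neg (LabHom X Y) := ⟨fun f => ⟨-f.e, -f.o⟩⟩

instance (X Y : Lab C) : AddCommGroup (LabHom X Y) where
  add_assoc _ _ _ := LabHom.ext' (add_assoc _ _ _) (add_assoc _ _ _)
  zero_add _ := LabHom.ext' (zero_add _) (zero_add _)
  add_zero _ := LabHom.ext' (add_zero _) (add_zero _)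
  add_comm _ _ := LabHom.ext' (add_comm _ _) (add_comm _ _)
  neg_add_cancel _ := LabHom.ext' (neg_add_cancel _) (neg_add_cancel _)
  nsmul := nsmulRec
  zsmul := zsmulRec

instance : Category (Lab C) where
  Hom X Y := LabHom X Y
  id X := ⟨GHom.ofHom (𝟙 X.obj) (sub_self _), 0⟩
  comp f g := ⟨GHom.comp f.e g.e (by omega),
    GHom.comp f.e g.o (by omega) + GHom.comp f.o g.e (by omega)⟩
  id_comp f := LabHom.ext' (GHom.ext fun p q hq => GHom.id_comp f.e (sub_self _) (by omega) p q hq) (by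
    dsimp only
    rw [GHom.zero_comp, add_zero]
    exact GHom.ext fun p q hq => GHom.id_comp f.o (sub_self _) (by omega) p q hq)
  comp_id f := LabHom.ext' (GHom.ext fun p q hq => GHom.comp_id f.e (sub_self _) (by omega) p q hq) (by
    dsimp only
    rw [GHom.comp_zero, zero_add]
    exact GHom.ext fun p q hq => GHom.comp_id f.o (sub_self _) (by omega) p q hq)
  assoc {W X Y Z} f g h := LabHom.ext' (GHom.comp_assoc _ _ _ (by omega) (by omega) (by omega)) (by
    dsimp only
    rw [GHom.add_comp, GHom.comp_add, ← add_assoc]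
    rw [GHom.comp_assoc f.e g.e h.o _ (bc := Z.deg - X.deg + 1) (by omega),
      GHom.comp_assoc f.e g.o h.e _ (bc := Z.deg - X.deg + 1) (by omega),
      GHom.comp_assoc f.o g.e h.e _ (bc := Z.deg - X.deg) (by omega)])

namespace Lab

/-- Reinterpretation of a pair of graded morphisms. -/
def mkHom {X Y : Lab C} (f : LabHom X Y) : X ⟶ Y := f

/-- The even part. -/
def ev {X Y : Lab C} (f : X ⟶ Y) : GHom X.obj Y.obj (Y.deg - X.deg) := LabHom.e f

/-- The odd part. -/
def od {X Y : Lab C} (f : X ⟶ Y) : GHom X.obj Y.obj (Y.deg - X.deg + 1) := LabHom.o f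

theorem hom_ext {X Y : Lab C} {f g : X ⟶ Y} (h : ev f = ev g) (h' : od f = od g) : f = g :=
  LabHom.ext' h h'

instance : Preadditive (Lab C) where
  homGroup X Y := inferInstanceAs (AddCommGroup (LabHom X Y))
  add_comp _ _ _ f f' g := LabHom.ext' (GHom.add_comp _ _ _ (by omega)) (by
    change GHom.comp (f.e + f'.e) g.o _ + GHom.comp (f.o + f'.o) g.e _ = _
    rw [GHom.add_comp, GHom.add_comp]
    exact add_add_add_comm _ _ _ _)
  comp_add _ _ _ f g g' := LabHom.ext' (GHom.comp_add _ _ _ (by omega)) (by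
    change GHom.comp f.e (g.o + g'.o) _ + GHom.comp f.o (g.e + g'.e) _ = _
    rw [GHom.comp_add, GHom.comp_add]
    exact add_add_add_comm _ _ _ _)

theorem ev_add {X Y : Lab C} (f g : X ⟶ Y) : ev (f + g) = ev f + ev g := rfl
theorem od_add {X Y : Lab C} (f g : X ⟶ Y) : od (f + g) = od f + od g := rfl
theorem ev_comp {X Y Z : Lab C} (f : X ⟶ Y) (g : Y ⟶ Z) :
    ev (f ≫ g) = GHom.comp (ev f) (ev g) (by omega) := rfl
theorem od_comp {X Y Z : Lab C} (f : X ⟶ Y) (g : Y ⟶ Z) :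
    od (f ≫ g) = GHom.comp (ev f) (od g) (by omega) + GHom.comp (od f) (ev g) (by omega) := rfl

/-- A morphism of graded objects as a morphism of labelled ones. -/
def ofH {X Y : Lab C} (φ : X.obj ⟶ Y.obj) (h : Y.deg - X.deg = 0) : X ⟶ Y :=
  mkHom ⟨GHom.ofHom φ h, 0⟩

theorem ev_ofH {X Y : Lab C} (φ : X.obj ⟶ Y.obj) (h : Y.deg - X.deg = 0) :
    ev (ofH φ h) = GHom.ofHom φ h := rfl
theorem od_ofH {X Y : Lab C} (φ : X.obj ⟶ Y.obj) (h : Y.deg - X.deg = 0) :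
    od (ofH φ h) = 0 := rfl

theorem od_comp_ofH {X Y Z : Lab C} (f : X ⟶ Y) (φ : Y.obj ⟶ Z.obj) (h : Z.deg - Y.deg = 0) :
    od (f ≫ ofH φ h) = GHom.comp (od f) (GHom.ofHom φ h) (by omega) := by
  rw [od_comp, od_ofH, GHom.comp_zero, ev_ofH]
  exact zero_add _

theorem od_ofH_comp {X Y Z : Lab C} (f : Y ⟶ Z) (φ : X.obj ⟶ Y.obj) (h : Y.deg - X.deg = 0) :
    od (ofH φ h ≫ f) = GHom.comp (GHom.ofHom φ h) (od f) (by omega) := by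
  rw [od_comp, od_ofH, GHom.zero_comp, ev_ofH]
  exact add_zero _

theorem ofH_comp {X Y Z : Lab C} (φ : X.obj ⟶ Y.obj) (h : Y.deg - X.deg = 0)
    (ψ : Y.obj ⟶ Z.obj) (h' : Z.deg - Y.deg = 0) :
    ofH φ h ≫ ofH ψ h' = ofH (X := X) (Y := Z) (φ ≫ ψ) (by omega) :=
  hom_ext (GHom.ofHom_comp _ _ h h' (by omega)) (by
    rw [od_comp, od_ofH, od_ofH, od_ofH, GHom.comp_zero, GHom.zero_comp, add_zero])

theorem id_ofH (X : Lab C) : 𝟙 X = ofH (𝟙 X.obj) (sub_self _) := rfl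

/-- An isomorphism of graded objects as an isomorphism of labelled ones. -/
def isoMk {X Y : Lab C} (e : X.obj ≅ Y.obj) (h : Y.deg - X.deg = 0) : X ≅ Y where
  hom := ofH e.hom h
  inv := ofH e.inv (by omega)
  hom_inv_id := (ofH_comp _ _ _ _).trans (by rw [e.hom_inv_id]; rfl)
  inv_hom_id := (ofH_comp _ _ _ _).trans (by rw [e.inv_hom_id]; rfl)

end Lab

end Lab

section LabMon

variable {C : Type u} [Category.{v} C] [Preadditive C] [HasFiniteBiproducts C]
  [MonoidalCategory C] [MonoidalPreadditive C] [HasColimits C]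
  [∀ X : C, PreservesFilteredColimits (tensorLeft X)]
  [∀ X : C, PreservesFilteredColimits (tensorRight X)]

namespace Lab

/-- The tensor product of labelled morphisms. -/
noncomputable def tens {X X' Y Y' : Lab C} (f : X ⟶ X') (g : Y ⟶ Y') :
    (Lab.mk (X.obj ⊗ Y.obj) (X.deg + Y.deg)) ⟶ (Lab.mk (X'.obj ⊗ Y'.obj) (X'.deg + Y'.deg)) :=
  mkHom
    { e := (X.deg * (Y'.deg - Y.deg)).negOnePow • GHom.tensor (ev f) (ev g)
        (t := X'.deg + Y'.deg - (X.deg + Y.deg)) (by ring)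
      o := (X.deg * (Y'.deg - Y.deg + 1)).negOnePow • GHom.tensor (ev f) (od g)
            (t := X'.deg + Y'.deg - (X.deg + Y.deg) + 1) (by ring) +
          (X.deg * (Y'.deg - Y.deg) + Y'.deg).negOnePow • GHom.tensor (od f) (ev g)
            (t := X'.deg + Y'.deg - (X.deg + Y.deg) + 1) (by ring) }

theorem ev_tens {X X' Y Y' : Lab C} (f : X ⟶ X') (g : Y ⟶ Y') : ev (tens f g) =
    (X.deg * (Y'.deg - Y.deg)).negOnePow • GHom.tensor (ev f) (ev g)
        (t := X'.deg + Y'.deg - (X.deg + Y.deg)) (by ring) := rfl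

theorem od_tens {X X' Y Y' : Lab C} (f : X ⟶ X') (g : Y ⟶ Y') : od (tens f g) =
    (X.deg * (Y'.deg - Y.deg + 1)).negOnePow • GHom.tensor (ev f) (od g)
            (t := X'.deg + Y'.deg - (X.deg + Y.deg) + 1) (by ring) +
          (X.deg * (Y'.deg - Y.deg) + Y'.deg).negOnePow • GHom.tensor (od f) (ev g)
            (t := X'.deg + Y'.deg - (X.deg + Y.deg) + 1) (by ring) := rfl

theorem od_tens_ofH {X X' Y Y' : Lab C} (f : X ⟶ X') (φ : Y.obj ⟶ Y'.obj)
    (h : Y'.deg - Y.deg = 0) : od (tens f (ofH φ h)) =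
      (X.deg * (Y'.deg - Y.deg) + Y'.deg).negOnePow • GHom.tensor (od f) (GHom.ofHom φ h)
            (t := X'.deg + Y'.deg - (X.deg + Y.deg) + 1) (by ring) := by
  rw [od_tens, od_ofH, GHom.tensor_zero, smul_zero, ev_ofH]
  exact zero_add _

theorem od_ofH_tens {X X' Y Y' : Lab C} (φ : X.obj ⟶ X'.obj) (h : X'.deg - X.deg = 0)
    (g : Y ⟶ Y') : od (tens (ofH φ h) g) =
      (X.deg * (Y'.deg - Y.deg + 1)).negOnePow • GHom.tensor (GHom.ofHom φ h) (od g)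
            (t := X'.deg + Y'.deg - (X.deg + Y.deg) + 1) (by ring) := by
  rw [od_tens, od_ofH, GHom.zero_tensor, smul_zero, ev_ofH]
  exact add_zero _

theorem tens_comp {X X' X'' Y Y' Y'' : Lab C} (f : X ⟶ X') (g : Y ⟶ Y') (f' : X' ⟶ X'')
    (g' : Y' ⟶ Y'') : tens f g ≫ tens f' g' = tens (f ≫ f') (g ≫ g') := by
  apply hom_ext
  · refine GHom.comp_aux _ _ _ _ (by ring) (by ring) (by dsimp; ring) (by ring) (by ring)
      (by dsimp; ring) ?_
    refine ⟨(X'.deg - X.deg) * (Y''.deg - Y'.deg), ?_⟩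
    ring
  · have h1 := GHom.comp_aux (ev f) (ev f') (ev g) (od g')
      (t := X'.deg + Y'.deg - (X.deg + Y.deg)) (by ring)
      (t' := X''.deg + Y''.deg - (X'.deg + Y'.deg) + 1) (by ring)
      (u := X''.deg + Y''.deg - (X.deg + Y.deg) + 1) (a := X''.deg - X.deg)
      (b := Y''.deg - Y.deg + 1) (by ring) (by ring) (by ring) (by ring)
      (x := X.deg * (Y'.deg - Y.deg)) (x' := X'.deg * (Y''.deg - Y'.deg + 1))
      (x'' := X.deg * (Y''.deg - Y.deg + 1))
      ⟨(X'.deg - X.deg) * (Y''.deg - Y'.deg + 1), by ring⟩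
    have h2 := GHom.comp_aux (ev f) (od f') (ev g) (ev g')
      (t := X'.deg + Y'.deg - (X.deg + Y.deg)) (by ring)
      (t' := X''.deg + Y''.deg - (X'.deg + Y'.deg) + 1) (by ring)
      (u := X''.deg + Y''.deg - (X.deg + Y.deg) + 1) (a := X''.deg - X.deg + 1)
      (b := Y''.deg - Y.deg) (by ring) (by ring) (by ring) (by ring)
      (x := X.deg * (Y'.deg - Y.deg)) (x' := X'.deg * (Y''.deg - Y'.deg) + Y''.deg)
      (x'' := X.deg * (Y''.deg - Y.deg) + Y''.deg)
      ⟨(X'.deg - X.deg) * (Y''.deg - Y'.deg), by ring⟩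
    have h3 := GHom.comp_aux (ev f) (ev f') (od g) (ev g')
      (t := X'.deg + Y'.deg - (X.deg + Y.deg) + 1) (by ring)
      (t' := X''.deg + Y''.deg - (X'.deg + Y'.deg)) (by ring)
      (u := X''.deg + Y''.deg - (X.deg + Y.deg) + 1) (a := X''.deg - X.deg)
      (b := Y''.deg - Y.deg + 1) (by ring) (by ring) (by ring) (by ring)
      (x := X.deg * (Y'.deg - Y.deg + 1)) (x' := X'.deg * (Y''.deg - Y'.deg))
      (x'' := X.deg * (Y''.deg - Y.deg + 1))
      ⟨(X'.deg - X.deg) * (Y''.deg - Y'.deg), by ring⟩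
    have h4 := GHom.comp_aux (od f) (ev f') (ev g) (ev g')
      (t := X'.deg + Y'.deg - (X.deg + Y.deg) + 1) (by ring)
      (t' := X''.deg + Y''.deg - (X'.deg + Y'.deg)) (by ring)
      (u := X''.deg + Y''.deg - (X.deg + Y.deg) + 1) (a := X''.deg - X.deg + 1)
      (b := Y''.deg - Y.deg) (by ring) (by ring) (by ring) (by ring)
      (x := X.deg * (Y'.deg - Y.deg) + Y'.deg) (x' := X'.deg * (Y''.deg - Y'.deg))
      (x'' := X.deg * (Y''.deg - Y.deg) + Y''.deg)
      ⟨(X'.deg - X.deg) * (Y''.deg - Y'.deg), by ring⟩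
    rw [od_comp, od_tens, od_tens, ev_tens, ev_tens, od_tens, GHom.comp_add, GHom.add_comp,
      od_comp, od_comp, GHom.tensor_add, GHom.add_tensor, smul_add, smul_add]
    exact (congrArg₂ (· + ·) (congrArg₂ (· + ·) h1 h2) (congrArg₂ (· + ·) h3 h4)).trans
      (add_add_add_comm _ _ _ _)

theorem tens_ofH {X X' Y Y' : Lab C} (φ : X.obj ⟶ X'.obj) (ψ : Y.obj ⟶ Y'.obj)
    (h : X'.deg - X.deg = 0) (h' : Y'.deg - Y.deg = 0) :
    tens (ofH φ h) (ofH ψ h') = ofH (φ ⊗ₘ ψ) (by dsimp; omega) := by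
  apply hom_ext
  · have e : (X.deg * (Y'.deg - Y.deg)).negOnePow = 1 := by rw [h']; simp
    rw [ev_tens, e, one_smul]
    exact GHom.ofHom_tensor _ _ h h' _
  · rw [od_tens, od_ofH, od_ofH, od_ofH, GHom.tensor_zero, GHom.zero_tensor, smul_zero, smul_zero,
      add_zero]

theorem id_tens (X Y : Lab C) : tens (𝟙 X) (𝟙 Y) = 𝟙 _ := by
  rw [id_ofH, id_ofH, tens_ofH, id_ofH]
  simp only [id_tensorHom_id]

end Lab

noncomputable instance : MonoidalCategoryStruct (Lab C) where
  tensorObj X Y := ⟨X.obj ⊗ Y.obj, X.deg + Y.deg⟩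
  tensorUnit := ⟨𝟙_ _, 0⟩
  tensorHom f g := Lab.tens f g
  whiskerLeft X _ _ g := Lab.tens (𝟙 X) g
  whiskerRight f Y := Lab.tens f (𝟙 Y)
  associator X Y Z := Lab.isoMk (α_ X.obj Y.obj Z.obj) (by dsimp; ring)
  leftUnitor X := Lab.isoMk (λ_ X.obj) (by dsimp; ring)
  rightUnitor X := Lab.isoMk (ρ_ X.obj) (by dsimp; ring)

namespace Lab

theorem tensorHom_ofH {X X' Y Y' : Lab C} (φ : X.obj ⟶ X'.obj) (ψ : Y.obj ⟶ Y'.obj)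
    (h : X'.deg - X.deg = 0) (h' : Y'.deg - Y.deg = 0) :
    ofH φ h ⊗ₘ ofH ψ h' = ofH (X := X ⊗ Y) (Y := X' ⊗ Y') (φ ⊗ₘ ψ)
      (by change X'.deg + Y'.deg - (X.deg + Y.deg) = 0; omega) :=
  tens_ofH _ _ h h'

theorem assoc_ofH (X Y Z : Lab C) : (α_ X Y Z).hom =
    ofH (X := (X ⊗ Y) ⊗ Z) (Y := X ⊗ Y ⊗ Z) (α_ X.obj Y.obj Z.obj).hom
      (by change X.deg + (Y.deg + Z.deg) - (X.deg + Y.deg + Z.deg) = 0; ring) := rfl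

theorem left_ofH (X : Lab C) : (λ_ X).hom = ofH (X := 𝟙_ _ ⊗ X) (Y := X) (λ_ X.obj).hom
      (by change X.deg - (0 + X.deg) = 0; ring) := rfl

theorem right_ofH (X : Lab C) : (ρ_ X).hom = ofH (X := X ⊗ 𝟙_ _) (Y := X) (ρ_ X.obj).hom
      (by change X.deg - (X.deg + 0) = 0; ring) := rfl

theorem assoc_nat {X X' Y Y' Z Z' : Lab C} (f : X ⟶ X') (g : Y ⟶ Y') (h : Z ⟶ Z') :
    ((f ⊗ₘ g) ⊗ₘ h) ≫ (α_ X' Y' Z').hom = (α_ X Y Z).hom ≫ (f ⊗ₘ g ⊗ₘ h) := by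
  change tens (tens f g) h ≫ ofH (X := ⟨(X'.obj ⊗ Y'.obj) ⊗ Z'.obj, X'.deg + Y'.deg + Z'.deg⟩)
      (Y := ⟨X'.obj ⊗ Y'.obj ⊗ Z'.obj, X'.deg + (Y'.deg + Z'.deg)⟩)
      (α_ X'.obj Y'.obj Z'.obj).hom (by dsimp; ring) =
    ofH (X := ⟨(X.obj ⊗ Y.obj) ⊗ Z.obj, X.deg + Y.deg + Z.deg⟩)
      (Y := ⟨X.obj ⊗ Y.obj ⊗ Z.obj, X.deg + (Y.deg + Z.deg)⟩)
      (α_ X.obj Y.obj Z.obj).hom (by dsimp; ring) ≫ tens f (tens g h)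
  apply hom_ext
  · rw [ev_comp, ev_comp, ev_tens, ev_tens, ev_tens, ev_tens, ev_ofH, ev_ofH]
    refine GHom.assoc_aux (ev f) (ev g) (ev h) (by ring) (by ring) (by dsimp; ring)
      (by dsimp; ring) (by dsimp; ring) (by dsimp; ring) (by dsimp; ring) (by dsimp; ring)
      ⟨0, by dsimp; ring⟩
  · have h1 := GHom.assoc_aux (ev f) (ev g) (od h)
      (ab := X'.deg + Y'.deg - (X.deg + Y.deg)) (bc := Y'.deg + Z'.deg - (Y.deg + Z.deg) + 1)
      (t := X'.deg + Y'.deg + Z'.deg - (X.deg + Y.deg + Z.deg) + 1)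
      (t' := X'.deg + (Y'.deg + Z'.deg) - (X.deg + (Y.deg + Z.deg)) + 1)
      (z := X'.deg + (Y'.deg + Z'.deg) - (X'.deg + Y'.deg + Z'.deg))
      (z' := X.deg + (Y.deg + Z.deg) - (X.deg + Y.deg + Z.deg))
      (w := X'.deg + (Y'.deg + Z'.deg) - (X.deg + Y.deg + Z.deg) + 1)
      (by ring) (by ring) (by ring) (by ring) (by ring) (by ring) (by ring) (by ring)
      (x := (X.deg + Y.deg) * (Z'.deg - Z.deg + 1)) (x' := X.deg * (Y'.deg - Y.deg))
      (y := X.deg * (Y'.deg + Z'.deg - (Y.deg + Z.deg) + 1)) (y' := Y.deg * (Z'.deg - Z.deg + 1))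
      ⟨0, by ring⟩
    have h2 := GHom.assoc_aux (ev f) (od g) (ev h)
      (ab := X'.deg + Y'.deg - (X.deg + Y.deg) + 1) (bc := Y'.deg + Z'.deg - (Y.deg + Z.deg) + 1)
      (t := X'.deg + Y'.deg + Z'.deg - (X.deg + Y.deg + Z.deg) + 1)
      (t' := X'.deg + (Y'.deg + Z'.deg) - (X.deg + (Y.deg + Z.deg)) + 1)
      (z := X'.deg + (Y'.deg + Z'.deg) - (X'.deg + Y'.deg + Z'.deg))
      (z' := X.deg + (Y.deg + Z.deg) - (X.deg + Y.deg + Z.deg))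
      (w := X'.deg + (Y'.deg + Z'.deg) - (X.deg + Y.deg + Z.deg) + 1)
      (by ring) (by ring) (by ring) (by ring) (by ring) (by ring) (by ring) (by ring)
      (x := (X.deg + Y.deg) * (Z'.deg - Z.deg) + Z'.deg) (x' := X.deg * (Y'.deg - Y.deg + 1))
      (y := X.deg * (Y'.deg + Z'.deg - (Y.deg + Z.deg) + 1))
      (y' := Y.deg * (Z'.deg - Z.deg) + Z'.deg)
      ⟨0, by ring⟩
    have h3 := GHom.assoc_aux (od f) (ev g) (ev h)
      (ab := X'.deg + Y'.deg - (X.deg + Y.deg) + 1) (bc := Y'.deg + Z'.deg - (Y.deg + Z.deg))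
      (t := X'.deg + Y'.deg + Z'.deg - (X.deg + Y.deg + Z.deg) + 1)
      (t' := X'.deg + (Y'.deg + Z'.deg) - (X.deg + (Y.deg + Z.deg)) + 1)
      (z := X'.deg + (Y'.deg + Z'.deg) - (X'.deg + Y'.deg + Z'.deg))
      (z' := X.deg + (Y.deg + Z.deg) - (X.deg + Y.deg + Z.deg))
      (w := X'.deg + (Y'.deg + Z'.deg) - (X.deg + Y.deg + Z.deg) + 1)
      (by ring) (by ring) (by ring) (by ring) (by ring) (by ring) (by ring) (by ring)
      (x := (X.deg + Y.deg) * (Z'.deg - Z.deg) + Z'.deg)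
      (x' := X.deg * (Y'.deg - Y.deg) + Y'.deg)
      (y := X.deg * (Y'.deg + Z'.deg - (Y.deg + Z.deg)) + (Y'.deg + Z'.deg))
      (y' := Y.deg * (Z'.deg - Z.deg))
      ⟨0, by ring⟩
    rw [od_comp_ofH, od_ofH_comp, od_tens, od_tens, od_tens, od_tens, ev_tens, ev_tens, GHom.tensor_add,
      GHom.add_tensor, smul_add, smul_add, GHom.comp_add, GHom.add_comp, GHom.comp_add,
      GHom.add_comp]
    exact (congrArg₂ (· + ·) h1 (congrArg₂ (· + ·) h2 h3)).trans (add_assoc _ _ _).symm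

theorem left_inv_nat {X Y : Lab C} (f : X ⟶ Y) :
    f ≫ (λ_ Y).inv = (λ_ X).inv ≫ (𝟙 (𝟙_ (Lab C)) ⊗ₘ f) := by
  change f ≫ ofH (X := Y) (Y := ⟨𝟙_ _ ⊗ Y.obj, 0 + Y.deg⟩) (λ_ Y.obj).inv (by dsimp; ring) =
    ofH (X := X) (Y := ⟨𝟙_ _ ⊗ X.obj, 0 + X.deg⟩) (λ_ X.obj).inv (by dsimp; ring) ≫
      tens (ofH (X := ⟨𝟙_ _, 0⟩) (Y := ⟨𝟙_ _, 0⟩) (𝟙 (𝟙_ _)) (sub_self _)) f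
  apply hom_ext
  · rw [ev_comp, ev_comp, ev_tens, ev_ofH, ev_ofH, ev_ofH]
    exact GHom.left_aux (ev f) (by dsimp; omega) (by dsimp; omega) (by dsimp; omega)
      (by dsimp; omega) (sub_self _) (by dsimp; omega) (by simp)
  · rw [od_comp_ofH, od_ofH_comp, od_ofH_tens]
    exact GHom.left_aux (od f) (by dsimp; omega) (by dsimp; omega) (by dsimp; omega)
      (by dsimp; omega) (sub_self _) (by dsimp; omega) (by simp)

theorem right_inv_nat {X Y : Lab C} (f : X ⟶ Y) :
    f ≫ (ρ_ Y).inv = (ρ_ X).inv ≫ (f ⊗ₘ 𝟙 (𝟙_ (Lab C))) := by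
  change f ≫ ofH (X := Y) (Y := ⟨Y.obj ⊗ 𝟙_ _, Y.deg + 0⟩) (ρ_ Y.obj).inv (by dsimp; ring) =
    ofH (X := X) (Y := ⟨X.obj ⊗ 𝟙_ _, X.deg + 0⟩) (ρ_ X.obj).inv (by dsimp; ring) ≫
      tens f (ofH (X := ⟨𝟙_ _, 0⟩) (Y := ⟨𝟙_ _, 0⟩) (𝟙 (𝟙_ _)) (sub_self _))
  apply hom_ext
  · rw [ev_comp, ev_comp, ev_tens, ev_ofH, ev_ofH, ev_ofH]
    exact GHom.right_aux (ev f) (by dsimp; omega) (by dsimp; omega) (by dsimp; omega)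
      (by dsimp; omega) (sub_self _) (by dsimp; omega) (by simp)
  · rw [od_comp_ofH, od_ofH_comp, od_tens_ofH]
    exact GHom.right_aux (od f) (by dsimp; omega) (by dsimp; omega) (by dsimp; omega)
      (by dsimp; omega) (sub_self _) (by dsimp; omega) (by simp)

end Lab

noncomputable instance : MonoidalCategory (Lab C) := MonoidalCategory.ofTensorHom
  (id_tensorHom_id := Lab.id_tens)
  (tensorHom_comp_tensorHom := fun f g f' g' => Lab.tens_comp f g f' g')
  (associator_naturality := Lab.assoc_nat)
  (leftUnitor_naturality := fun f => by
    rw [← Iso.inv_comp_eq, ← Category.assoc, ← Iso.eq_comp_inv]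
    exact (Lab.left_inv_nat f).symm)
  (rightUnitor_naturality := fun f => by
    rw [← Iso.inv_comp_eq, ← Category.assoc, ← Iso.eq_comp_inv]
    exact (Lab.right_inv_nat f).symm)
  (pentagon := fun W X Y Z => by
    have h := MonoidalCategory.pentagon W.obj X.obj Y.obj Z.obj
    rw [← MonoidalCategory.tensorHom_id, ← MonoidalCategory.id_tensorHom] at h
    simp only [Lab.assoc_ofH, Lab.id_ofH, Lab.tensorHom_ofH]
    erw [Lab.ofH_comp, Lab.ofH_comp, Lab.ofH_comp]
    exact congrArg (fun x => Lab.ofH x _) h)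
  (triangle := fun X Y => by
    have h := MonoidalCategory.triangle X.obj Y.obj
    rw [← MonoidalCategory.tensorHom_id, ← MonoidalCategory.id_tensorHom] at h
    simp only [Lab.assoc_ofH, Lab.left_ofH, Lab.right_ofH, Lab.id_ofH, Lab.tensorHom_ofH]
    erw [Lab.ofH_comp]
    exact congrArg (fun x => Lab.ofH x _) h)

theorem Lab.tens_add {X X' Y Y' : Lab C} (f : X ⟶ X') (g g' : Y ⟶ Y') :
    f ⊗ₘ (g + g') = (f ⊗ₘ g) + (f ⊗ₘ g') := by
  apply Lab.hom_ext
  · rw [Lab.ev_add]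
    change Lab.ev (Lab.tens _ _) = Lab.ev (Lab.tens _ _) + Lab.ev (Lab.tens _ _)
    rw [Lab.ev_tens, Lab.ev_tens, Lab.ev_tens, Lab.ev_add, GHom.tensor_add, smul_add]
  · rw [Lab.od_add]
    change Lab.od (Lab.tens _ _) = Lab.od (Lab.tens _ _) + Lab.od (Lab.tens _ _)
    rw [Lab.od_tens, Lab.od_tens, Lab.od_tens, Lab.ev_add, Lab.od_add, GHom.tensor_add,
      GHom.tensor_add, smul_add, smul_add]
    exact add_add_add_comm _ _ _ _

theorem Lab.add_tens {X X' Y Y' : Lab C} (f f' : X ⟶ X') (g : Y ⟶ Y') :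
    (f + f') ⊗ₘ g = (f ⊗ₘ g) + (f' ⊗ₘ g) := by
  apply Lab.hom_ext
  · rw [Lab.ev_add]
    change Lab.ev (Lab.tens _ _) = Lab.ev (Lab.tens _ _) + Lab.ev (Lab.tens _ _)
    rw [Lab.ev_tens, Lab.ev_tens, Lab.ev_tens, Lab.ev_add, GHom.add_tensor, smul_add]
  · rw [Lab.od_add]
    change Lab.od (Lab.tens _ _) = Lab.od (Lab.tens _ _) + Lab.od (Lab.tens _ _)
    rw [Lab.od_tens, Lab.od_tens, Lab.od_tens, Lab.ev_add, Lab.od_add, GHom.add_tensor,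
      GHom.add_tensor, smul_add, smul_add]
    exact add_add_add_comm _ _ _ _

instance : MonoidalPreadditive (Lab C) where
  whiskerLeft_zero {X Y Z} := by
    have h := Lab.tens_add (𝟙 X) (0 : Y ⟶ Z) 0
    rw [add_zero] at h
    rw [← MonoidalCategory.id_tensorHom]
    exact left_eq_add.mp h
  zero_whiskerRight {X Y Z} := by
    have h := Lab.add_tens (0 : Y ⟶ Z) 0 (𝟙 X)
    rw [add_zero] at h
    rw [← MonoidalCategory.tensorHom_id]
    exact left_eq_add.mp h
  whiskerLeft_add f g := by
    simp only [← MonoidalCategory.id_tensorHom, Lab.tens_add]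
  add_whiskerRight f g := by
    simp only [← MonoidalCategory.tensorHom_id, Lab.add_tens]

end LabMon

end AInf

namespace AInf

namespace Abs

variable {G : Type u} [Category.{v} G] [Preadditive G] [MonoidalCategory G] [MonoidalPreadditive G]

/-- Tensor powers in a monoidal category. -/
abbrev Pow (V : G) : ℕ → G
  | 0 => 𝟙_ G
  | n + 1 => V ⊗ Pow V n

/-- The canonical isomorphism `V^n ⟶ V^i ⊗ V^j` when `i + j = n`, and zero otherwise. -/
def sp (V : G) : ∀ i j n : ℕ, Pow V n ⟶ Pow V i ⊗ Pow V j
  | 0, j, n => if h : n = j then eqToHom (by rw [h]) ≫ (λ_ (Pow V j)).inv else 0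
  | _ + 1, _, 0 => 0
  | i + 1, j, n + 1 => V ◁ sp V i j n ≫ (α_ V (Pow V i) (Pow V j)).inv

variable {V W U T : G}

theorem sp_zero (V : G) (j : ℕ) : sp V 0 j j = (λ_ (Pow V j)).inv := by rw [sp, dif_pos rfl]; exact Category.id_comp _

theorem sp_zero_ne (V : G) {j n : ℕ} (h : n ≠ j) : sp V 0 j n = 0 := by simp [sp, h]

theorem sp_succ (V : G) (i j n : ℕ) :
    sp V (i + 1) j (n + 1) = V ◁ sp V i j n ≫ (α_ V (Pow V i) (Pow V j)).inv := rfl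

theorem sp_right (V : G) : ∀ n : ℕ, sp V n 0 n = (ρ_ (Pow V n)).inv
  | 0 => by rw [sp_zero]; exact unitors_inv_equal
  | n + 1 => by
    rw [sp_succ, sp_right V n]
    exact (rightUnitor_tensor_inv _ _).symm

theorem sp_coassoc (V : G) : ∀ i k l m j n : ℕ, i + k = m → k + l = j → i + j = n →
    sp V i j n ≫ (Pow V i ◁ sp V k l j) = sp V m l n ≫ (sp V i k m ▷ Pow V l) ≫ (α_ _ _ _).hom := by
  intro i
  induction i with
  | zero =>
    intro k l m j n h1 h2 h3
    obtain rfl : k = m := by omega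
    obtain rfl : j = n := by omega
    rw [sp_zero, sp_zero]
    change _ ≫ 𝟙_ G ◁ _ = _
    rw [← leftUnitor_inv_naturality]
    simp [Pow]
  | succ i ih =>
    intro k l m j n h1 h2 h3
    obtain ⟨m, rfl⟩ : ∃ m', m = m' + 1 := ⟨m - 1, by omega⟩
    obtain ⟨n, rfl⟩ : ∃ n', n = n' + 1 := ⟨n - 1, by omega⟩
    have := congrArg (fun x => V ◁ x) (ih k l m j n (by omega) h2 (by omega))
    simp only [MonoidalCategory.whiskerLeft_comp] at this
    rw [sp_succ, sp_succ, sp_succ]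
    simp only [comp_whiskerRight, Category.assoc]
    change _ ≫ _ ≫ (V ⊗ Pow V i) ◁ _ = _ ≫ _ ≫ _ ≫ _ ≫ (α_ (V ⊗ Pow V i) _ _).hom
    rw [MonoidalCategory.tensor_whiskerLeft]
    simp only [Iso.inv_hom_id_assoc]
    rw [reassoc_of% this]
    change _ = _ ≫ (α_ V (Pow V m) (Pow V l)).inv ≫ _
    rw [← MonoidalCategory.associator_inv_naturality_middle_assoc]
    congr 1
    simp


/-- The matrix of the coalgebra morphism with components `f`. -/
def F (f : ∀ n, Pow V n ⟶ W) : ∀ r n : ℕ, Pow V n ⟶ Pow W r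
  | 0, 0 => 𝟙 _
  | 0, _ + 1 => 0
  | r + 1, n => ∑ x ∈ Finset.HasAntidiagonal.antidiagonal n, sp V x.1 x.2 n ≫ (f x.1 ⊗ₘ F f r x.2)

theorem F_succ (f : ∀ n, Pow V n ⟶ W) (r n : ℕ) : F f (r + 1) n =
    ∑ x ∈ Finset.HasAntidiagonal.antidiagonal n, sp V x.1 x.2 n ≫ (f x.1 ⊗ₘ F f r x.2) := by
  cases n <;> rfl

theorem F_zero_zero (f : ∀ n, Pow V n ⟶ W) : F f 0 0 = 𝟙 _ := rfl

theorem F_zero_ne (f : ∀ n, Pow V n ⟶ W) {n : ℕ} (h : n ≠ 0) : F f 0 n = 0 := by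
  cases n
  · exact absurd rfl h
  · rfl

theorem tensor_zero' {X Y Z K : G} (f : X ⟶ Y) : f ⊗ₘ (0 : Z ⟶ K) = 0 := by simp
theorem zero_tensor' {X Y Z K : G} (f : X ⟶ Y) : (0 : Z ⟶ K) ⊗ₘ f = 0 := by simp

theorem F_one (f : ∀ n, Pow V n ⟶ W) (n : ℕ) : F f 1 n = f n ≫ (ρ_ W).inv := by
  rw [F_succ, Finset.sum_eq_single (n, 0)]
  · rw [sp_right, F_zero_zero]
    change _ ≫ (f n ⊗ₘ 𝟙 (𝟙_ G)) = _
    rw [MonoidalCategory.tensorHom_id, rightUnitor_inv_naturality]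
  · rintro ⟨a, b⟩ h1 h2
    rw [F_zero_ne, tensor_zero', comp_zero]
    rintro rfl
    exact h2 (by simpa using h1)
  · simp

theorem F_lt (f : ∀ n, Pow V n ⟶ W) (hf : f 0 = 0) : ∀ r n : ℕ, n < r → F f r n = 0 := by
  intro r
  induction r with
  | zero => intro n h; omega
  | succ r ih =>
    intro n h
    rw [F_succ]
    refine Finset.sum_eq_zero ?_
    rintro ⟨a, b⟩ hab
    have := Finset.HasAntidiagonal.mem_antidiagonal.1 hab
    dsimp only at this ⊢
    rcases Nat.eq_zero_or_pos a with rfl | ha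
    · rw [hf, zero_tensor', comp_zero]
    · rw [ih b (by omega), tensor_zero', comp_zero]

theorem sum_triple {M : Type*} [AddCommMonoid M] (n : ℕ) (T : ℕ → ℕ → ℕ → M) :
    ∑ x ∈ Finset.HasAntidiagonal.antidiagonal n, ∑ y ∈ Finset.HasAntidiagonal.antidiagonal x.2, T x.1 y.1 y.2 =
      ∑ x ∈ Finset.HasAntidiagonal.antidiagonal n, ∑ y ∈ Finset.HasAntidiagonal.antidiagonal x.1, T y.1 y.2 x.2 := by
  rw [Finset.sum_sigma', Finset.sum_sigma']
  refine Finset.sum_nbij' (fun x => ⟨(x.1.1 + x.2.1, x.2.2), (x.1.1, x.2.1)⟩)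
    (fun x => ⟨(x.2.1, x.2.2 + x.1.2), (x.2.2, x.1.2)⟩) ?_ ?_ ?_ ?_ ?_
  · rintro ⟨⟨a, b⟩, c, d⟩ h
    simp only [Finset.mem_sigma, Finset.HasAntidiagonal.mem_antidiagonal] at h ⊢
    exact ⟨by omega, trivial⟩
  · rintro ⟨⟨a, b⟩, c, d⟩ h
    simp only [Finset.mem_sigma, Finset.HasAntidiagonal.mem_antidiagonal] at h ⊢
    exact ⟨by omega, trivial⟩
  · rintro ⟨⟨a, b⟩, c, d⟩ h
    simp only [Finset.mem_sigma, Finset.HasAntidiagonal.mem_antidiagonal] at h ⊢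
    obtain ⟨h1, rfl⟩ := h
    rfl
  · rintro ⟨⟨a, b⟩, c, d⟩ h
    simp only [Finset.mem_sigma, Finset.HasAntidiagonal.mem_antidiagonal] at h ⊢
    obtain ⟨h1, rfl⟩ := h
    rfl
  · rintro ⟨⟨a, b⟩, c, d⟩ h
    rfl

theorem sum_tensor' {ι : Type*} {X Y Z K : G} (s : Finset ι) (f : ι → (X ⟶ Y)) (g : Z ⟶ K) :
    (∑ i ∈ s, f i) ⊗ₘ g = ∑ i ∈ s, (f i ⊗ₘ g) := sum_tensor _ _ _
theorem tensor_sum' {ι : Type*} {X Y Z K : G} (s : Finset ι) (f : ι → (X ⟶ Y)) (g : Z ⟶ K) :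
    g ⊗ₘ (∑ i ∈ s, f i) = ∑ i ∈ s, (g ⊗ₘ f i) := tensor_sum _ _ _

theorem F_sp (f : ∀ n, Pow V n ⟶ W) : ∀ a b r n : ℕ, a + b = r →
    F f r n ≫ sp W a b r = ∑ x ∈ Finset.HasAntidiagonal.antidiagonal n,
      sp V x.1 x.2 n ≫ (F f a x.1 ⊗ₘ F f b x.2) := by
  intro a
  induction a with
  | zero =>
    intro b r n h
    obtain rfl : b = r := by omega
    rw [Finset.sum_eq_single (0, n)]
    · rw [sp_zero, sp_zero, F_zero_zero]
      exact (leftUnitor_inv_naturality _).trans (by rw [MonoidalCategory.id_tensorHom])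
    · rintro ⟨a, c⟩ h1 h2
      rw [F_zero_ne, zero_tensor', comp_zero]
      rintro rfl
      exact h2 (by simpa using h1)
    · simp
  | succ a ih =>
    intro b r n h
    obtain ⟨r, rfl⟩ : ∃ m', r = m' + 1 := ⟨r - 1, by omega⟩
    have key : ∀ i k l : ℕ, i + (k + l) = n →
        sp V i (k + l) n ≫ (f i ⊗ₘ (sp V k l (k + l) ≫ (F f a k ⊗ₘ F f b l))) ≫
          (α_ W (Pow W a) (Pow W b)).inv =
        sp V (i + k) l n ≫ ((sp V i k (i + k) ≫ (f i ⊗ₘ F f a k)) ⊗ₘ F f b l) := by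
      intro i k l hn
      have h1 : f i ⊗ₘ (sp V k l (k + l) ≫ (F f a k ⊗ₘ F f b l)) =
          Pow V i ◁ sp V k l (k + l) ≫ (f i ⊗ₘ (F f a k ⊗ₘ F f b l)) := by
        rw [← MonoidalCategory.id_tensorHom, MonoidalCategory.tensorHom_comp_tensorHom,
          Category.id_comp]
      have h2 : (sp V i k (i + k) ≫ (f i ⊗ₘ F f a k)) ⊗ₘ F f b l =
          sp V i k (i + k) ▷ Pow V l ≫ ((f i ⊗ₘ F f a k) ⊗ₘ F f b l) := by
        rw [← MonoidalCategory.tensorHom_id, MonoidalCategory.tensorHom_comp_tensorHom,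
          Category.id_comp]
      rw [h1, h2, Category.assoc, associator_inv_naturality,
        reassoc_of% sp_coassoc V i k l (i + k) (k + l) n rfl rfl hn]
      simp
    rw [F_succ, sp_succ, Preadditive.sum_comp]
    have e1 : ∀ x ∈ Finset.HasAntidiagonal.antidiagonal n,
        (sp V x.1 x.2 n ≫ (f x.1 ⊗ₘ F f r x.2)) ≫ W ◁ sp W a b r ≫
          (α_ W (Pow W a) (Pow W b)).inv =
        ∑ y ∈ Finset.HasAntidiagonal.antidiagonal x.2, sp V x.1 (y.1 + y.2) n ≫
          (f x.1 ⊗ₘ (sp V y.1 y.2 (y.1 + y.2) ≫ (F f a y.1 ⊗ₘ F f b y.2))) ≫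
          (α_ W (Pow W a) (Pow W b)).inv := by
      intro x hx
      have e : (f x.1 ⊗ₘ F f r x.2) ≫ W ◁ sp W a b r =
          f x.1 ⊗ₘ (F f r x.2 ≫ sp W a b r) := by
        rw [← MonoidalCategory.id_tensorHom, MonoidalCategory.tensorHom_comp_tensorHom,
          Category.comp_id]
      rw [Category.assoc, reassoc_of% e, ih b r x.2 (by omega), tensor_sum',
        Preadditive.sum_comp, Preadditive.comp_sum]
      refine Finset.sum_congr rfl fun y hy => ?_
      have := Finset.HasAntidiagonal.mem_antidiagonal.1 hy
      obtain ⟨y1, y2⟩ := y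
      obtain ⟨x1, x2⟩ := x
      dsimp only at this ⊢
      subst this
      rfl
    have e2 : ∀ x ∈ Finset.HasAntidiagonal.antidiagonal n,
        sp V x.1 x.2 n ≫ (F f (a + 1) x.1 ⊗ₘ F f b x.2) =
        ∑ y ∈ Finset.HasAntidiagonal.antidiagonal x.1, sp V (y.1 + y.2) x.2 n ≫
          ((sp V y.1 y.2 (y.1 + y.2) ≫ (f y.1 ⊗ₘ F f a y.2)) ⊗ₘ F f b x.2) := by
      intro x hx
      rw [F_succ, sum_tensor', Preadditive.comp_sum]
      refine Finset.sum_congr rfl fun y hy => ?_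
      have := Finset.HasAntidiagonal.mem_antidiagonal.1 hy
      obtain ⟨y1, y2⟩ := y
      obtain ⟨x1, x2⟩ := x
      dsimp only at this ⊢
      subst this
      rfl
    refine (Finset.sum_congr rfl e1).trans (Eq.trans ?_ (Finset.sum_congr rfl e2).symm)
    refine (sum_triple n (fun i k l => sp V i (k + l) n ≫
      (f i ⊗ₘ (sp V k l (k + l) ≫ (F f a k ⊗ₘ F f b l))) ≫
          (α_ W (Pow W a) (Pow W b)).inv)).trans ?_
    refine Finset.sum_congr rfl fun x hx => Finset.sum_congr rfl fun y hy => key _ _ _ ?_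
    have h1 := Finset.HasAntidiagonal.mem_antidiagonal.1 hx
    have h2 := Finset.HasAntidiagonal.mem_antidiagonal.1 hy
    omega

/-- Composition of families. -/
def comp (f : ∀ n, Pow V n ⟶ W) (g : ∀ n, Pow W n ⟶ U) (n : ℕ) : Pow V n ⟶ U :=
  ∑ r ∈ Finset.range (n + 1), F f r n ≫ g r

theorem comp_zero' (f : ∀ n, Pow V n ⟶ W) (g : ∀ n, Pow W n ⟶ U) (hg : g 0 = 0) :
    comp f g 0 = 0 := by simp [comp, hg]

theorem sum_range_ext {M : Type*} [AddCommMonoid M] (T : ℕ → M) {n N : ℕ} (h : n ≤ N)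
    (hT : ∀ r, n < r → T r = 0) :
    ∑ r ∈ Finset.range (n + 1), T r = ∑ r ∈ Finset.range (N + 1), T r := by
  refine Finset.sum_subset ?_ ?_
  · intro x hx
    simp only [Finset.mem_range] at hx ⊢
    omega
  · intro x _ hx
    simp only [Finset.mem_range] at hx
    exact hT x (by omega)

theorem sum_range_antidiagonal {M : Type*} [AddCommMonoid M] (i j n : ℕ) (hn : i + j = n)
    (T : ℕ → ℕ → M) (h1 : ∀ a b, i < a → T a b = 0) (h2 : ∀ a b, j < b → T a b = 0) :
    ∑ r ∈ Finset.range (n + 1), ∑ x ∈ Finset.HasAntidiagonal.antidiagonal r, T x.1 x.2 =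
      ∑ a ∈ Finset.range (i + 1), ∑ b ∈ Finset.range (j + 1), T a b := by
  rw [Finset.sum_sigma', ← Finset.sum_product']
  symm
  refine Finset.sum_bij_ne_zero (fun x _ _ => ⟨x.1 + x.2, x⟩) ?_ ?_ ?_ ?_
  · rintro ⟨a, b⟩ h _
    simp only [Finset.mem_product, Finset.mem_range, Finset.mem_sigma,
      Finset.HasAntidiagonal.mem_antidiagonal] at h ⊢
    exact ⟨by omega, trivial⟩
  · rintro ⟨a, b⟩ _ _ ⟨c, d⟩ _ _ h
    simp only [Sigma.mk.injEq, heq_eq_eq] at h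
    exact h.2
  · rintro ⟨r, a, b⟩ h hT
    simp only [Finset.mem_range, Finset.mem_sigma, Finset.HasAntidiagonal.mem_antidiagonal] at h
    refine ⟨(a, b), ?_, hT, ?_⟩
    · simp only [Finset.mem_product, Finset.mem_range]
      constructor
      · by_contra hc
        exact hT (h1 a b (by omega))
      · by_contra hc
        exact hT (h2 a b (by omega))
    · simp [h.2]
  · rintro ⟨a, b⟩ _ _
    rfl

theorem F_comp (f : ∀ n, Pow V n ⟶ W) (g : ∀ n, Pow W n ⟶ U) (hf : f 0 = 0) :
    ∀ s n : ℕ, F (comp f g) s n = ∑ r ∈ Finset.range (n + 1), F f r n ≫ F g s r := by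
  intro s
  induction s with
  | zero =>
    intro n
    rw [Finset.sum_eq_single 0]
    · rcases Nat.eq_zero_or_pos n with rfl | hn
      · rw [F_zero_zero, F_zero_zero, F_zero_zero, Category.comp_id]
      · rw [F_zero_ne _ (by omega), F_zero_ne _ (by omega), zero_comp]
    · intro r _ hr
      rw [F_zero_ne _ hr, comp_zero]
    · simp
  | succ s ih =>
    intro n
    have e1 : ∀ r ∈ Finset.range (n + 1), F f r n ≫ F g (s + 1) r =
        ∑ x ∈ Finset.HasAntidiagonal.antidiagonal n, ∑ y ∈ Finset.HasAntidiagonal.antidiagonal r,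
          sp V x.1 x.2 n ≫ ((F f y.1 x.1 ≫ g y.1) ⊗ₘ (F f y.2 x.2 ≫ F g s y.2)) := by
      intro r _
      rw [F_succ, Preadditive.comp_sum, Finset.sum_comm]
      refine Finset.sum_congr rfl fun y hy => ?_
      rw [← Category.assoc, F_sp f y.1 y.2 r n (Finset.HasAntidiagonal.mem_antidiagonal.1 hy),
        Preadditive.sum_comp]
      refine Finset.sum_congr rfl fun x hx => ?_
      rw [Category.assoc, MonoidalCategory.tensorHom_comp_tensorHom]
    rw [Finset.sum_congr rfl e1, Finset.sum_comm, F_succ]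
    refine Finset.sum_congr rfl fun x hx => ?_
    rw [sum_range_antidiagonal x.1 x.2 n (Finset.HasAntidiagonal.mem_antidiagonal.1 hx)
      (fun a b => sp V x.1 x.2 n ≫ ((F f a x.1 ≫ g a) ⊗ₘ (F f b x.2 ≫ F g s b)))]
    · rw [ih, comp, sum_tensor', Preadditive.comp_sum]
      refine Finset.sum_congr rfl fun a _ => ?_
      rw [tensor_sum', Preadditive.comp_sum]
    · intro a b h
      rw [F_lt f hf a x.1 h, zero_comp, zero_tensor', comp_zero]
    · intro a b h
      rw [F_lt f hf b x.2 h, zero_comp, tensor_zero', comp_zero]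

theorem comp_assoc (f : ∀ n, Pow V n ⟶ W) (g : ∀ n, Pow W n ⟶ U) (h : ∀ n, Pow U n ⟶ T)
    (hf : f 0 = 0) (hg : g 0 = 0) : comp (comp f g) h = comp f (comp g h) := by
  funext n
  have e1 : comp (comp f g) h n = ∑ s ∈ Finset.range (n + 1), ∑ r ∈ Finset.range (n + 1),
      F f r n ≫ F g s r ≫ h s := by
    refine Finset.sum_congr rfl fun s _ => ?_
    rw [F_comp f g hf, Preadditive.sum_comp]
    exact Finset.sum_congr rfl fun r _ => Category.assoc _ _ _
  rw [e1, Finset.sum_comm]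
  refine Finset.sum_congr rfl fun r hr => ?_
  rw [comp, Preadditive.comp_sum]
  symm
  refine sum_range_ext _ (by simp only [Finset.mem_range] at hr; omega) ?_
  intro s hs
  rw [F_lt g hg s r hs, zero_comp, comp_zero]

/-- The identity family. -/
def one (V : G) : ∀ n, Pow V n ⟶ V
  | 0 => 0
  | 1 => (ρ_ V).hom
  | _ + 2 => 0

theorem one_one (V : G) : one V 1 = (ρ_ V).hom := rfl
theorem one_ne (V : G) {n : ℕ} (h : n ≠ 1) : one V n = 0 := by
  match n, h with
  | 0, _ => rfl
  | 1, h => exact absurd rfl h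
  | n + 2, _ => rfl

theorem F_id : ∀ r : ℕ, F (one V) r r = 𝟙 _ ∧ ∀ n, n ≠ r → F (one V) r n = 0 := by
  intro r
  induction r with
  | zero => exact ⟨rfl, fun n hn => F_zero_ne _ hn⟩
  | succ r ih =>
    constructor
    · rw [F_succ, Finset.sum_eq_single (1, r)]
      · dsimp only
        rw [ih.1, one_one, show sp V 1 r (r + 1) = _ from sp_succ V 0 r r, sp_zero,
          MonoidalCategory.tensorHom_id]
        change (V ◁ _ ≫ (α_ V (𝟙_ G) _).inv) ≫ _ = 𝟙 (V ⊗ _)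
        simp
      · rintro ⟨a, b⟩ h1 h2
        rw [one_ne, zero_tensor', comp_zero]
        rintro rfl
        apply h2
        have := Finset.HasAntidiagonal.mem_antidiagonal.1 h1
        simp only [Prod.mk.injEq, true_and]
        omega
      · intro h
        exact absurd (Finset.HasAntidiagonal.mem_antidiagonal.2 (by dsimp; omega)) h
    · intro n hn
      rw [F_succ]
      refine Finset.sum_eq_zero ?_
      rintro ⟨a, b⟩ hab
      have := Finset.HasAntidiagonal.mem_antidiagonal.1 hab
      dsimp only at this ⊢
      by_cases ha : a = 1
      · rw [ih.2 b (by omega), tensor_zero', comp_zero]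
      · rw [one_ne V ha, zero_tensor', comp_zero]

theorem one_comp (f : ∀ n, Pow V n ⟶ W) : comp (one V) f = f := by
  funext n
  rw [comp, Finset.sum_eq_single n]
  · rw [(F_id n).1, Category.id_comp]
  · intro r _ hr
    rw [(F_id r).2 n hr.symm, zero_comp]
  · intro h
    exact absurd (Finset.mem_range.2 (by omega)) h

theorem comp_one (f : ∀ n, Pow V n ⟶ W) (hf : f 0 = 0) : comp f (one W) = f := by
  funext n
  rcases Nat.eq_zero_or_pos n with rfl | hn
  · rw [comp_zero' _ _ (one_ne W (by omega)), hf]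
  rw [comp, Finset.sum_eq_single 1]
  · rw [F_one, one_one]
    change (_ ≫ (ρ_ W).inv) ≫ (ρ_ W).hom = _
    simp
  · intro r _ hr
    rw [one_ne W hr, comp_zero]
  · intro h
    exact absurd (Finset.mem_range.2 (by omega)) h

end Abs

end AInf

namespace AInf

section Literal

variable {C : Type u} [Category.{v} C] [Preadditive C] [HasFiniteBiproducts C]
  [MonoidalCategory C] [MonoidalPreadditive C] [HasColimits C]
  [∀ X : C, PreservesFilteredColimits (tensorLeft X)]
  [∀ X : C, PreservesFilteredColimits (tensorRight X)]

/-- The tensor powers `A^{⊗n}` of a graded object. -/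
noncomputable def pow (A : GradedObject ℤ C) : ℕ → GradedObject ℤ C
  | 0 => 𝟙_ _
  | n + 1 => A ⊗ pow A n

/-- The canonical isomorphism `A^{⊗n} ≅ A^{⊗i} ⊗ A^{⊗j}` for `i + j = n`. -/
noncomputable def split (A : GradedObject ℤ C) :
    ∀ i j n : ℕ, i + j = n → (pow A n ≅ pow A i ⊗ pow A j)
  | 0, j, n, h => eqToIso (by rw [← h, Nat.zero_add]) ≪≫ (λ_ (pow A j)).symm
  | _ + 1, _, 0, h => absurd h (by omega)
  | i + 1, j, n + 1, h =>
    whiskerLeftIso A (split A i j n (by omega)) ≪≫ (α_ A (pow A i) (pow A j)).symm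

/-- The graded morphism `1^{⊗j} ⊗ m_k ⊗ 1^{⊗l} : A^{⊗n} ⟶ A^{⊗i}`, of degree `2 - k`, where
`n = j + k + l` and `i = j + 1 + l`. It is defined by recursion on `j`: for `j = 0` (when `i` is
`l + 1`) it is `m_k ⊗ 1^{⊗l}`, and `1^{⊗(j+1)} ⊗ m_k ⊗ 1^{⊗l} = 1 ⊗ (1^{⊗j} ⊗ m_k ⊗ 1^{⊗l})`. -/
noncomputable def ins {A : GradedObject ℤ C} (m : ∀ n : ℕ, GHom (pow A n) A (2 - n)) :
    ∀ j k l n i : ℕ, j + k + l = n → j + 1 + l = i → GHom (pow A n) (pow A i) (2 - k)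
  | 0, _, _, _, 0, _, hi => absurd hi (by omega)
  | 0, k, _, n, l + 1, h, hi =>
    GHom.comp (GHom.ofHom (split A k l n (by omega)).hom rfl)
      (GHom.tensor (m k) (GHom.ofHom (𝟙 (pow A l)) rfl) (add_zero _)) (zero_add _)
  | _ + 1, _, _, 0, _, h, _ => absurd h (by omega)
  | _ + 1, _, _, _ + 1, 0, _, hi => absurd hi (by omega)
  | j + 1, k, l, n + 1, i + 1, h, hi =>
    GHom.tensor (GHom.ofHom (𝟙 A) rfl) (ins m j k l n i (by omega) (by omega)) (zero_add _)

/-- The graded morphism `f_{i_1} ⊗ ⋯ ⊗ f_{i_r} : A^{⊗n} ⟶ B^{⊗r}`, of degree `r - n`, where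
`n = i_1 + ⋯ + i_r`, defined as `f_{i_1} ⊗ (f_{i_2} ⊗ ⋯ )`. -/
noncomputable def blk {A B : GradedObject ℤ C} (f : ∀ n : ℕ, GHom (pow A n) B (1 - n)) :
    ∀ (r : ℕ) (i : Fin r → ℕ) (n : ℕ), ∑ u, i u = n → GHom (pow A n) (pow B r) (r - n)
  | 0, _, n, h => GHom.ofHom (eqToHom (by rw [← h]; rfl)) (by rw [← h]; rfl)
  | r + 1, i, n, h =>
    GHom.comp (GHom.ofHom (split A (i 0) (∑ u : Fin r, i u.succ) n
        (by rw [← h, Fin.sum_univ_succ])).hom rfl)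
      (GHom.tensor (f (i 0)) (blk f r (fun u => i u.succ) _ rfl)
        (t := ((r + 1 : ℕ) : ℤ) - n)
        (by rw [← h, Fin.sum_univ_succ]; push_cast; ring)) (zero_add _)

/-- The exponent `∑_{2 ≤ u ≤ r} (1 - i_u) ∑_{1 ≤ v ≤ u} i_v` of the sign attached to
`(i_1, …, i_r)`. -/
def sgn {r : ℕ} (i : Fin r → ℕ) : ℤ :=
  ∑ u : Fin r with 0 < u.val, (1 - (i u : ℤ)) * ∑ v ∈ Finset.Iic u, (i v : ℤ)

/-- The triples `(j, k, l)` of natural numbers with `j + k + l = n`. -/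
def triples (n : ℕ) : Finset (ℕ × ℕ × ℕ) :=
  (Finset.range (n + 1) ×ˢ Finset.range (n + 1) ×ˢ Finset.range (n + 1)).filter
    fun x => x.1 + x.2.1 + x.2.2 = n

theorem mem_triples {n : ℕ} {x : ℕ × ℕ × ℕ} : x ∈ triples n ↔ x.1 + x.2.1 + x.2.2 = n := by
  simp only [triples, Finset.mem_filter, Finset.mem_product, Finset.mem_range]
  omega

variable (C) in
/-- An `A_∞`-algebra: operations `m_n : A^{⊗n} ⟶ A` of degree `2 - n` for `n ≥ 1` (by convention
`m_0 = 0`) such that `∑_{j+k+l=n} (-1)^{jk+l} m_{j+1+l} (1^{⊗j} ⊗ m_k ⊗ 1^{⊗l}) = 0`. -/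
structure AInfAlg where
  obj : GradedObject ℤ C
  m : ∀ n : ℕ, GHom (pow obj n) obj (2 - n)
  m_zero : m 0 = 0
  rel : ∀ n : ℕ, ∑ x ∈ (triples n).attach,
    ((x.1.1 : ℤ) * x.1.2.1 + x.1.2.2).negOnePow •
      GHom.comp (ins m x.1.1 x.1.2.1 x.1.2.2 n (x.1.1 + 1 + x.1.2.2) (mem_triples.1 x.2) rfl)
        (m (x.1.1 + 1 + x.1.2.2)) (t := 3 - n)
        (by have h := mem_triples.1 x.2; push_cast; omega) = 0

/-- A morphism of `A_∞`-algebras: graded morphisms `f_n : A^{⊗n} ⟶ B` of degree `1 - n` for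
`n ≥ 1` (by convention `f_0 = 0`) such that
`∑_{j+k+l=n} (-1)^{jk+l} f_{j+1+l} (1^{⊗j} ⊗ m_k ⊗ 1^{⊗l}) =
∑_{i_1+⋯+i_r=n} (-1)^s m_r (f_{i_1} ⊗ ⋯ ⊗ f_{i_r})`, where `s` is the exponent `sgn i`. The tuples
having a zero entry do not contribute since `f_0 = 0`. -/
structure AInfHom (A B : AInfAlg C) where
  f : ∀ n : ℕ, GHom (pow A.obj n) B.obj (1 - n)
  f_zero : f 0 = 0
  rel : ∀ n : ℕ, ∑ x ∈ (triples n).attach,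
      ((x.1.1 : ℤ) * x.1.2.1 + x.1.2.2).negOnePow •
        GHom.comp
          (ins A.m x.1.1 x.1.2.1 x.1.2.2 n (x.1.1 + 1 + x.1.2.2) (mem_triples.1 x.2) rfl)
          (f (x.1.1 + 1 + x.1.2.2)) (t := 2 - n)
          (by have h := mem_triples.1 x.2; push_cast; omega) =
    ∑ r ∈ Finset.range (n + 1), ∑ i ∈ (Finset.Nat.antidiagonalTuple r n).attach,
      (sgn i.1).negOnePow •
        GHom.comp (blk f r i.1 n (Finset.Nat.mem_antidiagonalTuple.1 i.2)) (B.m r) (t := 2 - n)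
          (by ring)

/-- The components `∑_{i_1+⋯+i_r=n} (-1)^s g_r (f_{i_1} ⊗ ⋯ ⊗ f_{i_r})` of a composition. -/
noncomputable def compFun {A B D : GradedObject ℤ C} (f : ∀ n : ℕ, GHom (pow A n) B (1 - n))
    (g : ∀ n : ℕ, GHom (pow B n) D (1 - n)) (n : ℕ) : GHom (pow A n) D (1 - n) :=
  ∑ r ∈ Finset.range (n + 1), ∑ i ∈ (Finset.Nat.antidiagonalTuple r n).attach,
    (sgn i.1).negOnePow •
      GHom.comp (blk f r i.1 n (Finset.Nat.mem_antidiagonalTuple.1 i.2)) (g r) (by ring)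

/-- The components of the identity: `f_1 = 1` and `f_n = 0` for `n ≠ 1`. -/
noncomputable def idFun (A : GradedObject ℤ C) : ∀ n : ℕ, GHom (pow A n) A (1 - n)
  | 0 => 0
  | 1 => GHom.ofHom (ρ_ A).hom (by simp)
  | _ + 2 => 0

end Literal
end AInf

namespace AInf

namespace GHom

section

variable {C : Type u} [Category.{v} C] [Preadditive C] {M L N : GradedObject ℤ C} {r s t : ℤ}

/-- Change of the expression of the degree. -/
def recast (h : r = s) (f : GHom M L r) : GHom M L s := mk fun p q hq => f.v p q (by omega)

theorem recast_rfl (h : r = r) (f : GHom M L r) : recast h f = f :=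
  ext fun p q hq => by rw [recast, mk_v]

theorem recast_recast (h : r = s) (h' : s = t) (f : GHom M L r) :
    recast h' (recast h f) = recast (h.trans h') f := by
  subst h h'
  rw [recast_rfl]

theorem recast_add (h : r = s) (f g : GHom M L r) :
    recast h (f + g) = recast h f + recast h g := by
  subst h
  simp only [recast_rfl]

theorem recast_zero (h : r = s) : recast h (0 : GHom M L r) = 0 := by
  subst h
  simp only [recast_rfl]

theorem recast_smul (h : r = s) (n : ℤˣ) (f : GHom M L r) :
    recast h (n • f) = n • recast h f := by
  subst h
  simp only [recast_rfl]

theorem recast_comp (f : GHom M L r) (g : GHom L N s) (h : r + s = t) {t' : ℤ} (h' : t = t') :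
    recast h' (comp f g h) = comp f g (h.trans h') := by
  subst h'
  rw [recast_rfl]

theorem comp_recast (f : GHom M L r) (g : GHom L N s) {s' : ℤ} (h' : s = s') (h : r + s' = t) :
    comp f (recast h' g) h = comp f g (by omega) := by
  subst h'
  rw [recast_rfl]

theorem recast_comp' (f : GHom M L r) (g : GHom L N s) {r' : ℤ} (h' : r = r') (h : r' + s = t) :
    comp (recast h' f) g h = comp f g (by omega) := by
  subst h'
  rw [recast_rfl]

theorem comp_ofHom_id (f : GHom M L r) (hs : s = 0) (h : r + s = t) :
    comp f (ofHom (𝟙 L) hs) h = recast (by omega) f :=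
  ext fun p q hq => by rw [comp_id, recast, mk_v]

theorem ofHom_id_comp (f : GHom M L r) (hs : s = 0) (h : s + r = t) :
    comp (ofHom (𝟙 M) hs) f h = recast (by omega) f :=
  ext fun p q hq => by rw [id_comp, recast, mk_v]

theorem recast_ofHom (φ : M ⟶ L) (hr : r = 0) (h : r = s) :
    recast h (ofHom φ hr) = ofHom φ (by omega) := by
  subst h
  rw [recast_rfl]

end

section

variable {C : Type u} [Category.{v} C] [Preadditive C] [HasFiniteBiproducts C]
  [MonoidalCategory C] [MonoidalPreadditive C] [HasColimits C]
  [∀ X : C, PreservesFilteredColimits (tensorLeft X)]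
  [∀ X : C, PreservesFilteredColimits (tensorRight X)]
  {M M' L L' : GradedObject ℤ C} {r s t t' r' s' : ℤ}

theorem recast_tensor (f : GHom M M' r) (g : GHom L L' s) (h : r + s = t) (h' : t = t') :
    recast h' (tensor f g h) = tensor f g (h.trans h') := by
  subst h'
  rw [recast_rfl]

theorem tensor_recast (f : GHom M M' r) (g : GHom L L' s) (h' : s = s') (h : r + s' = t) :
    tensor f (recast h' g) h = tensor f g (by omega) := by
  subst h'
  rw [recast_rfl]

theorem recast_tensor' (f : GHom M M' r) (g : GHom L L' s) (h' : r = r') (h : r' + s = t) :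
    tensor (recast h' f) g h = tensor f g (by omega) := by
  subst h'
  rw [recast_rfl]

end

end GHom

namespace Lab

section

variable {C : Type u} [Category.{v} C] [Preadditive C] {X Y Z : Lab C}

/-- The even part, as an additive map. -/
def evHom (X Y : Lab C) : (X ⟶ Y) →+ GHom X.obj Y.obj (Y.deg - X.deg) where
  toFun := ev
  map_zero' := rfl
  map_add' _ _ := rfl

/-- The odd part, as an additive map. -/
def odHom (X Y : Lab C) : (X ⟶ Y) →+ GHom X.obj Y.obj (Y.deg - X.deg + 1) where
  toFun := od
  map_zero' := rfl
  map_add' _ _ := rfl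

theorem ev_sum {ι : Type*} (s : Finset ι) (f : ι → (X ⟶ Y)) :
    ev (∑ i ∈ s, f i) = ∑ i ∈ s, ev (f i) := map_sum (evHom X Y) f s

theorem od_sum {ι : Type*} (s : Finset ι) (f : ι → (X ⟶ Y)) :
    od (∑ i ∈ s, f i) = ∑ i ∈ s, od (f i) := map_sum (odHom X Y) f s

theorem ev_zero : ev (0 : X ⟶ Y) = 0 := rfl
theorem od_zero : od (0 : X ⟶ Y) = 0 := rfl

theorem ev_ofH_comp (φ : X.obj ⟶ Y.obj) (h : Y.deg - X.deg = 0) (f : Y ⟶ Z) :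
    ev (ofH φ h ≫ f) = GHom.comp (GHom.ofHom φ h) (ev f) (by omega) := rfl

theorem ev_comp_ofH (f : X ⟶ Y) (φ : Y.obj ⟶ Z.obj) (h : Z.deg - Y.deg = 0) :
    ev (f ≫ ofH φ h) = GHom.comp (ev f) (GHom.ofHom φ h) (by omega) := rfl

/-- An even morphism. -/
def evenL (f : GHom X.obj Y.obj (Y.deg - X.deg)) : X ⟶ Y := mkHom ⟨f, 0⟩

/-- An odd morphism. -/
def oddL (f : GHom X.obj Y.obj (Y.deg - X.deg + 1)) : X ⟶ Y := mkHom ⟨0, f⟩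

end

section

variable {C : Type u} [Category.{v} C] [Preadditive C] [HasFiniteBiproducts C]
  [MonoidalCategory C] [MonoidalPreadditive C] [HasColimits C]
  [∀ X : C, PreservesFilteredColimits (tensorLeft X)]
  [∀ X : C, PreservesFilteredColimits (tensorRight X)] {V W : Lab C}

theorem ev_tensorHom {X X' Y Y' : Lab C} (f : X ⟶ X') (g : Y ⟶ Y') : ev (f ⊗ₘ g) =
    (X.deg * (Y'.deg - Y.deg)).negOnePow • GHom.tensor (ev f) (ev g)
        (t := X'.deg + Y'.deg - (X.deg + Y.deg)) (by ring) := rfl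

theorem od_tensorHom {X X' Y Y' : Lab C} (f : X ⟶ X') (g : Y ⟶ Y') : od (f ⊗ₘ g) =
    (X.deg * (Y'.deg - Y.deg + 1)).negOnePow • GHom.tensor (ev f) (od g)
            (t := X'.deg + Y'.deg - (X.deg + Y.deg) + 1) (by ring) +
          (X.deg * (Y'.deg - Y.deg) + Y'.deg).negOnePow • GHom.tensor (od f) (ev g)
            (t := X'.deg + Y'.deg - (X.deg + Y.deg) + 1) (by ring) := rfl

open Abs

theorem ev_F_congr (f g : ∀ n, Pow V n ⟶ W) (h : ∀ n, ev (f n) = ev (g n)) :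
    ∀ r n, ev (F f r n) = ev (F g r n) := by
  intro r
  induction r with
  | zero => intro n; cases n <;> rfl
  | succ r ih =>
    intro n
    rw [F_succ, F_succ, ev_sum, ev_sum]
    refine Finset.sum_congr rfl fun x _ => ?_
    rw [ev_comp, ev_comp, ev_tensorHom, ev_tensorHom, h, ih]

theorem od_comp_zero {X Y Z : Lab C} (f : X ⟶ Y) (g : Y ⟶ Z) (hf : od f = 0) (hg : od g = 0) :
    od (f ≫ g) = 0 := by
  rw [od_comp, hf, hg, GHom.comp_zero, GHom.zero_comp, add_zero]

theorem od_tens_zero {X Y Z T : Lab C} (f : X ⟶ Y) (g : Z ⟶ T) (hf : od f = 0) (hg : od g = 0) :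
    od (f ⊗ₘ g) = 0 := by
  rw [od_tensorHom, hf, hg, GHom.tensor_zero, GHom.zero_tensor, smul_zero, smul_zero, add_zero]

theorem od_sp (V : Lab C) : ∀ i j n, od (sp V i j n) = 0 := by
  intro i
  induction i with
  | zero =>
    intro j n
    by_cases h : n = j
    · subst h
      rw [sp_zero]
      rfl
    · rw [sp_zero_ne V h]
      rfl
  | succ i ih =>
    intro j n
    cases n with
    | zero => rfl
    | succ n =>
      rw [sp_succ, ← MonoidalCategory.id_tensorHom]
      exact od_comp_zero _ _ (od_tens_zero _ _ rfl (ih j n)) rfl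

theorem od_F (f : ∀ n, Pow V n ⟶ W) (h : ∀ n, od (f n) = 0) : ∀ r n, od (F f r n) = 0 := by
  intro r
  induction r with
  | zero => intro n; cases n <;> rfl
  | succ r ih =>
    intro n
    rw [F_succ, od_sum]
    exact Finset.sum_eq_zero fun x _ =>
      od_comp_zero _ _ (od_sp _ _ _ _) (od_tens_zero _ _ (h _) (ih _))

theorem ofH_whiskerLeft (X : Lab C) {Y Z : Lab C} (φ : Y.obj ⟶ Z.obj) (h : Z.deg - Y.deg = 0) :
    X ◁ ofH φ h = ofH (X := X ⊗ Y) (Y := X ⊗ Z) (X.obj ◁ φ)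
      (by change X.deg + Z.deg - (X.deg + Y.deg) = 0; omega) := by
  rw [← MonoidalCategory.id_tensorHom, id_ofH, tensorHom_ofH]
  simp only [MonoidalCategory.id_tensorHom]

theorem ofH_whiskerRight {Y Z : Lab C} (φ : Y.obj ⟶ Z.obj) (h : Z.deg - Y.deg = 0) (X : Lab C) :
    ofH φ h ▷ X = ofH (X := Y ⊗ X) (Y := Z ⊗ X) (φ ▷ X.obj)
      (by change Z.deg + X.deg - (Y.deg + X.deg) = 0; omega) := by
  rw [← MonoidalCategory.tensorHom_id, id_ofH, tensorHom_ofH]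
  simp only [MonoidalCategory.tensorHom_id]

theorem assoc_inv_ofH (X Y Z : Lab C) : (α_ X Y Z).inv =
    ofH (X := X ⊗ Y ⊗ Z) (Y := (X ⊗ Y) ⊗ Z) (α_ X.obj Y.obj Z.obj).inv
      (by change X.deg + Y.deg + Z.deg - (X.deg + (Y.deg + Z.deg)) = 0; ring) := rfl

theorem left_inv_ofH (X : Lab C) : (λ_ X).inv = ofH (X := X) (Y := 𝟙_ _ ⊗ X) (λ_ X.obj).inv
      (by change (0 + X.deg) - X.deg = 0; ring) := rfl

/-- The graded object `A` shifted by one. -/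
abbrev sV (A : GradedObject ℤ C) : Lab C := ⟨A, 1⟩

/-- The `n`-th tensor power of `A`, shifted by `n`. -/
noncomputable abbrev sP (A : GradedObject ℤ C) (n : ℕ) : Lab C := ⟨pow A n, n⟩

/-- Relabelling. -/
noncomputable def rl (A : GradedObject ℤ C) (n : ℕ) : sV A ⊗ sP A n ≅ sP A (n + 1) :=
  isoMk (X := sV A ⊗ sP A n) (Y := sP A (n + 1)) (Iso.refl (A ⊗ pow A n))
    (by change ((n + 1 : ℕ) : ℤ) - (1 + n) = 0; push_cast; ring)

/-- The comparison of the two tensor powers. -/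
noncomputable def e (A : GradedObject ℤ C) : ∀ n, Pow (sV A) n ≅ sP A n
  | 0 => isoMk (X := 𝟙_ (Lab C)) (Y := sP A 0) (Iso.refl (𝟙_ _)) (sub_self _)
  | n + 1 => whiskerLeftIso (sV A) (e A n) ≪≫ rl A n

theorem e_succ_hom (A : GradedObject ℤ C) (n : ℕ) :
    (e A (n + 1)).hom = sV A ◁ (e A n).hom ≫ (rl A n).hom := rfl

theorem e_succ_inv (A : GradedObject ℤ C) (n : ℕ) :
    (e A (n + 1)).inv = (rl A n).inv ≫ sV A ◁ (e A n).inv := rfl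

theorem rl_hom (A : GradedObject ℤ C) (n : ℕ) : (rl A n).hom =
    ofH (X := sV A ⊗ sP A n) (Y := sP A (n + 1)) (𝟙 (A ⊗ pow A n))
    (by change ((n + 1 : ℕ) : ℤ) - (1 + n) = 0; push_cast; ring) := rfl

theorem rl_inv (A : GradedObject ℤ C) (n : ℕ) : (rl A n).inv =
    ofH (X := sP A (n + 1)) (Y := sV A ⊗ sP A n) (𝟙 (A ⊗ pow A n))
    (by change (1 + n : ℤ) - ((n + 1 : ℕ) : ℤ) = 0; push_cast; ring) := rfl

theorem ofH_comp₄ {X₁ X₂ X₃ X₄ X₅ : Lab C} (φ₁ : X₁.obj ⟶ X₂.obj) (φ₂ : X₂.obj ⟶ X₃.obj)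
    (φ₃ : X₃.obj ⟶ X₄.obj) (φ₄ : X₄.obj ⟶ X₅.obj) (h₁ : X₂.deg - X₁.deg = 0)
    (h₂ : X₃.deg - X₂.deg = 0) (h₃ : X₄.deg - X₃.deg = 0) (h₄ : X₅.deg - X₄.deg = 0) :
    ofH φ₁ h₁ ≫ ofH φ₂ h₂ ≫ ofH φ₃ h₃ ≫ ofH φ₄ h₄ =
      ofH (X := X₁) (Y := X₅) (φ₁ ≫ φ₂ ≫ φ₃ ≫ φ₄) (by omega) := by
  rw [ofH_comp, ofH_comp, ofH_comp]

theorem e_split (A : GradedObject ℤ C) : ∀ (i j n : ℕ) (h : i + j = n),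
    (e A n).inv ≫ sp (sV A) i j n ≫ ((e A i).hom ⊗ₘ (e A j).hom) =
      ofH (X := sP A n) (Y := sP A i ⊗ sP A j) (split A i j n h).hom
        (by change (i + j : ℤ) - n = 0; omega) := by
  intro i
  induction i with
  | zero =>
    intro j n h
    obtain rfl : j = n := by omega
    rw [sp_zero, MonoidalCategory.tensorHom_def', ← leftUnitor_inv_naturality_assoc,
      Iso.inv_hom_id_assoc]
    have h1 : (e A 0).hom = ofH (X := 𝟙_ (Lab C)) (Y := sP A 0) (𝟙 (𝟙_ (GradedObject ℤ C)))
      (sub_self _) := rfl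
    have h2 : (split A 0 j j h).hom = (λ_ (pow A j)).inv ≫ 𝟙 (𝟙_ _) ▷ pow A j := by
      rw [MonoidalCategory.id_whiskerRight]
      exact (Category.id_comp _).trans (Category.comp_id _).symm
    rw [h1, left_inv_ofH, h2]
    erw [ofH_whiskerRight, ofH_comp]
    rfl
  | succ i ih =>
    intro j n h
    obtain ⟨n, rfl⟩ : ∃ n', n = n' + 1 := ⟨n - 1, by omega⟩
    have h1 : (e A (i + 1)).hom ⊗ₘ (e A j).hom =
        ((sV A ◁ (e A i).hom) ⊗ₘ (e A j).hom) ≫ (rl A i).hom ▷ sP A j := by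
      rw [e_succ_hom, ← MonoidalCategory.tensorHom_id, MonoidalCategory.tensorHom_comp_tensorHom,
        Category.comp_id]
    have h2 : (α_ (sV A) (Pow (sV A) i) (Pow (sV A) j)).inv ≫
        ((sV A ◁ (e A i).hom) ⊗ₘ (e A j).hom) =
        sV A ◁ ((e A i).hom ⊗ₘ (e A j).hom) ≫ (α_ (sV A) (sP A i) (sP A j)).inv := by
      rw [← MonoidalCategory.id_tensorHom, ← associator_inv_naturality,
        MonoidalCategory.id_tensorHom]
    have h3 := congrArg (fun x => sV A ◁ x) (ih j n (by omega))
    simp only [MonoidalCategory.whiskerLeft_comp] at h3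
    rw [sp_succ, e_succ_inv, h1, Category.assoc, Category.assoc, reassoc_of% h2,
      reassoc_of% h3, rl_inv, rl_hom, ofH_whiskerLeft, assoc_inv_ofH]
    have h4 : (split A (i + 1) j (n + 1) h).hom = 𝟙 (A ⊗ pow A n) ≫
        (A ◁ (split A i j n (by omega)).hom) ≫ (α_ A (pow A i) (pow A j)).inv ≫
          (𝟙 (A ⊗ pow A i) ▷ pow A j) := by
      rw [MonoidalCategory.id_whiskerRight]
      refine Eq.trans ?_ (Category.id_comp _).symm
      exact congrArg (fun x => A ◁ (split A i j n (by omega)).hom ≫ x) (Category.comp_id _).symm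
    rw [h4]
    erw [ofH_whiskerRight]
    refine ofH_comp₄ (X₁ := sP A (n + 1)) (X₂ := sV A ⊗ sP A n)
      (X₃ := sV A ⊗ sP A i ⊗ sP A j) (X₄ := (sV A ⊗ sP A i) ⊗ sP A j)
      (X₅ := sP A (i + 1) ⊗ sP A j) _ _ _ _ _ _ _ _

end

end Lab

end AInf

namespace AInf

theorem sum_tuple_succ {M : Type*} [AddCommMonoid M] (r n : ℕ) (T : (Fin (r + 1) → ℕ) → M) :
    ∑ i ∈ Finset.Nat.antidiagonalTuple (r + 1) n, T i =
      ∑ x ∈ Finset.HasAntidiagonal.antidiagonal n,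
        ∑ t ∈ Finset.Nat.antidiagonalTuple r x.2, T (Fin.cons x.1 t) := by
  rw [Finset.sum_sigma']
  refine Finset.sum_nbij' (fun i => ⟨(i 0, ∑ u : Fin r, i u.succ), fun u => i u.succ⟩)
    (fun x => Fin.cons x.1.1 x.2) ?_ ?_ ?_ ?_ ?_
  · intro i hi
    have h := Finset.Nat.mem_antidiagonalTuple.1 hi
    rw [Fin.sum_univ_succ] at h
    simp only [Finset.mem_sigma, Finset.HasAntidiagonal.mem_antidiagonal,
      Finset.Nat.mem_antidiagonalTuple]
    exact ⟨h, trivial⟩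
  · rintro ⟨⟨a, b⟩, t⟩ h
    simp only [Finset.mem_sigma, Finset.HasAntidiagonal.mem_antidiagonal,
      Finset.Nat.mem_antidiagonalTuple] at h ⊢
    rw [Fin.sum_univ_succ]
    simp only [Fin.cons_zero, Fin.cons_succ]
    omega
  · intro i hi
    exact Fin.cons_self_tail i
  · rintro ⟨⟨a, b⟩, t⟩ h
    simp only [Finset.mem_sigma, Finset.HasAntidiagonal.mem_antidiagonal,
      Finset.Nat.mem_antidiagonalTuple] at h ⊢
    simp [h.2]
  · intro i hi
    exact congrArg T (Fin.cons_self_tail i).symm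

theorem sgn_cons {r : ℕ} (a : ℕ) (t : Fin r → ℕ) :
    (sgn (Fin.cons a t : Fin (r + 1) → ℕ)).negOnePow =
      ((a : ℤ) * (r - ∑ u, (t u : ℤ)) + sgn t).negOnePow := by
  rw [Int.negOnePow_eq_iff]
  have h1 : sgn (Fin.cons a t : Fin (r + 1) → ℕ) =
      ∑ u : Fin r, (1 - (t u : ℤ)) * (a + ∑ v ∈ Finset.Iic u, (t v : ℤ)) := by
    rw [sgn, Finset.sum_filter, Fin.sum_univ_succ]
    simp only [Fin.val_zero, lt_self_iff_false, if_false, zero_add, Fin.val_succ,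
      Nat.succ_pos, if_true, Fin.cons_succ]
    refine Finset.sum_congr rfl fun u _ => ?_
    congr 1
    have : ∀ (q : ℕ) (i : Fin q → ℕ) (w : Fin q), ∑ v ∈ Finset.Iic w, (i v : ℤ) =
        ∑ v, if v ≤ w then (i v : ℤ) else 0 := by
      intro q i w
      rw [← Finset.sum_filter]
      congr 1
      ext v
      simp
    rw [this, this, Fin.sum_univ_succ]
    simp [Fin.succ_le_succ_iff]
  rw [h1]
  simp only [mul_add, Finset.sum_add_distrib]
  rw [← Finset.sum_mul, Finset.sum_sub_distrib]
  have h2 : Even (∑ u : Fin r, (1 - (t u : ℤ)) * ∑ v ∈ Finset.Iic u, (t v : ℤ) - sgn t) := by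
    cases r with
    | zero => simp [sgn]
    | succ r =>
      rw [sgn, Finset.sum_filter, ← Finset.sum_sub_distrib, Fin.sum_univ_succ]
      have : (Finset.Iic (0 : Fin (r + 1))) = {0} := by
        ext v
        simp
      simp only [this, Finset.sum_singleton, Fin.val_zero, lt_self_iff_false, if_false, sub_zero,
        Fin.val_succ, Nat.succ_pos, if_true, sub_self, Finset.sum_const_zero, add_zero]
      have h := Int.even_mul_succ_self ((t 0 : ℤ) - 1)
      rw [← even_neg]
      have h' : -((1 - (t 0 : ℤ)) * (t 0 : ℤ)) = ((t 0 : ℤ) - 1) * ((t 0 : ℤ) - 1 + 1) := by ring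
      rw [h']
      exact h
  simp only [Finset.sum_const, Finset.card_univ, Fintype.card_fin, nsmul_eq_mul, mul_one]
  convert h2 using 1
  ring

namespace GHom

section

variable {C : Type u} [Category.{v} C] [Preadditive C] [HasFiniteBiproducts C]
  [MonoidalCategory C] [MonoidalPreadditive C] [HasColimits C]
  [∀ X : C, PreservesFilteredColimits (tensorLeft X)]
  [∀ X : C, PreservesFilteredColimits (tensorRight X)]
  {M M' L L' N : GradedObject ℤ C} {r s t : ℤ} {ι : Type*}

theorem tensor_sum (f : GHom M M' r) (S : Finset ι) (g : ι → GHom L L' s) (h : r + s = t) :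
    tensor f (∑ i ∈ S, g i) h = ∑ i ∈ S, tensor f (g i) h :=
  map_sum ({ toFun := fun x => tensor f x h, map_zero' := tensor_zero f h,
             map_add' := fun x y => tensor_add f x y h } : GHom L L' s →+ _) g S

theorem comp_sum (f : GHom M L r) (S : Finset ι) (g : ι → GHom L N s) (h : r + s = t) :
    comp f (∑ i ∈ S, g i) h = ∑ i ∈ S, comp f (g i) h :=
  map_sum ({ toFun := fun x => comp f x h, map_zero' := comp_zero f h,
             map_add' := fun x y => comp_add f x y h } : GHom L N s →+ _) g S

theorem sum_comp (S : Finset ι) (f : ι → GHom M L r) (g : GHom L N s) (h : r + s = t) :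
    comp (∑ i ∈ S, f i) g h = ∑ i ∈ S, comp (f i) g h :=
  map_sum ({ toFun := fun x => comp x g h, map_zero' := zero_comp g h,
             map_add' := fun x y => add_comp x y g h } : GHom M L r →+ _) f S

theorem ofHom_comp_eq {z z' s' t : ℤ} (φ : M ⟶ L) (hz : z = 0) (hz' : z' = 0) (x : GHom L N s)
    (x' : GHom L N s') (hs : s = s') (hx : recast hs x = x') (h : z + s = t) (h' : z' + s' = t) :
    comp (ofHom φ hz) x h = comp (ofHom φ hz') x' h' := by
  subst hz hz' hs
  rw [recast_rfl] at hx
  rw [hx]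

theorem recast_sum (h : r = s) (S : Finset ι) (f : ι → GHom M L r) :
    recast h (∑ i ∈ S, f i) = ∑ i ∈ S, recast h (f i) := by
  subst h
  simp only [recast_rfl]

end

end GHom

namespace Lab

section

variable {C : Type u} [Category.{v} C] [Preadditive C] [HasFiniteBiproducts C]
  [MonoidalCategory C] [MonoidalPreadditive C] [HasColimits C]
  [∀ X : C, PreservesFilteredColimits (tensorLeft X)]
  [∀ X : C, PreservesFilteredColimits (tensorRight X)]
  {A B D : GradedObject ℤ C}

open Abs

/-- A family transported to the literal tensor powers. -/
noncomputable def fam (f : ∀ n, Pow (sV A) n ⟶ sV B) (n : ℕ) : sP A n ⟶ sV B :=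
  (e A n).inv ≫ f n

/-- The matrix of a family, on the literal tensor powers. -/
noncomputable def mat (f : ∀ n, Pow (sV A) n ⟶ sV B) (r n : ℕ) : sP A n ⟶ sP B r :=
  (e A n).inv ≫ F f r n ≫ (e B r).hom

theorem mat_succ (f : ∀ n, Pow (sV A) n ⟶ sV B) (r n : ℕ) : mat f (r + 1) n =
    ∑ x ∈ Finset.HasAntidiagonal.antidiagonal n,
      ((e A n).inv ≫ sp (sV A) x.1 x.2 n ≫ ((e A x.1).hom ⊗ₘ (e A x.2).hom)) ≫
        (fam f x.1 ⊗ₘ mat f r x.2) ≫ (rl B r).hom := by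
  rw [mat, F_succ, Preadditive.sum_comp, Preadditive.comp_sum]
  refine Finset.sum_congr rfl fun x _ => ?_
  have h : ((e A x.1).hom ⊗ₘ (e A x.2).hom) ≫ (fam f x.1 ⊗ₘ mat f r x.2) =
      (f x.1 ⊗ₘ F f r x.2) ≫ sV B ◁ (e B r).hom := by
    rw [← MonoidalCategory.id_tensorHom, MonoidalCategory.tensorHom_comp_tensorHom,
      MonoidalCategory.tensorHom_comp_tensorHom, fam, mat, Iso.hom_inv_id_assoc,
      Iso.hom_inv_id_assoc, Category.comp_id]
  rw [e_succ_hom, Category.assoc, Category.assoc, Category.assoc, reassoc_of% h]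

/-- The family of graded morphisms `blk`, extended by zero. -/
noncomputable def blkT (g : ∀ n : ℕ, GHom (pow A n) B (1 - n)) (r : ℕ) (i : Fin r → ℕ) (n : ℕ) :
    GHom (pow A n) (pow B r) (r - n) :=
  if h : ∑ u, i u = n then blk g r i n h else 0

theorem ev_comp_rl {X : Lab C} (r : ℕ) (f : X ⟶ sV B ⊗ sP B r) : ev (f ≫ (rl B r).hom) =
    GHom.recast (by change (1 + r : ℤ) - _ = ((r + 1 : ℕ) : ℤ) - _; push_cast; ring) (ev f) := by
  rw [rl_hom]
  refine GHom.comp_ofHom_id (L := B ⊗ pow B r) (ev f) ?_ ?_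
  · change ((r + 1 : ℕ) : ℤ) - (1 + r) = 0
    push_cast; ring
  · change (1 + r : ℤ) - _ + (((r + 1 : ℕ) : ℤ) - (1 + r)) = ((r + 1 : ℕ) : ℤ) - _
    push_cast; ring

theorem od_comp_rl {X : Lab C} (r : ℕ) (f : X ⟶ sV B ⊗ sP B r) : od (f ≫ (rl B r).hom) =
    GHom.recast (by change (1 + r : ℤ) - _ + 1 = ((r + 1 : ℕ) : ℤ) - _ + 1; push_cast; ring)
      (od f) := by
  have h : (sP B (r + 1)).deg - (sV B ⊗ sP B r).deg = 0 := by
    change ((r + 1 : ℕ) : ℤ) - (1 + r) = 0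
    push_cast; ring
  exact (od_comp_ofH (Y := sV B ⊗ sP B r) (Z := sP B (r + 1)) f (𝟙 (B ⊗ pow B r)) h).trans
    (GHom.comp_ofHom_id (L := B ⊗ pow B r) (od f) h (by omega))

theorem ev_step {a b n r : ℕ} (hn : a + b = n) (f : sP A a ⟶ sV B) (g : sP A b ⟶ sP B r)
    (hd : (sP A a ⊗ sP A b).deg - (sP A n).deg = 0) :
    ev (ofH (X := sP A n) (Y := sP A a ⊗ sP A b) (split A a b n hn).hom hd ≫
      (f ⊗ₘ g) ≫ (rl B r).hom) =
    GHom.comp (GHom.ofHom (split A a b n hn).hom rfl)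
      (((a : ℤ) * (r - b)).negOnePow • GHom.tensor (ev f) (ev g)
        (t := ((r + 1 : ℕ) : ℤ) - n) (by push_cast; omega)) (zero_add _) := by
  rw [ev_ofH_comp, ev_comp_rl, ev_tensorHom]
  have hs : ((r + 1 : ℕ) : ℤ) - (a + b) = ((r + 1 : ℕ) : ℤ) - n := by omega
  refine GHom.ofHom_comp_eq _ _ _ _ _ hs ?_ _ _
  refine (GHom.recast_recast _ _ _).trans ?_
  refine (GHom.recast_smul _ _ _).trans (congrArg _ ?_)
  exact GHom.recast_tensor _ _ _ _

theorem ev_mat (f : ∀ n, Pow (sV A) n ⟶ sV B) (g : ∀ n : ℕ, GHom (pow A n) B (1 - n))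
    (h : ∀ n, ev (fam f n) = g n) : ∀ r n : ℕ, ev (mat f r n) =
      ∑ i ∈ Finset.Nat.antidiagonalTuple r n, (sgn i).negOnePow • blkT g r i n := by
  intro r
  induction r with
  | zero =>
    intro n
    cases n with
    | zero =>
      rw [Finset.Nat.antidiagonalTuple_zero_zero, Finset.sum_singleton, blkT, dif_pos (by simp)]
      have h1 : mat f 0 0 = ofH (X := sP A 0) (Y := sP B 0) (𝟙 (𝟙_ (GradedObject ℤ C)))
          (sub_self _) := by
        rw [mat, F_zero_zero]
        refine (congrArg (fun x => (e A 0).inv ≫ x) (Category.id_comp (X := 𝟙_ (Lab C))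
          (e B 0).hom)).trans ?_
        refine (ofH_comp (X := sP A 0) (Y := 𝟙_ (Lab C)) (Z := sP B 0)
          (𝟙 (𝟙_ (GradedObject ℤ C))) (sub_self _)
          (𝟙 (𝟙_ (GradedObject ℤ C))) (sub_self _)).trans ?_
        exact congrArg (fun x => ofH (X := sP A 0) (Y := sP B 0) x (sub_self _))
          (Category.comp_id _)
      have h2 : sgn (![] : Fin 0 → ℕ) = 0 := by simp [sgn]
      rw [h1, h2, Int.negOnePow_zero, one_smul]
      rfl
    | succ n =>
      rw [Finset.Nat.antidiagonalTuple_zero_succ, Finset.sum_empty, mat, F_zero_ne _ (by omega),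
        zero_comp, comp_zero]
      rfl
  | succ r ih =>
    intro n
    rw [mat_succ, ev_sum, sum_tuple_succ]
    refine Finset.sum_congr rfl fun x hx => ?_
    have hx' := Finset.HasAntidiagonal.mem_antidiagonal.1 hx
    rw [e_split A x.1 x.2 n hx', ev_step, h, ih, GHom.tensor_sum, Finset.smul_sum, GHom.comp_sum]
    refine Finset.sum_congr rfl fun t ht => ?_
    obtain ⟨a, b⟩ := x
    have ht' := Finset.Nat.mem_antidiagonalTuple.1 ht
    dsimp only at ht' hx' ⊢
    subst ht'
    have h1 : ∑ u, (Fin.cons a t : Fin (r + 1) → ℕ) u = n := by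
      rw [Fin.sum_univ_succ]
      simpa using hx'
    rw [blkT, blkT, dif_pos rfl, dif_pos h1, GHom.tensor_smul, smul_smul, ← Int.negOnePow_add,
      GHom.comp_smul, sgn_cons]
    push_cast
    rfl

end

end Lab

end AInf

namespace AInf

namespace Abs

variable {G : Type u} [Category.{v} G] [Preadditive G] [MonoidalCategory G] [MonoidalPreadditive G]
  {V W : G}

theorem F_one_add (p : ∀ n, Pow V n ⟶ V) (r n : ℕ) :
    F (fun n => one V n + p n) (r + 1) (n + 1) =
      V ◁ F (fun n => one V n + p n) r n +
        ∑ x ∈ Finset.HasAntidiagonal.antidiagonal (n + 1),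
          sp V x.1 x.2 (n + 1) ≫ (p x.1 ⊗ₘ F (fun n => one V n + p n) r x.2) := by
  rw [F_succ]
  simp only [MonoidalPreadditive.add_tensor, Preadditive.comp_add, Finset.sum_add_distrib]
  congr 1
  rw [Finset.sum_eq_single (1, n)]
  · dsimp only
    rw [one_one, show sp V 1 n (n + 1) = _ from sp_succ V 0 n n, sp_zero]
    change (V ◁ _ ≫ (α_ V (𝟙_ G) _).inv) ≫ ((ρ_ V).hom ⊗ₘ _) = _
    rw [MonoidalCategory.tensorHom_def]
    simp
  · rintro ⟨a, b⟩ h1 h2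
    rw [one_ne, zero_tensor', comp_zero]
    rintro rfl
    apply h2
    have := Finset.HasAntidiagonal.mem_antidiagonal.1 h1
    simp only [Prod.mk.injEq, true_and]
    omega
  · intro h
    exact absurd (Finset.HasAntidiagonal.mem_antidiagonal.2 (by dsimp; omega)) h

end Abs

namespace GHom

theorem recast_cancel {C : Type u} [Category.{v} C] [Preadditive C] {M L : GradedObject ℤ C}
    {r s : ℤ} (h : r = s) (h' : s = r) (f : GHom M L r) : recast h' (recast h f) = f := by
  subst h
  rw [recast_rfl, recast_rfl]

theorem tensor_eq {C : Type u} [Category.{v} C] [Preadditive C] [HasFiniteBiproducts C]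
    [MonoidalCategory C] [MonoidalPreadditive C] [HasColimits C]
    [∀ X : C, PreservesFilteredColimits (tensorLeft X)]
    [∀ X : C, PreservesFilteredColimits (tensorRight X)]
    {M M' L L' : GradedObject ℤ C} {r r' s s' t : ℤ} {f : GHom M M' r} {f' : GHom M M' r'}
    {g : GHom L L' s} {g' : GHom L L' s'} (hr : r = r') (hs : s = s') (hf : recast hr f = f')
    (hg : recast hs g = g') (h : r + s = t) (h' : r' + s' = t) :
    tensor f g h = tensor f' g' h' := by
  subst hr hs hf hg
  rw [recast_rfl, recast_rfl]

end GHom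

namespace Lab

section

variable {C : Type u} [Category.{v} C] [Preadditive C] [HasFiniteBiproducts C]
  [MonoidalCategory C] [MonoidalPreadditive C] [HasColimits C]
  [∀ X : C, PreservesFilteredColimits (tensorLeft X)]
  [∀ X : C, PreservesFilteredColimits (tensorRight X)]
  {A B D : GradedObject ℤ C}

open Abs

/-- The odd family attached to operations. -/
noncomputable def psi (m : ∀ n : ℕ, GHom (pow A n) A (2 - n)) (n : ℕ) : Pow (sV A) n ⟶ sV A :=
  (e A n).hom ≫ oddL (X := sP A n) (GHom.recast (by dsimp; ring) (m n))

/-- The family `1 + ε m` attached to operations. -/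
noncomputable def phi (m : ∀ n : ℕ, GHom (pow A n) A (2 - n)) (n : ℕ) : Pow (sV A) n ⟶ sV A :=
  one (sV A) n + psi m n

theorem fam_psi (m : ∀ n : ℕ, GHom (pow A n) A (2 - n)) (n : ℕ) :
    fam (psi m) n = oddL (X := sP A n) (GHom.recast (by dsimp; ring) (m n)) := by
  rw [fam, psi, Iso.inv_hom_id_assoc]

theorem ev_psi (m : ∀ n : ℕ, GHom (pow A n) A (2 - n)) (n : ℕ) : ev (psi m n) = 0 := by
  rw [psi, ev_comp]
  exact GHom.comp_zero _ _

theorem ev_phi (m : ∀ n : ℕ, GHom (pow A n) A (2 - n)) (n : ℕ) :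
    ev (phi m n) = ev (one (sV A) n) := by
  rw [phi, ev_add, ev_psi, add_zero]

theorem ev_mat_phi_ne (m : ∀ n : ℕ, GHom (pow A n) A (2 - n)) {r n : ℕ} (h : n ≠ r) :
    ev (mat (phi m) r n) = 0 := by
  rw [mat, ev_comp, ev_comp, ev_F_congr _ _ (ev_phi m), ← ev_comp, ← ev_comp, (F_id r).2 n h,
    zero_comp, comp_zero]
  rfl

theorem ev_mat_phi (m : ∀ n : ℕ, GHom (pow A n) A (2 - n)) (n : ℕ) :
    ev (mat (phi m) n n) = GHom.ofHom (𝟙 (pow A n)) (sub_self _) := by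
  rw [mat, ev_comp, ev_comp, ev_F_congr _ _ (ev_phi m), ← ev_comp, ← ev_comp, (F_id n).1,
    Category.id_comp, Iso.inv_hom_id]
  rfl

theorem od_step {a b n r : ℕ} (hn : a + b = n) (f : sP A a ⟶ sV B) (g : sP A b ⟶ sP B r)
    (hd : (sP A a ⊗ sP A b).deg - (sP A n).deg = 0) (hf : ev f = 0) :
    od (ofH (X := sP A n) (Y := sP A a ⊗ sP A b) (split A a b n hn).hom hd ≫
      (f ⊗ₘ g) ≫ (rl B r).hom) =
    GHom.comp (GHom.ofHom (split A a b n hn).hom rfl)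
      (((a : ℤ) * (r - b) + r).negOnePow • GHom.tensor (od f) (ev g)
        (t := ((r + 1 : ℕ) : ℤ) - n + 1) (by push_cast; omega)) (zero_add _) := by
  rw [od_ofH_comp, od_comp_rl, od_tensorHom, hf, GHom.zero_tensor, smul_zero, zero_add]
  have hs : ((r + 1 : ℕ) : ℤ) - (a + b) + 1 = ((r + 1 : ℕ) : ℤ) - n + 1 := by omega
  refine GHom.ofHom_comp_eq _ _ _ _ _ hs ?_ _ _
  refine (GHom.recast_recast _ _ _).trans ?_
  refine (GHom.recast_smul _ _ _).trans (congrArg _ ?_)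
  exact GHom.recast_tensor _ _ _ _

theorem od_id_tensorHom (X : Lab C) {Y Y' : Lab C} (g : Y ⟶ Y') : od (𝟙 X ⊗ₘ g) =
    (X.deg * (Y'.deg - Y.deg + 1)).negOnePow • GHom.tensor (GHom.ofHom (𝟙 X.obj) (sub_self X.deg)) (od g)
            (t := X.deg + Y'.deg - (X.deg + Y.deg) + 1) (by ring) := by
  have h0 : od (𝟙 X) = 0 := rfl
  rw [od_tensorHom, h0, GHom.zero_tensor, smul_zero]
  exact add_zero (M := GHom (X.obj ⊗ Y.obj) (X.obj ⊗ Y'.obj)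
    (X.deg + Y'.deg - (X.deg + Y.deg) + 1)) _

theorem od_whisker {n r : ℕ} (g : sP A n ⟶ sP A r) :
    od ((rl A n).inv ≫ sV A ◁ g ≫ (rl A r).hom) =
      ((r : ℤ) - n + 1).negOnePow • GHom.tensor (M := A) (L := pow A n)
        (GHom.ofHom (𝟙 A) rfl) (od g)
        (t := ((r + 1 : ℕ) : ℤ) - (n + 1 : ℕ) + 1) (by push_cast; omega) := by
  rw [rl_inv, ← MonoidalCategory.id_tensorHom]
  have hd : (sV A ⊗ sP A n).deg - (sP A (n + 1)).deg = 0 := by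
    change (1 + n : ℤ) - ((n + 1 : ℕ) : ℤ) = 0
    push_cast; ring
  refine (od_ofH_comp (X := sP A (n + 1)) (Y := sV A ⊗ sP A n) _ _ hd).trans ?_
  rw [od_comp_rl, od_id_tensorHom, GHom.recast_smul]
  refine (GHom.comp_smul _ _ _ _).trans ?_
  have e1 : ((1 : ℤ) * (r - n + 1)).negOnePow = ((r : ℤ) - n + 1).negOnePow := by rw [one_mul]
  refine congrArg₂ (· • ·) e1 ?_
  refine (GHom.ofHom_id_comp _ _ _).trans ?_
  refine (GHom.recast_recast _ _ _).trans ?_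
  refine (GHom.recast_tensor _ _ _ _).trans ?_
  exact GHom.tensor_eq (sub_self _) rfl (GHom.recast_ofHom _ _ _) (GHom.recast_rfl _ _) _ _

/-- The family of graded morphisms `ins`, extended by zero. -/
noncomputable def insT (m : ∀ n : ℕ, GHom (pow A n) A (2 - n)) (j k l i n : ℕ) :
    GHom (pow A n) (pow A i) (i - n + 1) :=
  if h : j + k + l = n ∧ j + 1 + l = i then
    GHom.recast (by omega) (ins m j k l n i h.1 h.2) else 0

theorem ins_zero (m : ∀ n : ℕ, GHom (pow A n) A (2 - n)) (hm : m 0 = 0) :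
    ∀ (j l n i : ℕ) (h : j + 0 + l = n) (h' : j + 1 + l = i), ins m j 0 l n i h h' = 0 := by
  intro j
  induction j with
  | zero =>
    intro l n i h h'
    obtain ⟨i, rfl⟩ : ∃ i', i = i' + 1 := ⟨i - 1, by omega⟩
    rw [ins, hm, GHom.zero_tensor]
    exact GHom.comp_zero _ _
  | succ j ih =>
    intro l n i h h'
    obtain ⟨i, rfl⟩ : ∃ i', i = i' + 1 := ⟨i - 1, by omega⟩
    obtain ⟨n, rfl⟩ : ∃ i', n = i' + 1 := ⟨n - 1, by omega⟩
    rw [ins, ih]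
    exact GHom.tensor_zero _ _

theorem insT_zero (m : ∀ n : ℕ, GHom (pow A n) A (2 - n)) (hm : m 0 = 0) (j l i n : ℕ) :
    insT m j 0 l i n = 0 := by
  rw [insT]
  split
  · rw [ins_zero m hm, GHom.recast_zero]
  · rfl

theorem mat_phi_succ (m : ∀ n : ℕ, GHom (pow A n) A (2 - n)) (r n : ℕ) :
    mat (phi m) (r + 1) (n + 1) =
      (rl A n).inv ≫ sV A ◁ mat (phi m) r n ≫ (rl A r).hom +
      ∑ x ∈ Finset.HasAntidiagonal.antidiagonal (n + 1),
      ((e A (n + 1)).inv ≫ sp (sV A) x.1 x.2 (n + 1) ≫ ((e A x.1).hom ⊗ₘ (e A x.2).hom)) ≫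
        (fam (psi m) x.1 ⊗ₘ mat (phi m) r x.2) ≫ (rl A r).hom := by
  have h0 : F (phi m) (r + 1) (n + 1) = _ := F_one_add (psi m) r n
  rw [mat, h0, Preadditive.add_comp, Preadditive.comp_add, Preadditive.sum_comp,
    Preadditive.comp_sum]
  congr 1
  · rw [e_succ_inv, e_succ_hom, mat]
    simp only [MonoidalCategory.whiskerLeft_comp, Category.assoc]
    rfl
  refine Finset.sum_congr rfl fun x _ => ?_
  have h : ((e A x.1).hom ⊗ₘ (e A x.2).hom) ≫ (fam (psi m) x.1 ⊗ₘ mat (phi m) r x.2) =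
      (psi m x.1 ⊗ₘ F (phi m) r x.2) ≫ sV A ◁ (e A r).hom := by
    rw [← MonoidalCategory.id_tensorHom, MonoidalCategory.tensorHom_comp_tensorHom,
      MonoidalCategory.tensorHom_comp_tensorHom, fam, mat, Iso.hom_inv_id_assoc,
      Iso.hom_inv_id_assoc, Category.comp_id]
  rw [e_succ_hom, Category.assoc, Category.assoc, Category.assoc, reassoc_of% h]
  rfl

theorem od_mat_phi (m : ∀ n : ℕ, GHom (pow A n) A (2 - n)) (hm : m 0 = 0) : ∀ s n : ℕ,
    od (mat (phi m) s n) = ∑ x ∈ Finset.HasAntidiagonal.antidiagonal n,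
      ∑ y ∈ Finset.HasAntidiagonal.antidiagonal x.2,
        ((x.1 : ℤ) * y.1 + y.2).negOnePow • insT m x.1 y.1 y.2 s n := by
  have hphi : phi m 0 = 0 := by
    rw [phi, one_ne _ (by omega), psi, hm, GHom.recast_zero]
    exact (zero_add _).trans comp_zero
  intro s
  induction s with
  | zero =>
    intro n
    trans 0
    · cases n with
      | zero =>
        rw [mat]
        exact od_comp_zero _ _ rfl (od_comp_zero _ _ rfl rfl)
      | succ n => rw [mat, F_zero_ne _ (by omega), zero_comp, comp_zero]; rfl
    · symm
      refine Finset.sum_eq_zero fun x _ => Finset.sum_eq_zero fun y _ => ?_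
      rw [insT, dif_neg (by omega), smul_zero]
  | succ s ih =>
    intro n
    cases n with
    | zero =>
      rw [mat, F_lt _ hphi _ _ (by omega), zero_comp, comp_zero]
      simp [insT_zero m hm, od_zero]
    | succ n =>
      rw [mat_phi_succ, od_add, od_sum]
      refine (add_comm _ _).trans ?_
      refine (congrArg₂ (· + ·) ?_ ?_).trans (Finset.Nat.sum_antidiagonal_succ).symm
      · dsimp only
        refine Finset.sum_congr rfl fun x hx => ?_
        obtain ⟨k, l⟩ := x
        have hx' := Finset.HasAntidiagonal.mem_antidiagonal.1 hx
        dsimp only at hx' ⊢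
        rw [e_split A k l (n + 1) hx', od_step hx' _ _ _ (by rw [fam_psi]; rfl)]
        by_cases hl : l = s
        · subst hl
          rw [ev_mat_phi, insT, dif_pos (by omega), fam_psi, GHom.comp_smul, ins]
          have e1 : ((k : ℤ) * (l - l) + l).negOnePow = (((0 : ℕ) : ℤ) * k + l).negOnePow := by
            simp
          refine (congrArg₂ (· • ·) e1 ?_)
          refine Eq.trans ?_ (GHom.recast_comp _ _ _ _).symm
          refine GHom.ofHom_comp_eq _ _ _ _ _ (by push_cast; omega) ?_ _ _
          refine (GHom.recast_tensor _ _ _ _).trans ?_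
          refine GHom.tensor_eq (by change (1:ℤ) - k + 1 = 2 - k; ring) (sub_self _) ?_ ?_ _ _
          · exact GHom.recast_cancel (M := pow A k) (L := A)
              (by change (2 : ℤ) - k = 1 - k + 1; ring) _ (m k)
          · exact GHom.recast_ofHom _ _ _
        · rw [ev_mat_phi_ne m hl, GHom.tensor_zero, smul_zero, GHom.comp_zero, insT,
            dif_neg (by omega), smul_zero]
          rfl
      · rw [od_whisker, ih]
        rw [GHom.tensor_sum, Finset.smul_sum]
        refine Finset.sum_congr rfl fun x hx => ?_
        rw [GHom.tensor_sum, Finset.smul_sum]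
        refine Finset.sum_congr rfl fun y hy => ?_
        obtain ⟨j, p⟩ := x
        obtain ⟨k, l⟩ := y
        dsimp only
        by_cases h : j + k + l = n ∧ j + 1 + l = s
        · rw [insT, insT, dif_pos h, dif_pos (by omega), GHom.tensor_smul, smul_smul,
            ← Int.negOnePow_add, ins]
          have e1 : ((s : ℤ) - n + 1 + (j * k + l)).negOnePow =
              (((j + 1 : ℕ) : ℤ) * k + l).negOnePow := by
            rw [Int.negOnePow_eq_iff, ← h.1, ← h.2]
            refine ⟨1 - k, ?_⟩
            push_cast
            ring
          refine (congrArg₂ (· • ·) e1 ?_)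
          refine Eq.trans ?_ (GHom.recast_tensor _ _ _ _).symm
          exact GHom.tensor_recast _ _ _ _
        · rw [insT, insT, dif_neg h, dif_neg (by omega), smul_zero, smul_zero, GHom.tensor_zero,
            smul_zero]
          rfl

end
end Lab
end AInf

namespace AInf

theorem sum_triples {M : Type*} [AddCommMonoid M] (n : ℕ) (T : ℕ → ℕ → ℕ → M) :
    ∑ x ∈ triples n, T x.1 x.2.1 x.2.2 = ∑ x ∈ Finset.HasAntidiagonal.antidiagonal n,
      ∑ y ∈ Finset.HasAntidiagonal.antidiagonal x.2, T x.1 y.1 y.2 := by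
  rw [Finset.sum_sigma']
  refine Finset.sum_nbij' (fun x => ⟨(x.1, x.2.1 + x.2.2), (x.2.1, x.2.2)⟩)
    (fun x => (x.1.1, x.2.1, x.2.2)) ?_ ?_ ?_ ?_ ?_
  · rintro ⟨j, k, l⟩ h
    have h' := mem_triples.1 h
    rw [Finset.mem_sigma, Finset.HasAntidiagonal.mem_antidiagonal,
      Finset.HasAntidiagonal.mem_antidiagonal]
    exact ⟨(Nat.add_assoc _ _ _).symm.trans h', rfl⟩
  · rintro ⟨⟨a, b⟩, c, d⟩ h
    simp only [Finset.mem_sigma, Finset.HasAntidiagonal.mem_antidiagonal] at h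
    rw [mem_triples]
    dsimp only
    omega
  · rintro ⟨j, k, l⟩ h
    rfl
  · rintro ⟨⟨a, b⟩, c, d⟩ h
    simp only [Finset.mem_sigma, Finset.HasAntidiagonal.mem_antidiagonal] at h
    simp [h.2]
  · rintro ⟨j, k, l⟩ h
    rfl

namespace Lab

section

variable {C : Type u} [Category.{v} C] [Preadditive C] [HasFiniteBiproducts C]
  [MonoidalCategory C] [MonoidalPreadditive C] [HasColimits C]
  [∀ X : C, PreservesFilteredColimits (tensorLeft X)]
  [∀ X : C, PreservesFilteredColimits (tensorRight X)]
  {A B D : GradedObject ℤ C}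

open Abs

/-- The even family attached to graded morphisms. -/
noncomputable def hat (f : ∀ n : ℕ, GHom (pow A n) B (1 - n)) (n : ℕ) : Pow (sV A) n ⟶ sV B :=
  (e A n).hom ≫ evenL (X := sP A n) (f n)

theorem fam_hat (f : ∀ n : ℕ, GHom (pow A n) B (1 - n)) (n : ℕ) :
    fam (hat f) n = evenL (X := sP A n) (f n) := by
  rw [fam, hat, Iso.inv_hom_id_assoc]

theorem ev_fam_hat (f : ∀ n : ℕ, GHom (pow A n) B (1 - n)) (n : ℕ) : ev (fam (hat f) n) = f n := by
  rw [fam_hat]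
  rfl

theorem od_fam_hat (f : ∀ n : ℕ, GHom (pow A n) B (1 - n)) (n : ℕ) : od (fam (hat f) n) = 0 := by
  rw [fam_hat]
  rfl

theorem od_e_hom (A : GradedObject ℤ C) : ∀ n, od (e A n).hom = 0
  | 0 => rfl
  | n + 1 => by
    rw [e_succ_hom, ← MonoidalCategory.id_tensorHom]
    exact od_comp_zero _ _ (od_tens_zero _ _ rfl (od_e_hom A n)) rfl

theorem od_e_inv (A : GradedObject ℤ C) : ∀ n, od (e A n).inv = 0
  | 0 => rfl
  | n + 1 => by
    rw [e_succ_inv, ← MonoidalCategory.id_tensorHom]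
    exact od_comp_zero _ _ rfl (od_tens_zero _ _ rfl (od_e_inv A n))

theorem od_hat (f : ∀ n : ℕ, GHom (pow A n) B (1 - n)) (n : ℕ) : od (hat f n) = 0 :=
  od_comp_zero _ _ (od_e_hom A n) rfl

theorem hat_zero (f : ∀ n : ℕ, GHom (pow A n) B (1 - n)) (h : f 0 = 0) : hat f 0 = 0 := by
  rw [hat, h]
  exact comp_zero

theorem fam_ext {f g : ∀ n, Pow (sV A) n ⟶ sV B} (h : ∀ n, ev (fam f n) = ev (fam g n))
    (h' : ∀ n, od (fam f n) = od (fam g n)) : f = g := by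
  funext n
  exact (cancel_epi (e A n).inv).1 (hom_ext (h n) (h' n))

theorem hat_injective {f g : ∀ n : ℕ, GHom (pow A n) B (1 - n)} (h : hat f = hat g) : f = g := by
  funext n
  rw [← ev_fam_hat f, h, ev_fam_hat]

theorem fam_comp (f : ∀ n, Pow (sV A) n ⟶ sV B) (g : ∀ n, Pow (sV B) n ⟶ sV D) (n : ℕ) :
    fam (comp f g) n = ∑ r ∈ Finset.range (n + 1), mat f r n ≫ fam g r := by
  rw [fam, comp, Preadditive.comp_sum]
  refine Finset.sum_congr rfl fun r _ => ?_
  rw [mat, fam, Category.assoc, Category.assoc, Iso.hom_inv_id_assoc]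

theorem od_mat (f : ∀ n, Pow (sV A) n ⟶ sV B) (h : ∀ n, od (f n) = 0) (r n : ℕ) :
    od (mat f r n) = 0 :=
  od_comp_zero _ _ (od_e_inv A n) (od_comp_zero _ _ (od_F f h r n) (od_e_hom B r))

theorem compFun_eq (f : ∀ n : ℕ, GHom (pow A n) B (1 - n))
    (g : ∀ n : ℕ, GHom (pow B n) D (1 - n)) (n : ℕ) : compFun f g n =
    ∑ r ∈ Finset.range (n + 1), ∑ i ∈ Finset.Nat.antidiagonalTuple r n,
      (sgn i).negOnePow • GHom.comp (blkT f r i n) (g r) (by ring) := by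
  refine Finset.sum_congr rfl fun r _ => ?_
  rw [← Finset.sum_attach (Finset.Nat.antidiagonalTuple r n)]
  refine Finset.sum_congr rfl fun i _ => ?_
  rw [blkT, dif_pos]

theorem hat_compFun (f : ∀ n : ℕ, GHom (pow A n) B (1 - n))
    (g : ∀ n : ℕ, GHom (pow B n) D (1 - n)) : hat (compFun f g) = comp (hat f) (hat g) := by
  refine fam_ext (fun n => ?_) fun n => ?_
  · rw [ev_fam_hat, fam_comp, ev_sum, compFun_eq]
    refine Finset.sum_congr rfl fun r _ => ?_
    rw [ev_comp, ev_mat (hat f) f (ev_fam_hat f), ev_fam_hat, GHom.sum_comp]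
    refine Finset.sum_congr rfl fun i _ => ?_
    rw [GHom.smul_comp]
  · rw [od_fam_hat, fam_comp, od_sum]
    symm
    exact Finset.sum_eq_zero fun r _ =>
      od_comp_zero _ _ (od_mat _ (od_hat f) _ _) (od_fam_hat _ _)

theorem hat_idFun (A : GradedObject ℤ C) : hat (idFun A) = one (sV A) := by
  funext n
  match n with
  | 0 => exact comp_zero
  | 1 =>
    rw [one_one]
    have h1 : (e A 1).hom = ofH (X := sV A ⊗ 𝟙_ (Lab C)) (Y := sP A 1) (𝟙 (A ⊗ 𝟙_ _)) (by
        change ((1 : ℕ) : ℤ) - (1 + 0) = 0; norm_num) := by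
      change sV A ◁ 𝟙 _ ≫ _ = _
      rw [MonoidalCategory.whiskerLeft_id]
      exact Category.id_comp _
    rw [hat, h1]
    refine (ofH_comp (X := sV A ⊗ 𝟙_ (Lab C)) (Y := sP A 1) (Z := sV A) _ _ (ρ_ A).hom
      (by change (1 : ℤ) - ((1 : ℕ) : ℤ) = 0; norm_num)).trans ?_
    rw [right_ofH]
    exact congrArg (fun x => ofH (X := sV A ⊗ 𝟙_ (Lab C)) (Y := sV A) x _) (Category.id_comp _)
  | n + 2 => exact comp_zero

theorem od_one (V : Lab C) (n : ℕ) : od (one V n) = 0 := by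
  match n with
  | 0 => rfl
  | 1 => rfl
  | n + 2 => rfl

theorem od_fam_phi (m : ∀ n : ℕ, GHom (pow A n) A (2 - n)) (n : ℕ) :
    od (fam (phi m) n) = GHom.recast (by dsimp; ring) (m n) := by
  have h : fam (phi m) n = (e A n).inv ≫ one (sV A) n + fam (psi m) n := Preadditive.comp_add _ _ _ _ _ _
  have h' : od ((e A n).inv ≫ one (sV A) n) = 0 := od_comp_zero _ _ (od_e_inv A n) (od_one _ n)
  rw [h, od_add, h', fam_psi]
  exact zero_add _

theorem ev_comp_congr {f f' : ∀ n, Pow (sV A) n ⟶ sV B} {g g' : ∀ n, Pow (sV B) n ⟶ sV D}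
    (h : ∀ n, ev (f n) = ev (f' n)) (h' : ∀ n, ev (g n) = ev (g' n)) (n : ℕ) :
    ev (comp f g n) = ev (comp f' g' n) := by
  rw [comp, comp, ev_sum, ev_sum]
  refine Finset.sum_congr rfl fun r _ => ?_
  rw [ev_comp, ev_comp, ev_F_congr f f' h, h']

/-- The left hand side of the relations for morphisms. -/
noncomputable def lhs (m : ∀ n : ℕ, GHom (pow A n) A (2 - n))
    (f : ∀ n : ℕ, GHom (pow A n) B (1 - n)) (n : ℕ) : GHom (pow A n) B (2 - n) :=
  ∑ x ∈ (triples n).attach,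
      ((x.1.1 : ℤ) * x.1.2.1 + x.1.2.2).negOnePow •
        GHom.comp
          (ins m x.1.1 x.1.2.1 x.1.2.2 n (x.1.1 + 1 + x.1.2.2) (mem_triples.1 x.2) rfl)
          (f (x.1.1 + 1 + x.1.2.2)) (t := 2 - n)
          (by have h := mem_triples.1 x.2; push_cast; omega)

/-- The right hand side of the relations for morphisms. -/
noncomputable def rhs (m : ∀ n : ℕ, GHom (pow B n) B (2 - n))
    (f : ∀ n : ℕ, GHom (pow A n) B (1 - n)) (n : ℕ) : GHom (pow A n) B (2 - n) :=
  ∑ r ∈ Finset.range (n + 1), ∑ i ∈ (Finset.Nat.antidiagonalTuple r n).attach,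
      (sgn i.1).negOnePow •
        GHom.comp (blk f r i.1 n (Finset.Nat.mem_antidiagonalTuple.1 i.2)) (m r) (t := 2 - n)
          (by ring)

theorem lhs_eq (m : ∀ n : ℕ, GHom (pow A n) A (2 - n))
    (f : ∀ n : ℕ, GHom (pow A n) B (1 - n)) (n : ℕ) : lhs m f n =
    ∑ x ∈ Finset.HasAntidiagonal.antidiagonal n, ∑ y ∈ Finset.HasAntidiagonal.antidiagonal x.2,
      ((x.1 : ℤ) * y.1 + y.2).negOnePow • GHom.comp (insT m x.1 y.1 y.2 (x.1 + 1 + y.2) n)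
        (f (x.1 + 1 + y.2)) (t := 2 - n) (by push_cast; ring) := by
  rw [← sum_triples n fun j k l => ((j : ℤ) * k + l).negOnePow •
    GHom.comp (insT m j k l (j + 1 + l) n) (f (j + 1 + l)) (t := 2 - n) (by push_cast; ring),
    ← Finset.sum_attach (triples n), lhs]
  refine Finset.sum_congr rfl fun x _ => ?_
  rw [insT, dif_pos ⟨mem_triples.1 x.2, rfl⟩, GHom.recast_comp']

theorem rhs_eq (m : ∀ n : ℕ, GHom (pow B n) B (2 - n))
    (f : ∀ n : ℕ, GHom (pow A n) B (1 - n)) (n : ℕ) : rhs m f n =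
    ∑ r ∈ Finset.range (n + 1), ∑ i ∈ Finset.Nat.antidiagonalTuple r n,
      (sgn i).negOnePow • GHom.comp (blkT f r i n) (m r) (by ring) := by
  refine Finset.sum_congr rfl fun r _ => ?_
  rw [← Finset.sum_attach (Finset.Nat.antidiagonalTuple r n)]
  refine Finset.sum_congr rfl fun i _ => ?_
  rw [blkT, dif_pos]

theorem od_rhs (m : ∀ n : ℕ, GHom (pow B n) B (2 - n))
    (f : ∀ n : ℕ, GHom (pow A n) B (1 - n)) (n : ℕ) :
    od (fam (comp (hat f) (phi m)) n) = GHom.recast (by dsimp; ring) (rhs m f n) := by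
  rw [fam_comp, od_sum, rhs_eq, GHom.recast_sum]
  refine Finset.sum_congr rfl fun r _ => ?_
  rw [od_comp, od_mat _ (od_hat f), GHom.zero_comp, ev_mat (hat f) f (ev_fam_hat f), od_fam_phi,
    GHom.recast_sum]
  refine (add_zero _).trans ?_
  refine (GHom.sum_comp _ _ _ _).trans ?_
  refine Finset.sum_congr rfl fun i _ => ?_
  rw [GHom.smul_comp, GHom.recast_smul, GHom.recast_comp, GHom.comp_recast]

theorem od_lhs (m : ∀ n : ℕ, GHom (pow A n) A (2 - n)) (hm : m 0 = 0)
    (f : ∀ n : ℕ, GHom (pow A n) B (1 - n)) (n : ℕ) :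
    od (fam (comp (phi m) (hat f)) n) = GHom.recast (by dsimp; ring) (lhs m f n) := by
  rw [fam_comp, od_sum, lhs_eq, GHom.recast_sum]
  have h1 : ∀ r, od (mat (phi m) r n ≫ fam (hat f) r) =
      ∑ x ∈ Finset.HasAntidiagonal.antidiagonal n,
        ∑ y ∈ Finset.HasAntidiagonal.antidiagonal x.2, ((x.1 : ℤ) * y.1 + y.2).negOnePow •
          GHom.comp (insT m x.1 y.1 y.2 r n) (f r) (t := 1 - n + 1) (by ring) := by
    intro r
    rw [od_comp, od_fam_hat, GHom.comp_zero, ev_fam_hat, od_mat_phi m hm]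
    refine (zero_add _).trans ?_
    refine (GHom.sum_comp _ _ _ _).trans ?_
    refine Finset.sum_congr rfl fun x _ => ?_
    refine (GHom.sum_comp _ _ _ _).trans ?_
    refine Finset.sum_congr rfl fun y _ => ?_
    exact GHom.smul_comp _ _ _ _
  rw [Finset.sum_congr rfl fun r _ => h1 r, Finset.sum_comm]
  refine Finset.sum_congr rfl fun x hx => ?_
  rw [Finset.sum_comm, GHom.recast_sum]
  refine Finset.sum_congr rfl fun y hy => ?_
  rw [GHom.recast_smul, GHom.recast_comp]
  rw [Finset.sum_eq_single (x.1 + 1 + y.2)]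
  · intro r _ hr
    rw [insT, dif_neg (by omega), GHom.zero_comp, smul_zero]
  · intro h
    have hx' := Finset.HasAntidiagonal.mem_antidiagonal.1 hx
    have hy' := Finset.HasAntidiagonal.mem_antidiagonal.1 hy
    rw [Finset.mem_range] at h
    have h0 : y.1 = 0 := by omega
    rw [h0, insT_zero m hm, GHom.zero_comp, smul_zero]

theorem rel_iff (m : ∀ n : ℕ, GHom (pow A n) A (2 - n)) (hm : m 0 = 0)
    (m' : ∀ n : ℕ, GHom (pow B n) B (2 - n)) (f : ∀ n : ℕ, GHom (pow A n) B (1 - n))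
    (hf : f 0 = 0) :
    (∀ n, lhs m f n = rhs m' f n) ↔ comp (phi m) (hat f) = comp (hat f) (phi m') := by
  constructor
  · intro h
    refine fam_ext (fun n => ?_) fun n => ?_
    · rw [fam, fam, Lab.ev_comp, Lab.ev_comp, ev_comp_congr (ev_phi m) (fun _ => rfl),
        ev_comp_congr (fun _ => rfl) (ev_phi m'), one_comp, comp_one _ (hat_zero f hf)]
    · rw [od_lhs m hm, od_rhs, h]
  · intro h n
    have h1 := od_lhs m hm f n
    rw [h, od_rhs] at h1
    have h2 := congrArg (GHom.recast (M := pow A n) (L := B) (r := 1 - n + 1) (s := 2 - n)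
      (by ring)) h1
    erw [GHom.recast_cancel, GHom.recast_cancel] at h2
    exact h2.symm

end

end Lab

section

variable {C : Type u} [Category.{v} C] [Preadditive C] [HasFiniteBiproducts C]
  [MonoidalCategory C] [MonoidalPreadditive C] [HasColimits C]
  [∀ X : C, PreservesFilteredColimits (tensorLeft X)]
  [∀ X : C, PreservesFilteredColimits (tensorRight X)]

theorem AInfHom.comm {A B : AInfAlg C} (f : AInfHom A B) :
    Abs.comp (Lab.phi A.m) (Lab.hat f.f) = Abs.comp (Lab.hat f.f) (Lab.phi B.m) :=
  (Lab.rel_iff A.m A.m_zero B.m f.f f.f_zero).1 f.rel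

theorem AInfHom.ext' {A B : AInfAlg C} {f g : AInfHom A B} (h : Lab.hat f.f = Lab.hat g.f) :
    f = g := by
  have h' := Lab.hat_injective h
  cases f
  cases g
  cases h'
  rfl

theorem phi_zero (A : AInfAlg C) : Lab.phi A.m 0 = 0 := by
  rw [Lab.phi, Abs.one_ne _ (by omega), Lab.psi, A.m_zero, GHom.recast_zero]
  exact (zero_add _).trans comp_zero

/-- The composition of morphisms of `A_∞`-algebras. -/
noncomputable def AInfHom.comp {A B D : AInfAlg C} (f : AInfHom A B) (g : AInfHom B D) :
    AInfHom A D where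
  f := compFun f.f g.f
  f_zero := by
    rw [compFun]
    simp [g.f_zero, GHom.comp_zero]
  rel := (Lab.rel_iff A.m A.m_zero D.m _ (by
      rw [compFun]
      simp [g.f_zero, GHom.comp_zero])).2 (by
    have hf := Lab.hat_zero f.f f.f_zero
    have hg := Lab.hat_zero g.f g.f_zero
    rw [Lab.hat_compFun, ← Abs.comp_assoc _ _ _ (phi_zero A) hf, f.comm,
      Abs.comp_assoc _ _ _ hf (phi_zero B), g.comm, Abs.comp_assoc _ _ _ hf hg])

/-- The identity of an `A_∞`-algebra. -/
noncomputable def AInfHom.id (A : AInfAlg C) : AInfHom A A where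
  f := idFun A.obj
  f_zero := rfl
  rel := (Lab.rel_iff A.m A.m_zero A.m _ rfl).2 (by
    rw [Lab.hat_idFun, Abs.one_comp, Abs.comp_one _ (phi_zero A)])

/-- The category of `A_∞`-algebras. -/
noncomputable instance : Category (AInfAlg C) where
  Hom A B := AInfHom A B
  id A := AInfHom.id A
  comp f g := AInfHom.comp f g
  id_comp f := AInfHom.ext' (by
    change Lab.hat (compFun _ _) = _
    rw [Lab.hat_compFun]
    change Abs.comp (Lab.hat (idFun _)) _ = _
    rw [Lab.hat_idFun, Abs.one_comp])
  comp_id f := AInfHom.ext' (by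
    change Lab.hat (compFun _ _) = _
    rw [Lab.hat_compFun]
    change Abs.comp _ (Lab.hat (idFun _)) = _
    rw [Lab.hat_idFun, Abs.comp_one _ (Lab.hat_zero _ f.f_zero)])
  assoc f g h := AInfHom.ext' (by
    change Lab.hat (compFun (compFun _ _) _) = Lab.hat (compFun _ (compFun _ _))
    rw [Lab.hat_compFun, Lab.hat_compFun, Lab.hat_compFun, Lab.hat_compFun,
      Abs.comp_assoc _ _ _ (Lab.hat_zero _ f.f_zero) (Lab.hat_zero _ g.f_zero)])

end

end AInf

namespace AInf

section

variable {C : Type u} [Category.{v} C] [Preadditive C] [HasFiniteBiproducts C]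
  [MonoidalCategory C] [MonoidalPreadditive C] [HasColimits C]
  [∀ X : C, PreservesFilteredColimits (tensorLeft X)]
  [∀ X : C, PreservesFilteredColimits (tensorRight X)]

theorem split_one (A : GradedObject ℤ C) :
    (split A 1 0 1 rfl).hom = (ρ_ (pow A 1)).inv := by
  have h : (split A 1 0 1 rfl).hom =
      A ◁ (𝟙 _ ≫ (λ_ (𝟙_ (GradedObject ℤ C))).inv) ≫ (α_ A (𝟙_ _) (𝟙_ _)).inv := rfl
  rw [h, Category.id_comp, unitors_inv_equal]
  exact (rightUnitor_tensor_inv _ _).symm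

/-- A graded morphism `A^{⊗1} ⟶ B` as a graded morphism `A ⟶ B`, through `A ≅ A^{⊗1}`. -/
noncomputable def linear {A B : GradedObject ℤ C} {r : ℤ} (f : GHom (pow A 1) B r) : GHom A B r :=
  GHom.comp (GHom.ofHom (L := pow A 1) (ρ_ A).inv rfl) f (zero_add r)

theorem split_one_tensor {A B : GradedObject ℤ C} {r : ℤ} (f : GHom (pow A 1) B r) :
    GHom.comp (GHom.ofHom (split A 1 0 1 rfl).hom rfl)
      (GHom.tensor f (GHom.ofHom (𝟙 (pow A 0)) rfl) (add_zero r)) (zero_add r) =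
    GHom.comp f (GHom.ofHom (L := pow B 1) (ρ_ B).inv rfl) (add_zero r) := by
  rw [split_one]
  exact (GHom.rightUnitor_inv_nat f rfl).symm

theorem lhs_one {A B : GradedObject ℤ C} (m : ∀ n : ℕ, GHom (pow A n) A (2 - n)) (hm : m 0 = 0)
    (f : ∀ n : ℕ, GHom (pow A n) B (1 - n)) : Lab.lhs m f 1 =
    GHom.comp (m 1) (linear (f 1)) (by norm_num) := by
  have h : ∀ x ∈ (triples 1).attach, x ≠ ⟨(0, 1, 0), mem_triples.2 rfl⟩ →
      ((x.1.1 : ℤ) * x.1.2.1 + x.1.2.2).negOnePow •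
        GHom.comp
          (ins m x.1.1 x.1.2.1 x.1.2.2 1 (x.1.1 + 1 + x.1.2.2) (mem_triples.1 x.2) rfl)
          (f (x.1.1 + 1 + x.1.2.2)) (t := 2 - (1 : ℕ))
          (by have h := mem_triples.1 x.2; push_cast; omega) = 0 := by
    rintro ⟨⟨j, k, l⟩, h⟩ _ hne
    have h' := mem_triples.1 h
    have hk : k = 0 := by
      by_contra hk
      apply hne
      dsimp only at h'
      obtain ⟨rfl, rfl, rfl⟩ : j = 0 ∧ k = 1 ∧ l = 0 := by omega
      rfl
    subst hk
    dsimp only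
    rw [Lab.ins_zero m hm, GHom.zero_comp, smul_zero]
  rw [Lab.lhs, Finset.sum_eq_single _ h (fun h' => absurd (Finset.mem_attach _ _) h')]
  dsimp only
  rw [show (((0 : ℕ) : ℤ) * (1 : ℕ) + (0 : ℕ)).negOnePow = 1 by simp, one_smul]
  have h2 : ins m 0 1 0 1 1 rfl rfl = _ := split_one_tensor (m 1)
  change GHom.comp (ins m 0 1 0 1 1 rfl rfl) (f 1) _ = _
  rw [h2]
  exact GHom.comp_assoc _ _ _ _ _ _

theorem rhs_one {A B : GradedObject ℤ C} (m : ∀ n : ℕ, GHom (pow B n) B (2 - n))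
    (f : ∀ n : ℕ, GHom (pow A n) B (1 - n)) : Lab.rhs m f 1 =
    GHom.comp (f 1) (linear (m 1)) (by norm_num) := by
  rw [Lab.rhs_eq, Finset.sum_range_succ, Finset.sum_range_succ, Finset.sum_range_zero,
    Finset.Nat.antidiagonalTuple_zero_succ, Finset.sum_empty, add_zero, zero_add,
    Finset.Nat.antidiagonalTuple_one, Finset.sum_singleton, Lab.blkT, dif_pos (by simp)]
  have h1 : sgn ![1] = 0 := by simp [sgn]
  rw [h1, Int.negOnePow_zero, one_smul]
  have h2 : blk f 1 ![1] 1 (by simp) = GHom.comp (f 1)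
    (GHom.ofHom (L := pow B 1) (ρ_ B).inv rfl) (add_zero _) := split_one_tensor (f 1)
  rw [h2]
  exact GHom.comp_assoc _ _ _ _ _ _

theorem AInfAlg.comp_m_one (A : AInfAlg C) :
    GHom.comp (A.m 1) (linear (A.m 1)) (t := 2) (by norm_num) = 0 := by
  have h : ∀ x ∈ (triples 1).attach, x ≠ ⟨(0, 1, 0), mem_triples.2 rfl⟩ →
      ((x.1.1 : ℤ) * x.1.2.1 + x.1.2.2).negOnePow •
        GHom.comp
          (ins A.m x.1.1 x.1.2.1 x.1.2.2 1 (x.1.1 + 1 + x.1.2.2) (mem_triples.1 x.2) rfl)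
          (A.m (x.1.1 + 1 + x.1.2.2)) (t := 3 - (1 : ℕ))
          (by have h := mem_triples.1 x.2; push_cast; omega) = 0 := by
    rintro ⟨⟨j, k, l⟩, h⟩ _ hne
    have h' := mem_triples.1 h
    have hk : k = 0 := by
      by_contra hk
      apply hne
      dsimp only at h'
      obtain ⟨rfl, rfl, rfl⟩ : j = 0 ∧ k = 1 ∧ l = 0 := by omega
      rfl
    subst hk
    dsimp only
    rw [Lab.ins_zero A.m A.m_zero, GHom.zero_comp, smul_zero]
  have h1 := A.rel 1
  rw [Finset.sum_eq_single _ h (fun h' => absurd (Finset.mem_attach _ _) h')] at h1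
  dsimp only at h1
  rw [show (((0 : ℕ) : ℤ) * (1 : ℕ) + (0 : ℕ)).negOnePow = 1 by simp, one_smul] at h1
  have h2 : ins A.m 0 1 0 1 1 rfl rfl = _ := split_one_tensor (A.m 1)
  change GHom.comp (ins A.m 0 1 0 1 1 rfl rfl) (A.m 1) _ = 0 at h1
  rw [h2] at h1
  exact (GHom.comp_assoc _ _ _ _ _ _).symm.trans h1

/-- The complex `(A, m_1)` underlying an `A_∞`-algebra. -/
noncomputable def toComplex (A : AInfAlg C) : CochainComplex C ℤ where
  X p := A.obj p
  d p q := if h : p + 1 = q then (linear (A.m 1)).v p q (by push_cast; omega) else 0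
  shape p q h := dif_neg h
  d_comp_d' p q r hpq hqr := by
    have hpq' : p + 1 = q := hpq
    have hqr' : q + 1 = r := hqr
    rw [dif_pos hpq', dif_pos hqr', ← GHom.comp_v (linear (A.m 1)) (linear (A.m 1)) (t := 2)
      (by norm_num) p q r]
    have h : GHom.comp (linear (A.m 1)) (linear (A.m 1)) (t := 2) (by norm_num) = 0 := by
      conv_lhs => arg 1; rw [linear]
      rw [GHom.comp_assoc _ _ _ _ (by norm_num : (2 - ((1 : ℕ) : ℤ)) + (2 - ((1 : ℕ) : ℤ)) = 2),
        A.comp_m_one, GHom.comp_zero]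
    rw [h, GHom.zero_v]

theorem AInfHom.linear_comm {A B : AInfAlg C} (f : AInfHom A B) :
    GHom.comp (linear (f.f 1)) (linear (B.m 1)) (t := 1) (by norm_num) =
      GHom.comp (linear (A.m 1)) (linear (f.f 1)) (by norm_num) := by
  have h : GHom.comp (A.m 1) (linear (f.f 1)) (t := 2 - (1 : ℕ)) (by norm_num) =
      GHom.comp (f.f 1) (linear (B.m 1)) (by norm_num) := by
    rw [← lhs_one A.m A.m_zero f.f, ← rhs_one B.m f.f]
    exact f.rel 1
  conv_lhs => arg 1; rw [linear]
  conv_rhs => arg 1; rw [linear]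
  rw [GHom.comp_assoc _ _ _ _ (by norm_num : (1 - ((1 : ℕ) : ℤ)) + (2 - ((1 : ℕ) : ℤ)) =
      2 - ((1 : ℕ) : ℤ)), GHom.comp_assoc _ _ _ _
      (by norm_num : (2 - ((1 : ℕ) : ℤ)) + (1 - ((1 : ℕ) : ℤ)) = 2 - ((1 : ℕ) : ℤ)), h]

/-- The component `f_1`, as a morphism of complexes. -/
noncomputable def linMap {A B : AInfAlg C} (f : A ⟶ B) : toComplex A ⟶ toComplex B where
  f p := (linear (AInfHom.f f 1)).v p p (by norm_num)
  comm' p q hpq := by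
    have hpq' : p + 1 = q := hpq
    have h := congrArg (fun x => GHom.v x p q hpq') (AInfHom.linear_comm f)
    change GHom.v (GHom.comp _ _ _) p q hpq' = GHom.v (GHom.comp _ _ _) p q hpq' at h
    rw [GHom.comp_v _ _ _ p p q (by norm_num) (by push_cast; omega),
      GHom.comp_v _ _ _ p q q (by push_cast; omega) (by norm_num)] at h
    refine (congrArg _ (dif_pos hpq')).trans (h.trans (congrArg (fun x => x ≫ _) ?_))
    exact (dif_pos hpq').symm

end

instance hasFiniteBiproducts_of_abelian (C : Type u) [Category.{v} C] [Abelian C] :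
    HasFiniteBiproducts C := Abelian.hasFiniteBiproducts

section

variable (C : Type u) [Category.{v} C] [Abelian C] [MonoidalCategory C] [MonoidalPreadditive C]
  [HasColimits C] [∀ X : C, PreservesFilteredColimits (tensorLeft X)]
  [∀ X : C, PreservesFilteredColimits (tensorRight X)]

/-- The `A_∞`-quasi-isomorphisms: the morphisms such that `f_1` is a quasi-isomorphism. -/
def weq : MorphismProperty (AInfAlg C) := fun _ _ f => QuasiIso (linMap f)

/-- The morphisms such that `f_1` is a monomorphism. -/
def cof : MorphismProperty (AInfAlg C) := fun _ _ f => ∀ p, Mono ((linMap f).f p)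

/-- The morphisms such that `f_1` is an epimorphism. -/
def fib : MorphismProperty (AInfAlg C) := fun _ _ f => ∀ p, Epi ((linMap f).f p)

end

end AInf

/-! An A∞-structure on A is a square-zero coderivation of the tensor coalgebra on the shift of A,
and a morphism is a map of such coalgebras. Both are determined by families of components `Pow V n ⟶
W` vanishing in arity zero, which compose like noncommutative power series under `Abs.comp`. In `Lab
C`, where a morphism is f + εd with ε odd and ε² = 0, an algebra becomes the family `A.str` = 1 +
εm, and a morphism becomes an even family commuting with these (`fm_comm`). Since ε² = 0 forgets
squares, the relations of an algebra are recorded separately, as the vanishing of `sqc`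
(`relSum_iff`). The square of an odd coderivation is again a coderivation (`sq_succ`), so it
vanishes once it is intertwined with zero by even families whose linear parts are jointly monic
(`sqc_eq_zero_of_mono`). This proves the relations for transported structures and for fibre
products.

A family whose linear part is the identity is invertible (`comp_rinv`, `rinv_comp`). Semisimplicity
splits f_1 as a graded map when it is mono or epi, and then an isomorphism on one side makes f
strict, that is, f_n = 0 for n ≥ 2 (`exists_iso_strict_right`, `exists_iso_strict_left`). For a
strict fibration onto B and a morphism X → B, the fibre product lives on X ⊕ K, with K the kernel of
the fibration, and its structure is forced by the two projections.

Lifting is obstruction theory. In a square with strict sides a lift by a family always exists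
(`startFam_partialLift`). Its failure to be a morphism in the lowest arity n is a cocycle among the
maps B^{⊗n} → E that vanish on A^{⊗n} and over F (`defect_cocycle`), and changing the component of
arity n by c changes the failure by the boundary of c (`defect_update`). If i or p is a weak
equivalence, these cocycles are boundaries: the cokernel of i_1 or the kernel of p_1 is an acyclic
complex, contractible by semisimplicity, and the contraction induces a homotopy on B or on E; the
one on B is extended to tensor powers (`Htpy.pow`).

Two out of three and stability under retracts are pulled back along the functor to complexes. The
factorizations use disks, the contractible complexes on M ⊕ M[1] with zero products. Every A maps to
the disk on A by a morphism with split monic linear part (`toDisk`), so f factors through the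
product of B with that disk. In the other direction the complex B is a quotient of a disk D; the
family on A × D given by f and this cover is a morphism up to arity one, and it is corrected in
arities at least two, because A → A × D is an acyclic cofibration (`exists_lift`). -/

namespace AInf

/-! ### Calculus of families: strict families, linear parts, inversion. -/

namespace Abs

variable {G : Type u} [Category.{v} G] [Preadditive G] [MonoidalCategory G] [MonoidalPreadditive G]
  {V W U T : G}

/-- In a summand that is not zero the r block lengths are positive with sum n, so no block is longer
than n - r + 1. The bound is written as `k + r ≤ n + 1` to avoid truncated subtraction. For r ≥ 2
only arities below n matter, which is what the obstruction theory uses. -/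
theorem F_congr (f g : ∀ n, Pow V n ⟶ W) (hf : f 0 = 0) (hg : g 0 = 0) :
    ∀ r n : ℕ, (∀ k, k + r ≤ n + 1 → f k = g k) → F f r n = F g r n := by
  intro r
  induction r with
  | zero => intro n _; cases n <;> rfl
  | succ r ih =>
    intro n h
    rw [F_succ, F_succ]
    refine Finset.sum_congr rfl ?_
    rintro ⟨a, b⟩ hab
    have hab' := Finset.HasAntidiagonal.mem_antidiagonal.1 hab
    dsimp only at hab' ⊢
    rcases Nat.eq_zero_or_pos a with rfl | ha
    · rw [hf, hg, zero_tensor', zero_tensor']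
    rcases Nat.lt_or_ge b r with hb | hb
    · rw [F_lt f hf r b hb, F_lt g hg r b hb, tensor_zero', tensor_zero']
    · rw [h a (by omega), ih b fun k hk => h k (by omega)]

theorem comp_congr {f f' : ∀ n, Pow V n ⟶ W} {g g' : ∀ n, Pow W n ⟶ U} (n : ℕ)
    (hf : f 0 = 0) (hf' : f' 0 = 0)
    (h : ∀ k ≤ n, f k = f' k) (h' : ∀ k ≤ n, g k = g' k) : comp f g n = comp f' g' n := by
  refine Finset.sum_congr rfl fun r hr => ?_
  have hr' := Finset.mem_range.1 hr
  rw [h' r (by omega)]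
  rcases Nat.eq_zero_or_pos r with rfl | hr0
  · cases n <;> rfl
  · rw [F_congr f f' hf hf' r n fun k hk => h k (by omega)]

theorem comp_add (f : ∀ n, Pow V n ⟶ W) (g g' : ∀ n, Pow W n ⟶ U) :
    comp f (g + g') = comp f g + comp f g' := by
  funext n
  simp only [comp, Pi.add_apply, Preadditive.comp_add, Finset.sum_add_distrib]

/-- The family with values composed with a morphism. -/
def post (f : ∀ n, Pow V n ⟶ W) (l : W ⟶ U) (n : ℕ) : Pow V n ⟶ U := f n ≫ l

theorem comp_post (f : ∀ n, Pow V n ⟶ W) (g : ∀ n, Pow W n ⟶ U) (l : U ⟶ T) :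
    comp f (post g l) = post (comp f g) l := by
  funext n
  simp only [comp, post, Preadditive.sum_comp, Category.assoc]

/-- The strict family attached to a morphism. -/
def st (l : V ⟶ W) : ∀ n, Pow V n ⟶ W := post (one V) l

theorem st_zero (l : V ⟶ W) : st l 0 = 0 := zero_comp

theorem st_one (l : V ⟶ W) : st l 1 = (ρ_ V).hom ≫ l := rfl

theorem st_ne (l : V ⟶ W) {n : ℕ} (h : n ≠ 1) : st l n = 0 := by
  rw [st, post, one_ne V h, zero_comp]

theorem st_id : st (𝟙 V) = one V := funext fun _ => Category.comp_id _

theorem post_st (l : V ⟶ W) (l' : W ⟶ U) : post (st l) l' = st (l ≫ l') :=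
  funext fun _ => Category.assoc _ _ _

theorem comp_st (f : ∀ n, Pow V n ⟶ W) (hf : f 0 = 0) (l : W ⟶ U) : comp f (st l) = post f l := by
  rw [st, comp_post, comp_one f hf]

/-- Tensor powers of a morphism. -/
def tpow (l : V ⟶ W) : ∀ n, Pow V n ⟶ Pow W n
  | 0 => 𝟙 _
  | n + 1 => l ⊗ₘ tpow l n

theorem tpow_succ (l : V ⟶ W) (n : ℕ) : tpow l (n + 1) = l ⊗ₘ tpow l n := rfl

theorem tpow_id : ∀ n, tpow (𝟙 V) n = 𝟙 _
  | 0 => rfl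
  | n + 1 => by rw [tpow, tpow_id n]; exact id_tensorHom_id _ _

theorem tpow_comp (l : V ⟶ W) (l' : W ⟶ U) : ∀ n, tpow l n ≫ tpow l' n = tpow (l ≫ l') n
  | 0 => Category.comp_id _
  | n + 1 => by
    rw [tpow_succ, tpow_succ, tpow_succ, ← tpow_comp l l' n]
    exact MonoidalCategory.tensorHom_comp_tensorHom _ _ _ _

/-- The linear part of a family. -/
def lin (f : ∀ n, Pow V n ⟶ W) : V ⟶ W := (ρ_ V).inv ≫ f 1

theorem lin_st (l : V ⟶ W) : lin (st l) = l := by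
  rw [lin, st_one]
  exact Iso.inv_hom_id_assoc _ _

theorem lin_one : lin (one V) = 𝟙 V := by rw [← st_id, lin_st]

theorem eq_lin (f : ∀ n, Pow V n ⟶ W) : f 1 = (ρ_ V).hom ≫ lin f :=
  (Iso.hom_inv_id_assoc _ _).symm

/-- If n positive block lengths add up to n, they are all equal to one, so only tensor powers of the
linear part survive on the diagonal. -/
theorem F_diag (f : ∀ n, Pow V n ⟶ W) (hf : f 0 = 0) : ∀ n, F f n n = tpow (lin f) n
  | 0 => rfl
  | n + 1 => by
    rw [F_succ, Finset.sum_eq_single (1, n)]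
    · dsimp only
      rw [show sp V 1 n (n + 1) = _ from sp_succ V 0 n n, sp_zero, F_diag f hf n, tpow_succ, eq_lin f]
      change (V ◁ _ ≫ (α_ V (𝟙_ G) _).inv) ≫ ((ρ_ V).hom ≫ lin f ⊗ₘ _) = _
      rw [← Category.id_comp (tpow (lin f) n), ← MonoidalCategory.tensorHom_comp_tensorHom]
      simp
    · rintro ⟨a, b⟩ h1 h2
      have := Finset.HasAntidiagonal.mem_antidiagonal.1 h1
      dsimp only at this ⊢
      rcases Nat.eq_zero_or_pos a with rfl | ha
      · rw [hf, zero_tensor', comp_zero]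
      · have ha1 : a ≠ 1 := by
          rintro rfl
          exact h2 (by simp only [Prod.mk.injEq, true_and]; omega)
        rw [F_lt f hf n b (by omega), tensor_zero', comp_zero]
    · intro h
      exact absurd (Finset.HasAntidiagonal.mem_antidiagonal.2 (by dsimp; omega)) h

theorem F_st_ne (l : V ⟶ W) : ∀ r n : ℕ, n ≠ r → F (st l) r n = 0 := by
  intro r
  induction r with
  | zero => intro n h; exact F_zero_ne _ h
  | succ r ih =>
    intro n h
    rw [F_succ]
    refine Finset.sum_eq_zero ?_
    rintro ⟨a, b⟩ hab
    have := Finset.HasAntidiagonal.mem_antidiagonal.1 hab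
    dsimp only at this ⊢
    by_cases ha : a = 1
    · rw [ih b (by omega), tensor_zero', comp_zero]
    · rw [st_ne l ha, zero_tensor', comp_zero]

theorem st_comp (l : V ⟶ W) (g : ∀ n, Pow W n ⟶ U) (n : ℕ) :
    comp (st l) g n = tpow l n ≫ g n := by
  rw [comp, Finset.sum_eq_single n]
  · rw [F_diag _ (st_zero l), lin_st]
  · intro r _ hr
    rw [F_st_ne l r n hr.symm, zero_comp]
  · intro h
    exact absurd (Finset.mem_range.2 (by omega)) h

theorem st_comp_st (l : V ⟶ W) (l' : W ⟶ U) : comp (st l) (st l') = st (l ≫ l') := by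
  rw [comp_st _ (st_zero l), post_st]

theorem lin_comp (f : ∀ n, Pow V n ⟶ W) (g : ∀ n, Pow W n ⟶ U) :
    lin (comp f g) = lin f ≫ lin g := by
  rw [lin, comp, Finset.sum_range_succ, Finset.sum_range_succ, Finset.sum_range_zero,
    F_zero_ne _ one_ne_zero, F_one, zero_comp, add_zero, zero_add, lin, lin]
  exact (congrArg _ (Category.assoc _ _ _)).trans (Category.assoc _ _ _).symm

/-- The right inverse of a unipotent family. -/
noncomputable def rinv (f : ∀ n, Pow V n ⟶ V) (n : ℕ) : Pow V n ⟶ V :=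
  one V n - ∑ r : Fin n, F f r n ≫ rinv f r

theorem rinv_zero (f : ∀ n, Pow V n ⟶ V) : rinv f 0 = 0 := by
  rw [rinv]
  simp [one_ne]

theorem rinv_one (f : ∀ n, Pow V n ⟶ V) : rinv f 1 = one V 1 := by
  rw [rinv]
  simp [rinv_zero]

/-- The definition of `rinv` solves this very equation arity by arity: the component `rinv f n`
occurs only through the diagonal entry `F f n n`, which is the identity because the linear part is.
-/
theorem comp_rinv (f : ∀ n, Pow V n ⟶ V) (h0 : f 0 = 0) (h1 : lin f = 𝟙 V) :
    comp f (rinv f) = one V := by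
  funext n
  rw [comp, Finset.sum_range_succ, F_diag f h0, h1, tpow_id, Category.id_comp, Finset.sum_range]
  conv_lhs => rw [rinv]
  rw [add_sub_cancel]

/-- In a monoid where every element has a right inverse, right inverses are two-sided: f is the
right inverse of its own right inverse. -/
theorem rinv_comp (f : ∀ n, Pow V n ⟶ V) (h0 : f 0 = 0) (h1 : lin f = 𝟙 V) :
    comp (rinv f) f = one V := by
  have h2 : lin (rinv f) = 𝟙 V := by rw [lin, rinv_one]; exact lin_one
  have h3 := comp_rinv (rinv f) (rinv_zero f) h2
  have h4 : f = rinv (rinv f) := by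
    rw [← one_comp (rinv (rinv f)), ← comp_rinv f h0 h1,
      comp_assoc _ _ _ h0 (rinv_zero _), h3, comp_one f h0]
  rw [← h4] at h3
  exact h3

theorem lin_rinv (f : ∀ n, Pow V n ⟶ V) : lin (rinv f) = 𝟙 V := by
  rw [lin, rinv_one]; exact lin_one

theorem lin_post (f : ∀ n, Pow V n ⟶ W) (l : W ⟶ U) : lin (post f l) = lin f ≫ l :=
  (Category.assoc _ _ _).symm

theorem lin_add (f g : ∀ n, Pow V n ⟶ W) : lin (f + g) = lin f + lin g :=
  Preadditive.comp_add _ _ _ _ _ _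

theorem comp_apply_zero (f : ∀ n, Pow V n ⟶ W) (g : ∀ n, Pow W n ⟶ U) (hg : g 0 = 0) :
    comp f g 0 = 0 := comp_zero' f g hg

theorem post_zero (f : ∀ n, Pow V n ⟶ W) (l : W ⟶ U) (hf : f 0 = 0) : post f l 0 = 0 := by
  rw [post, hf, zero_comp]

theorem post_add (f g : ∀ n, Pow V n ⟶ W) (l : W ⟶ U) :
    post (f + g) l = post f l + post g l := funext fun _ => Preadditive.add_comp _ _ _ _ _ _

theorem post_post (f : ∀ n, Pow V n ⟶ W) (l : W ⟶ U) (l' : U ⟶ T) :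
    post (post f l) l' = post f (l ≫ l') := funext fun _ => Category.assoc _ _ _

theorem post_id (f : ∀ n, Pow V n ⟶ W) : post f (𝟙 W) = f := funext fun _ => Category.comp_id _

end Abs

end AInf

namespace AInf

/-! ### The square of the coderivation attached to an odd family. -/

namespace Lab

section

variable {C : Type u} [Category.{v} C] [Preadditive C] {X Y Z T : Lab C}

/-- The composition of the odd parts. -/
def oo (f : X ⟶ Y) (g : Y ⟶ Z) : GHom X.obj Z.obj (Z.deg - X.deg + 2) :=
  GHom.comp (od f) (od g) (by ring)

theorem oo_add (f : X ⟶ Y) (g g' : Y ⟶ Z) : oo f (g + g') = oo f g + oo f g' :=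
  GHom.comp_add _ _ _ _

theorem add_oo (f f' : X ⟶ Y) (g : Y ⟶ Z) : oo (f + f') g = oo f g + oo f' g :=
  GHom.add_comp _ _ _ _

theorem oo_zero_left (g : Y ⟶ Z) (f : X ⟶ Y) (hf : od f = 0) : oo f g = 0 := by
  rw [oo, hf, GHom.zero_comp]

theorem oo_zero_right (f : X ⟶ Y) (g : Y ⟶ Z) (hg : od g = 0) : oo f g = 0 := by
  rw [oo, hg, GHom.comp_zero]

theorem oo_sum {ι : Type*} (s : Finset ι) (f : X ⟶ Y) (g : ι → (Y ⟶ Z)) :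
    oo f (∑ i ∈ s, g i) = ∑ i ∈ s, oo f (g i) :=
  map_sum ({ toFun := fun x => oo f x, map_zero' := oo_zero_right _ _ rfl,
             map_add' := fun x y => oo_add f x y } : (Y ⟶ Z) →+ _) g s

theorem sum_oo {ι : Type*} (s : Finset ι) (f : ι → (X ⟶ Y)) (g : Y ⟶ Z) :
    oo (∑ i ∈ s, f i) g = ∑ i ∈ s, oo (f i) g :=
  map_sum ({ toFun := fun x => oo x g, map_zero' := oo_zero_left _ _ rfl,
             map_add' := fun x y => add_oo x y g } : (X ⟶ Y) →+ _) f s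

theorem od_even_comp (f : X ⟶ Y) (g : Y ⟶ Z) (hf : od f = 0) :
    od (f ≫ g) = GHom.comp (ev f) (od g) (by ring) := by
  rw [od_comp, hf, GHom.zero_comp, add_zero]

theorem od_comp_even (f : X ⟶ Y) (g : Y ⟶ Z) (hg : od g = 0) :
    od (f ≫ g) = GHom.comp (od f) (ev g) (by ring) := by
  rw [od_comp, hg, GHom.comp_zero, zero_add]

theorem even_comp_oo (h : X ⟶ Y) (f : Y ⟶ Z) (g : Z ⟶ T) (hh : od h = 0) :
    oo (h ≫ f) g = GHom.comp (ev h) (oo f g) (by ring) := by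
  rw [oo, od_even_comp _ _ hh, oo, GHom.comp_assoc]

theorem oo_comp_even (f : X ⟶ Y) (g : Y ⟶ Z) (h : Z ⟶ T) (hh : od h = 0) :
    oo f (g ≫ h) = GHom.comp (oo f g) (ev h) (by ring) := by
  rw [oo, od_comp_even _ _ hh, oo, GHom.comp_assoc]

/-- An even morphism between two odd parts may be attached to either side. This is what lets `oo`
follow the associativity of compositions although the product of two odd parts is invisible in `Lab
C`. -/
theorem oo_even_mid (f : X ⟶ Y) (h : Y ⟶ Z) (g : Z ⟶ T) (hh : od h = 0) :
    oo f (h ≫ g) = oo (f ≫ h) g := by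
  rw [oo, oo, od_comp_even _ _ hh, od_even_comp _ _ hh]
  exact (GHom.comp_assoc _ _ _ _ _ _).symm

theorem od_sub (f g : X ⟶ Y) : od (f - g) = od f - od g := by
  exact map_sub (odHom X Y) f g
theorem ev_sub (f g : X ⟶ Y) : ev (f - g) = ev f - ev g := by
  exact map_sub (evHom X Y) f g

end

section

variable {C : Type u} [Category.{v} C] [Preadditive C] [HasFiniteBiproducts C]
  [MonoidalCategory C] [MonoidalPreadditive C] [HasColimits C]
  [∀ X : C, PreservesFilteredColimits (tensorLeft X)]
  [∀ X : C, PreservesFilteredColimits (tensorRight X)]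

theorem sum_sum_tensor {M M' L L' : GradedObject ℤ C} {r s t : ℤ} {ι κ : Type*} (S : Finset ι)
    (S' : Finset κ) (f : ι → GHom M M' r) (g : κ → GHom L L' s) (h : r + s = t) (n : ℤˣ) :
    ∑ i ∈ S, ∑ j ∈ S', n • GHom.tensor (f i) (g j) h =
      n • GHom.tensor (∑ i ∈ S, f i) (∑ j ∈ S', g j) h := by
  have h1 : GHom.tensor (∑ i ∈ S, f i) (∑ j ∈ S', g j) h =
      ∑ i ∈ S, GHom.tensor (f i) (∑ j ∈ S', g j) h :=
    map_sum ({ toFun := fun x => GHom.tensor x _ h, map_zero' := GHom.zero_tensor _ h,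
               map_add' := fun x y => GHom.add_tensor x y _ h } : GHom M M' r →+ _) f S
  rw [h1, Finset.smul_sum]
  refine Finset.sum_congr rfl fun i _ => ?_
  rw [GHom.tensor_sum, Finset.smul_sum]

/-- This is the Leibniz expansion of a product of two odd maps on a tensor product. The two mixed
terms carry opposite signs, since one of them needs two odd maps to be exchanged; they cancel after
summation in `sq_succ`. -/
theorem oo_tensorHom {X X' X'' Y Y' Y'' : Lab C} (f : X ⟶ X') (g : Y ⟶ Y') (f' : X' ⟶ X'')
    (g' : Y' ⟶ Y'') : oo (f ⊗ₘ g) (f' ⊗ₘ g') =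
      (X.deg * (Y''.deg - Y.deg)).negOnePow • GHom.tensor (ev (f ≫ f')) (oo g g')
        (t := X''.deg + Y''.deg - (X.deg + Y.deg) + 2) (by ring) +
      (X.deg * (Y''.deg - Y.deg)).negOnePow • GHom.tensor (oo f f') (ev (g ≫ g'))
        (t := X''.deg + Y''.deg - (X.deg + Y.deg) + 2) (by ring) +
      ((X.deg * (Y''.deg - Y.deg) + X.deg + Y''.deg).negOnePow • GHom.tensor
        (GHom.comp (ev f) (od f') (t := X''.deg - X.deg + 1) (by ring))
        (GHom.comp (od g) (ev g') (t := Y''.deg - Y.deg + 1) (by ring))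
        (t := X''.deg + Y''.deg - (X.deg + Y.deg) + 2) (by ring) -
      (X.deg * (Y''.deg - Y.deg) + X.deg + Y''.deg).negOnePow • GHom.tensor
        (GHom.comp (od f) (ev f') (t := X''.deg - X.deg + 1) (by ring))
        (GHom.comp (ev g) (od g') (t := Y''.deg - Y.deg + 1) (by ring))
        (t := X''.deg + Y''.deg - (X.deg + Y.deg) + 2) (by ring)) := by
  have h1 := GHom.comp_aux (ev f) (ev f') (od g) (od g')
      (t := X'.deg + Y'.deg - (X.deg + Y.deg) + 1) (by ring)
      (t' := X''.deg + Y''.deg - (X'.deg + Y'.deg) + 1) (by ring)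
      (u := X''.deg + Y''.deg - (X.deg + Y.deg) + 2) (a := X''.deg - X.deg)
      (b := Y''.deg - Y.deg + 2) (by ring) (by ring) (by ring) (by ring)
      (x := X.deg * (Y'.deg - Y.deg + 1)) (x' := X'.deg * (Y''.deg - Y'.deg + 1))
      (x'' := X.deg * (Y''.deg - Y.deg))
      ⟨X'.deg * (Y''.deg - Y'.deg + 1) - X.deg * (Y''.deg - Y'.deg), by ring⟩
  have h2 := GHom.comp_aux (od f) (od f') (ev g) (ev g')
      (t := X'.deg + Y'.deg - (X.deg + Y.deg) + 1) (by ring)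
      (t' := X''.deg + Y''.deg - (X'.deg + Y'.deg) + 1) (by ring)
      (u := X''.deg + Y''.deg - (X.deg + Y.deg) + 2) (a := X''.deg - X.deg + 2)
      (b := Y''.deg - Y.deg) (by ring) (by ring) (by ring) (by ring)
      (x := X.deg * (Y'.deg - Y.deg) + Y'.deg) (x' := X'.deg * (Y''.deg - Y'.deg) + Y''.deg)
      (x'' := X.deg * (Y''.deg - Y.deg))
      ⟨X'.deg * (Y''.deg - Y'.deg) - X.deg * (Y''.deg - Y'.deg) + Y''.deg, by ring⟩
  have h3 := GHom.comp_aux (ev f) (od f') (od g) (ev g')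
      (t := X'.deg + Y'.deg - (X.deg + Y.deg) + 1) (by ring)
      (t' := X''.deg + Y''.deg - (X'.deg + Y'.deg) + 1) (by ring)
      (u := X''.deg + Y''.deg - (X.deg + Y.deg) + 2) (a := X''.deg - X.deg + 1)
      (b := Y''.deg - Y.deg + 1) (by ring) (by ring) (by ring) (by ring)
      (x := X.deg * (Y'.deg - Y.deg + 1)) (x' := X'.deg * (Y''.deg - Y'.deg) + Y''.deg)
      (x'' := X.deg * (Y''.deg - Y.deg) + X.deg + Y''.deg)
      ⟨X'.deg * (Y''.deg - Y'.deg) - X.deg * (Y''.deg - Y'.deg), by ring⟩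
  have h4 := GHom.comp_aux (od f) (ev f') (ev g) (od g')
      (t := X'.deg + Y'.deg - (X.deg + Y.deg) + 1) (by ring)
      (t' := X''.deg + Y''.deg - (X'.deg + Y'.deg) + 1) (by ring)
      (u := X''.deg + Y''.deg - (X.deg + Y.deg) + 2) (a := X''.deg - X.deg + 1)
      (b := Y''.deg - Y.deg + 1) (by ring) (by ring) (by ring) (by ring)
      (x := X.deg * (Y'.deg - Y.deg) + Y'.deg) (x' := X'.deg * (Y''.deg - Y'.deg + 1))
      (x'' := X.deg * (Y''.deg - Y.deg) + X.deg + Y''.deg + 1)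
      ⟨X'.deg * (Y''.deg - Y'.deg + 1) - X.deg * (Y''.deg - Y'.deg) - X.deg, by ring⟩
  -- The exponent in `h4` was chosen one larger than that in `h3`: this extra 1 is the Koszul sign
  -- of moving one odd part past the other.
  rw [Int.negOnePow_succ, Units.neg_smul] at h4
  rw [oo, od_tensorHom, od_tensorHom, GHom.comp_add, GHom.add_comp, GHom.add_comp]
  refine (congrArg₂ (· + ·) (congrArg₂ (· + ·) h1 h4) (congrArg₂ (· + ·) h3 h2)).trans ?_
  rw [ev_comp, ev_comp]
  unfold oo
  abel

open Abs

variable {V W U : Lab C}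

theorem od_comp_fam (f : ∀ n, Pow V n ⟶ W) (g : ∀ n, Pow W n ⟶ U) (hf : ∀ n, od (f n) = 0)
    (hg : ∀ n, od (g n) = 0) (n : ℕ) : od (comp f g n) = 0 := by
  rw [comp, od_sum]
  exact Finset.sum_eq_zero fun r _ => od_comp_zero _ _ (od_F f hf _ _) (hg _)

theorem ev_comp_fam_congr {f f' : ∀ n, Pow V n ⟶ W} {g g' : ∀ n, Pow W n ⟶ U}
    (h : ∀ n, ev (f n) = ev (f' n)) (h' : ∀ n, ev (g n) = ev (g' n)) (n : ℕ) :
    ev (comp f g n) = ev (comp f' g' n) := by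
  rw [comp, comp, ev_sum, ev_sum]
  refine Finset.sum_congr rfl fun r _ => ?_
  rw [ev_comp, ev_comp, ev_F_congr f f' h, h']

/-- The square of the coderivation attached to the odd part of a family. -/
noncomputable def sq (f : ∀ n, Pow V n ⟶ V) (s n : ℕ) :
    GHom (Pow V n).obj (Pow V s).obj ((Pow V s).deg - (Pow V n).deg + 2) :=
  ∑ r ∈ Finset.range (n + 1), oo (F f r n) (F f s r)

/-- The components of the square of the coderivation attached to the odd part of a family. -/
noncomputable def sqc (f : ∀ n, Pow V n ⟶ V) (n : ℕ) :
    GHom (Pow V n).obj V.obj (V.deg - (Pow V n).deg + 2) :=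
  ∑ r ∈ Finset.range (n + 1), oo (F f r n) (f r)

/-- The even part of a composition by an odd one. -/
theorem sum_ev_od (f : ∀ n, Pow V n ⟶ V) (he : ∀ n, ev (f n) = ev (one V n)) (n : ℕ)
    (g : ∀ n, Pow V n ⟶ W) :
    ∑ r ∈ Finset.range (n + 1), GHom.comp (ev (F f r n)) (od (g r))
      (t := W.deg - (Pow V n).deg + 1) (by ring) = od (g n) := by
  have h := congrArg (fun x => od (x n)) (one_comp g)
  rw [comp, od_sum] at h
  rw [← h]
  refine Finset.sum_congr rfl fun r _ => ?_
  rw [od_even_comp _ _ (od_F _ (fun n => by match n with | 0 => rfl | 1 => rfl | n + 2 => rfl) _ _),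
    ev_F_congr f _ he]

theorem od_one' (V : Lab C) (n : ℕ) : od (one V n) = 0 := by
  match n with
  | 0 => rfl
  | 1 => rfl
  | n + 2 => rfl

/-- Read off the odd part of the identity "f composed with `one` is f" in matrix form. The even part
of f may replace `one`, because they agree by `he`. -/
theorem sum_od_ev (f : ∀ n, Pow V n ⟶ V) (h0 : f 0 = 0) (he : ∀ n, ev (f n) = ev (one V n))
    (s n : ℕ) :
    ∑ r ∈ Finset.range (n + 1), GHom.comp (od (F f r n)) (ev (F f s r))
      (t := (Pow V s).deg - (Pow V n).deg + 1) (by ring) = od (F f s n) := by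
  have h := F_comp f (one V) h0 s n
  rw [comp_one f h0] at h
  conv_rhs => rw [h, od_sum]
  refine Finset.sum_congr rfl fun r _ => ?_
  rw [od_comp_even _ _ (od_F _ (od_one' V) _ _), ev_F_congr f _ he]

/-- The square of an odd coderivation D is a coderivation: on a product, D² becomes 1 ⊗ D² + D² ⊗ 1
plus two mixed terms D ⊗ D of opposite signs. The formula is the recursion of a coderivation whose
components are `sqc f`, the even parts having summed up to those of the identity. -/
theorem sq_succ (f : ∀ n, Pow V n ⟶ V) (h0 : f 0 = 0) (he : ∀ n, ev (f n) = ev (one V n))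
    (s n : ℕ) : sq f (s + 1) n = ∑ x ∈ Finset.HasAntidiagonal.antidiagonal n,
      GHom.comp (ev (sp V x.1 x.2 n))
        (((Pow V x.1).deg * ((Pow V s).deg - (Pow V x.2).deg)).negOnePow •
            GHom.tensor (ev (one V x.1)) (sq f s x.2)
              (t := V.deg + (Pow V s).deg - ((Pow V x.1).deg + (Pow V x.2).deg) + 2) (by ring) +
          ((Pow V x.1).deg * ((Pow V s).deg - (Pow V x.2).deg)).negOnePow •
            GHom.tensor (sqc f x.1) (ev (F (one V) s x.2))
              (t := V.deg + (Pow V s).deg - ((Pow V x.1).deg + (Pow V x.2).deg) + 2) (by ring))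
        (t := (V.deg + (Pow V s).deg) - (Pow V n).deg + 2)
        (by change (Pow V x.1).deg + (Pow V x.2).deg - _ + _ = _; ring) := by
  have e1 : ∀ r ∈ Finset.range (n + 1), oo (F f r n) (F f (s + 1) r) =
        ∑ x ∈ Finset.HasAntidiagonal.antidiagonal n, ∑ y ∈ Finset.HasAntidiagonal.antidiagonal r,
          GHom.comp (ev (sp V x.1 x.2 n)) (oo (F f y.1 x.1 ⊗ₘ F f y.2 x.2) (f y.1 ⊗ₘ F f s y.2))
            (t := (V.deg + (Pow V s).deg) - (Pow V n).deg + 2)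
            (by change (Pow V x.1).deg + (Pow V x.2).deg - _ +
                  (V.deg + (Pow V s).deg - ((Pow V x.1).deg + (Pow V x.2).deg) + 2) = _; ring) := by
    intro r _
    rw [F_succ, oo_sum, Finset.sum_comm]
    refine Finset.sum_congr rfl fun y hy => ?_
    rw [oo_even_mid _ _ _ (od_sp _ _ _ _),
      F_sp f y.1 y.2 r n (Finset.HasAntidiagonal.mem_antidiagonal.1 hy), sum_oo]
    refine Finset.sum_congr rfl fun x hx => ?_
    exact even_comp_oo _ _ _ (od_sp _ _ _ _)
  refine (Finset.sum_congr rfl e1).trans ?_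
  rw [Finset.sum_comm]
  refine Finset.sum_congr rfl fun x hx => ?_
  rw [sum_range_antidiagonal x.1 x.2 n (Finset.HasAntidiagonal.mem_antidiagonal.1 hx)
      (fun a b => GHom.comp (ev (sp V x.1 x.2 n))
        (oo (F f a x.1 ⊗ₘ F f b x.2) (f a ⊗ₘ F f s b)) _)]
  · simp only [← GHom.comp_sum]
    congr 1
    simp only [oo_tensorHom, Finset.sum_add_distrib, Finset.sum_sub_distrib]
    have h1 : ∀ i : ℕ, ∑ a ∈ Finset.range (i + 1), ev (F f a i ≫ f a) = ev (one V i) := by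
      intro i
      rw [← ev_sum]
      refine (ev_comp_fam_congr he he i).trans ?_
      rw [one_comp]
    have h2 : ∀ i : ℕ, ∑ a ∈ Finset.range (i + 1), ev (F f a i ≫ F f s a) =
        ev (F (one V) s i) := by
      intro i
      rw [← ev_sum, ← F_comp f f h0]
      refine ev_F_congr _ _ (fun k => (ev_comp_fam_congr he he k).trans ?_) _ _
      rw [one_comp]
    have h3 : ∀ i : ℕ, ∑ a ∈ Finset.range (i + 1), GHom.comp (od (F f a i)) (ev (f a))
        (t := V.deg - (Pow V i).deg + 1) (by ring) = od (f i) := by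
      intro i
      have h := congrArg (fun x => od (x i)) (comp_one f h0)
      rw [comp, od_sum] at h
      rw [← h]
      refine Finset.sum_congr rfl fun r _ => ?_
      rw [od_comp_even _ _ (od_one' V r), he]
    refine (congrArg₂ (· + ·) (congrArg₂ (· + ·) (sum_sum_tensor _ _ _ _ _ _)
      (sum_sum_tensor _ _ _ _ _ _)) (congrArg₂ (· - ·) (sum_sum_tensor _ _ _ _ _ _)
      (sum_sum_tensor _ _ _ _ _ _))).trans ?_
    -- Both mixed sums become the tensor product of the odd part of `f` with that of `F f s`, so
    -- their difference is zero.
    rw [h1, h2, sum_ev_od f he, sum_od_ev f h0 he, h3, sum_ev_od f he, sub_self, add_zero]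
    rfl
  · intro a b h
    rw [F_lt f h0 a x.1 h, zero_tensor', oo_zero_left _ _ rfl, GHom.comp_zero]
  · intro a b h
    rw [F_lt f h0 b x.2 h, tensor_zero', oo_zero_left _ _ rfl, GHom.comp_zero]

end

end Lab

end AInf

namespace AInf

/-! ### Vanishing of the square, and the relations of algebras. -/

namespace Lab

section

variable {C : Type u} [Category.{v} C] [Preadditive C] [HasFiniteBiproducts C]
  [MonoidalCategory C] [MonoidalPreadditive C] [HasColimits C]
  [∀ X : C, PreservesFilteredColimits (tensorLeft X)]
  [∀ X : C, PreservesFilteredColimits (tensorRight X)]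

open Abs

variable {V W U : Lab C}

theorem od_F_zero (f : ∀ n, Pow V n ⟶ W) (n : ℕ) : od (F f 0 n) = 0 := by
  cases n <;> rfl

theorem sq_zero_left (f : ∀ n, Pow V n ⟶ V) (n : ℕ) : sq f 0 n = 0 :=
  Finset.sum_eq_zero fun _ _ => oo_zero_right _ _ (od_F_zero _ _)

theorem sqc_zero (f : ∀ n, Pow V n ⟶ V) (h0 : f 0 = 0) : sqc f 0 = 0 := by
  refine Finset.sum_eq_zero fun r _ => ?_
  cases r with
  | zero => exact oo_zero_left _ _ rfl
  | succ r =>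
    rw [F_lt f h0 _ _ (Nat.succ_pos r)]
    exact oo_zero_left _ _ rfl

theorem sq_eq_zero_of_lt (f : ∀ n, Pow V n ⟶ V) (h0 : f 0 = 0)
    (he : ∀ n, ev (f n) = ev (one V n)) (n : ℕ) (h : ∀ k < n, sqc f k = 0) (s : ℕ) :
    ∀ k < n, sq f s k = 0 := by
  induction s with
  | zero => exact fun k _ => sq_zero_left f k
  | succ s ih =>
    intro k hk
    rw [sq_succ f h0 he]
    refine Finset.sum_eq_zero fun x hx => ?_
    have hx' := Finset.HasAntidiagonal.mem_antidiagonal.1 hx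
    rw [ih x.2 (by omega), h x.1 (by omega), GHom.tensor_zero, GHom.zero_tensor, smul_zero,
      add_zero]
    exact GHom.comp_zero _ _

/-- A coderivation maps arity n to arity s through its component of arity n - s + 1. When the
components below n vanish, only s = 1 can contribute in arity n. -/
theorem sq_eq_zero_of_ne (f : ∀ n, Pow V n ⟶ V) (h0 : f 0 = 0)
    (he : ∀ n, ev (f n) = ev (one V n)) (n : ℕ) (h : ∀ k < n, sqc f k = 0) (s : ℕ) (hs : s ≠ 1) :
    sq f s n = 0 := by
  obtain _ | _ | s := s
  · exact sq_zero_left f n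
  · exact absurd rfl hs
  rw [sq_succ f h0 he]
  refine Finset.sum_eq_zero fun x hx => ?_
  have hx' := Finset.HasAntidiagonal.mem_antidiagonal.1 hx
  have h1 : GHom.tensor (ev (one V x.1)) (sq f (s + 1) x.2)
      (t := V.deg + (Pow V (s + 1)).deg - ((Pow V x.1).deg + (Pow V x.2).deg) + 2) (by ring) =
        0 := by
    rcases Nat.eq_zero_or_pos x.1 with h1 | h1
    · rw [one_ne V (by omega), ev_zero, GHom.zero_tensor]
    · rw [sq_eq_zero_of_lt f h0 he n h _ _ (by omega), GHom.tensor_zero]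
  have h2 : GHom.tensor (sqc f x.1) (ev (F (one V) (s + 1) x.2))
      (t := V.deg + (Pow V (s + 1)).deg - ((Pow V x.1).deg + (Pow V x.2).deg) + 2) (by ring) =
        0 := by
    rcases Nat.eq_zero_or_pos x.2 with h1 | h1
    · rw [F_lt _ (one_ne V (by omega)) _ _ (by omega), ev_zero, GHom.tensor_zero]
    · rw [h _ (by omega), GHom.zero_tensor]
  rw [h1, h2, smul_zero, add_zero]
  exact GHom.comp_zero _ _

theorem sq_eq_zero (f : ∀ n, Pow V n ⟶ V) (h0 : f 0 = 0)
    (he : ∀ n, ev (f n) = ev (one V n)) (h : ∀ k, sqc f k = 0) (s n : ℕ) : sq f s n = 0 :=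
  sq_eq_zero_of_lt f h0 he (n + 1) (fun k _ => h k) s n (Nat.lt_succ_self n)

/-- This and the next two lemmas are the associativity laws for products of two odd coderivations
and one even family k. The coderivations stand both before k, on either side of k, or both after k.
-/
theorem sum_oo_comp (f : ∀ n, Pow V n ⟶ V) (h0 : f 0 = 0) (k : ∀ n, Pow V n ⟶ W)
    (hk : ∀ n, od (k n) = 0) (n : ℕ) :
    ∑ r ∈ Finset.range (n + 1), oo (F f r n) (comp f k r) =
      ∑ s ∈ Finset.range (n + 1), GHom.comp (sq f s n) (ev (k s)) (by ring) := by
  have h1 : ∀ r ∈ Finset.range (n + 1), oo (F f r n) (comp f k r) =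
      ∑ s ∈ Finset.range (n + 1), GHom.comp (oo (F f r n) (F f s r)) (ev (k s)) (by ring) := by
    intro r hr
    rw [comp, sum_range_ext (fun s => F f s r ≫ k s) (N := n)
      (by have := Finset.mem_range.1 hr; omega)
      (fun s hs => by rw [F_lt f h0 s r hs, zero_comp]), oo_sum]
    exact Finset.sum_congr rfl fun s _ => oo_comp_even _ _ _ (hk s)
  rw [Finset.sum_congr rfl h1, Finset.sum_comm]
  exact Finset.sum_congr rfl fun s _ => (GHom.sum_comp _ _ _ _).symm

theorem sum_oo_comp' (f : ∀ n, Pow V n ⟶ V) (h0 : f 0 = 0) (k : ∀ n, Pow V n ⟶ W)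
    (hk0 : k 0 = 0) (hk : ∀ n, od (k n) = 0) (g : ∀ n, Pow W n ⟶ U) (n : ℕ) :
    ∑ r ∈ Finset.range (n + 1), oo (F f r n) (comp k g r) =
      ∑ s ∈ Finset.range (n + 1), oo (F (comp f k) s n) (g s) := by
  have h1 : ∀ r ∈ Finset.range (n + 1), oo (F f r n) (comp k g r) =
      ∑ s ∈ Finset.range (n + 1), oo (F f r n ≫ F k s r) (g s) := by
    intro r hr
    rw [comp, sum_range_ext (fun s => F k s r ≫ g s) (N := n)
      (by have := Finset.mem_range.1 hr; omega)
      (fun s hs => by rw [F_lt k hk0 s r hs, zero_comp]), oo_sum]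
    exact Finset.sum_congr rfl fun s _ => oo_even_mid _ _ _ (od_F k hk _ _)
  rw [Finset.sum_congr rfl h1, Finset.sum_comm]
  refine Finset.sum_congr rfl fun s _ => ?_
  rw [F_comp f k h0, sum_oo]

theorem sum_oo_comp'' (k : ∀ n, Pow V n ⟶ W) (hk0 : k 0 = 0) (hk : ∀ n, od (k n) = 0)
    (g : ∀ n, Pow W n ⟶ W) (g0 : g 0 = 0) (n : ℕ) :
    ∑ s ∈ Finset.range (n + 1), oo (F (comp k g) s n) (g s) =
      ∑ r ∈ Finset.range (n + 1), GHom.comp (ev (F k r n)) (sqc g r) (by ring) := by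
  have h1 : ∀ s ∈ Finset.range (n + 1), oo (F (comp k g) s n) (g s) =
      ∑ r ∈ Finset.range (n + 1), GHom.comp (ev (F k r n)) (oo (F g s r) (g s)) (by ring) := by
    intro s _
    rw [F_comp k g hk0, sum_oo]
    exact Finset.sum_congr rfl fun r _ => even_comp_oo _ _ _ (od_F k hk _ _)
  rw [Finset.sum_congr rfl h1, Finset.sum_comm]
  refine Finset.sum_congr rfl fun r hr => ?_
  rw [sqc, sum_range_ext (fun s => oo (F g s r) (g s)) (N := n)
      (by have := Finset.mem_range.1 hr; omega)
      (fun s hs => by rw [F_lt g g0 s r hs]; exact oo_zero_left _ _ rfl), GHom.comp_sum]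

/-- The families h i intertwine the square of f with that of g i, which is zero. By induction all
components below n vanish, so in arity n the intertwining relation reduces to `sqc f n` followed by
the linear part of h i, and joint monicity concludes. This replaces a direct check of the relations
for transported algebras and fibre products. -/
theorem sqc_eq_zero_of_mono {ι : Type*} (f : ∀ n, Pow V n ⟶ V) (h0 : f 0 = 0)
    (he : ∀ n, ev (f n) = ev (one V n)) (W : ι → Lab C) (g : ∀ i n, Pow (W i) n ⟶ W i)
    (g0 : ∀ i, g i 0 = 0) (hg : ∀ i n, sqc (g i) n = 0) (h : ∀ i n, Pow V n ⟶ W i)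
    (hh0 : ∀ i, h i 0 = 0) (hh : ∀ i n, od (h i n) = 0) (hc : ∀ i, comp f (h i) = comp (h i) (g i))
    (hm : ∀ (M : GradedObject ℤ C) (r : ℤ) (x : GHom M V.obj r),
      (∀ i, GHom.comp x (ev (lin (h i))) rfl = 0) → x = 0) (n : ℕ) : sqc f n = 0 := by
  induction n using Nat.strong_induction_on with
  | _ n ih =>
    rcases Nat.eq_zero_or_pos n with rfl | hn
    · exact sqc_zero f h0
    apply hm
    intro i
    have h1 := sum_oo_comp f h0 (h i) (hh i) n
    rw [hc, sum_oo_comp' f h0 (h i) (hh0 i) (hh i), hc,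
      sum_oo_comp'' (h i) (hh0 i) (hh i) (g i) (g0 i),
      Finset.sum_eq_zero fun r _ => by rw [hg, GHom.comp_zero], Finset.sum_eq_single 1] at h1
    -- The row s = 1 is `sqc f n` up to the unitor, since `F f 1 r` is `f r` up to the unitor.
    · have h2 : sq f 1 n = GHom.comp (sqc f n) (ev (ρ_ V).inv) (by ring) := by
        rw [sqc, GHom.sum_comp]
        refine Finset.sum_congr rfl fun r _ => ?_
        rw [F_one f r]
        exact oo_comp_even _ _ (ρ_ V).inv rfl
      rw [h2, GHom.comp_assoc (bc := (W i).deg - V.deg) _ _ _ _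
        (by change (V.deg + 0) - V.deg + ((W i).deg - (V.deg + 0)) = _; ring)] at h1
      have h3 := congrArg (GHom.recast (M := (Pow V n).obj) (L := (W i).obj)
        (s := V.deg - (Pow V n).deg + 2 + ((W i).deg - V.deg)) (by ring)) h1
      rw [GHom.recast_zero] at h3
      exact ((GHom.recast_comp _ _ _ _).symm.trans h3.symm)
    · intro s _ hs
      rw [sq_eq_zero_of_ne f h0 he n ih s hs, GHom.zero_comp]
    · intro h
      exact absurd (Finset.mem_range.2 (by omega)) h

variable {A B D : GradedObject ℤ C}

theorem ev_inv_cancel {X Y : Lab C} (i : X ≅ Y) {M : GradedObject ℤ C} {r t : ℤ}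
    (x : GHom X.obj M r) (ht : X.deg - Y.deg + r = t) (h : GHom.comp (ev i.inv) x ht = 0) :
    x = 0 := by
  have h1 := congrArg (fun y => GHom.comp (ev i.hom) y (t := r) (by omega)) h
  rw [GHom.comp_zero, ← GHom.comp_assoc (ab := X.deg - X.deg) _ _ _ (by ring) _ (by ring)] at h1
  have h2 : GHom.comp (ev i.hom) (ev i.inv) (t := X.deg - X.deg) (by ring) =
      GHom.ofHom (𝟙 X.obj) (sub_self _) := by
    rw [← ev_comp, i.hom_inv_id]; rfl
  rw [h2, GHom.ofHom_id_comp, GHom.recast_rfl] at h1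
  exact h1

/-- The left hand side of the relations for algebras. -/
noncomputable def relSum (m : ∀ n : ℕ, GHom (pow A n) A (2 - n)) (n : ℕ) : GHom (pow A n) A (3 - n) :=
  ∑ x ∈ (triples n).attach,
    ((x.1.1 : ℤ) * x.1.2.1 + x.1.2.2).negOnePow •
      GHom.comp (ins m x.1.1 x.1.2.1 x.1.2.2 n (x.1.1 + 1 + x.1.2.2) (mem_triples.1 x.2) rfl)
        (m (x.1.1 + 1 + x.1.2.2)) (t := 3 - n)
        (by have h := mem_triples.1 x.2; push_cast; omega)

/-- The odd part of the matrix of 1 + εm collects the signed maps 1 ⊗ m_k ⊗ 1 (`od_mat_phi`).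
Grouping the triples (j, k, l) by r = j + 1 + l turns the literal relation into a row of a matrix
product. -/
theorem relSum_eq (m : ∀ n : ℕ, GHom (pow A n) A (2 - n)) (hm : m 0 = 0) (n : ℕ) :
    relSum m n = ∑ r ∈ Finset.range (n + 1), GHom.comp (od (mat (phi m) r n)) (m r)
      (t := 3 - n) (by change (r : ℤ) - n + 1 + _ = _; ring) := by
  have h0 : relSum m n =
    ∑ x ∈ Finset.HasAntidiagonal.antidiagonal n, ∑ y ∈ Finset.HasAntidiagonal.antidiagonal x.2,
      ((x.1 : ℤ) * y.1 + y.2).negOnePow • GHom.comp (insT m x.1 y.1 y.2 (x.1 + 1 + y.2) n)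
        (m (x.1 + 1 + y.2)) (t := 3 - n) (by push_cast; ring) := by
    rw [← sum_triples n fun j k l => ((j : ℤ) * k + l).negOnePow •
      GHom.comp (insT m j k l (j + 1 + l) n) (m (j + 1 + l)) (t := 3 - n) (by push_cast; ring),
      ← Finset.sum_attach (triples n), relSum]
    refine Finset.sum_congr rfl fun x _ => ?_
    rw [insT, dif_pos ⟨mem_triples.1 x.2, rfl⟩, GHom.recast_comp']
  have h1 : ∀ r : ℕ, GHom.comp (od (mat (phi m) r n)) (m r)
      (t := 3 - n) (by change (r : ℤ) - n + 1 + _ = _; ring) =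
      ∑ x ∈ Finset.HasAntidiagonal.antidiagonal n,
        ∑ y ∈ Finset.HasAntidiagonal.antidiagonal x.2, ((x.1 : ℤ) * y.1 + y.2).negOnePow •
          GHom.comp (insT m x.1 y.1 y.2 r n) (m r) (t := 3 - n) (by ring) := by
    intro r
    rw [od_mat_phi m hm]
    refine (GHom.sum_comp _ _ _ _).trans ?_
    refine Finset.sum_congr rfl fun x _ => ?_
    refine (GHom.sum_comp _ _ _ _).trans ?_
    refine Finset.sum_congr rfl fun y _ => ?_
    exact GHom.smul_comp _ _ _ _
  rw [Finset.sum_congr rfl fun r _ => h1 r, Finset.sum_comm, h0]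
  refine Finset.sum_congr rfl fun x hx => ?_
  rw [Finset.sum_comm]
  refine Finset.sum_congr rfl fun y hy => ?_
  rw [Finset.sum_eq_single (x.1 + 1 + y.2)]
  · intro r _ hr
    rw [insT, dif_neg (by omega), GHom.zero_comp, smul_zero]
  · intro h
    have hx' := Finset.HasAntidiagonal.mem_antidiagonal.1 hx
    have hy' := Finset.HasAntidiagonal.mem_antidiagonal.1 hy
    rw [Finset.mem_range] at h
    -- The target arity j + 1 + l exceeds n = j + k + l only when k = 0, and such terms vanish
    -- because m_0 = 0.
    have h0 : y.1 = 0 := by omega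
    rw [h0, insT_zero m hm, GHom.zero_comp, smul_zero]

theorem e_inv_comp_sqc (f : ∀ n, Pow (sV A) n ⟶ sV A) (n : ℕ) :
    GHom.comp (ev (e A n).inv) (sqc f n) (t := (sV A).deg - (sP A n).deg + 2) (by ring) =
      ∑ r ∈ Finset.range (n + 1), oo (mat f r n) (fam f r) := by
  rw [sqc, GHom.comp_sum]
  refine Finset.sum_congr rfl fun r _ => ?_
  rw [fam, oo_even_mid _ _ _ (od_e_inv A r), mat, Category.assoc, Category.assoc, Iso.hom_inv_id,
    Category.comp_id, even_comp_oo _ _ _ (od_e_inv A n)]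

/-- The two expressions differ by the isomorphism between `Pow` and the literal tensor powers and by
a rewriting of the degree. -/
theorem relSum_iff (m : ∀ n : ℕ, GHom (pow A n) A (2 - n)) (hm : m 0 = 0) (n : ℕ) :
    relSum m n = 0 ↔ sqc (phi m) n = 0 := by
  have h1 : GHom.recast (by change _ = (1 : ℤ) - n + 2; ring) (relSum m n) =
      GHom.comp (ev (e A n).inv) (sqc (phi m) n) (t := (sV A).deg - (sP A n).deg + 2)
        (by ring) := by
    rw [e_inv_comp_sqc, relSum_eq m hm, GHom.recast_sum]
    refine Finset.sum_congr rfl fun r _ => ?_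
    rw [oo, od_fam_phi, GHom.comp_recast, GHom.recast_comp]
  constructor
  · intro h
    rw [h, GHom.recast_zero] at h1
    exact ev_inv_cancel (e A n) _ _ h1.symm
  · intro h
    rw [h, GHom.comp_zero] at h1
    have h2 := congrArg (GHom.recast (M := pow A n) (L := A) (s := 3 - n)
      (by change (1 : ℤ) - n + 2 = _; ring)) h1
    rw [GHom.recast_cancel, GHom.recast_zero] at h2
    exact h2

end

end Lab

end AInf

namespace AInf

/-! ### Dictionary between algebras and families, and the underlying complex. -/

section

variable {C : Type u} [Category.{v} C] [Preadditive C] [HasFiniteBiproducts C]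
  [MonoidalCategory C] [MonoidalPreadditive C] [HasColimits C]
  [∀ X : C, PreservesFilteredColimits (tensorLeft X)]
  [∀ X : C, PreservesFilteredColimits (tensorRight X)]

open Abs Lab

namespace AInfAlg

/-- The shifted graded object underlying an algebra. -/
noncomputable abbrev V (A : AInfAlg C) : Lab C := sV A.obj

/-- The family encoding the operations of an algebra. -/
noncomputable def str (A : AInfAlg C) : ∀ n, Pow A.V n ⟶ A.V := phi A.m

theorem str_zero (A : AInfAlg C) : A.str 0 = 0 := phi_zero A

theorem ev_str (A : AInfAlg C) (n : ℕ) : ev (A.str n) = ev (one A.V n) := ev_phi A.m n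

theorem sqc_str (A : AInfAlg C) (n : ℕ) : sqc A.str n = 0 :=
  (relSum_iff A.m A.m_zero n).1 (A.rel n)

end AInfAlg

/-- The operations encoded by a family. -/
noncomputable def opsOf {A : GradedObject ℤ C} (f : ∀ n, Pow (sV A) n ⟶ sV A) (n : ℕ) :
    GHom (pow A n) A (2 - n) :=
  GHom.recast (by change (1 : ℤ) - n + 1 = _; ring) (od (fam f n))

theorem opsOf_zero {A : GradedObject ℤ C} (f : ∀ n, Pow (sV A) n ⟶ sV A) (h0 : f 0 = 0) :
    opsOf f 0 = 0 := by
  rw [opsOf, fam, h0, comp_zero]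
  exact GHom.recast_zero _

theorem phi_opsOf {A : GradedObject ℤ C} (f : ∀ n, Pow (sV A) n ⟶ sV A)
    (he : ∀ n, ev (f n) = ev (one (sV A) n)) : phi (opsOf f) = f := by
  refine fam_ext (fun n => ?_) fun n => ?_
  · rw [fam, fam, ev_comp, ev_comp, ev_phi, he]
  · rw [od_fam_phi, opsOf, GHom.recast_cancel]

/-- The algebra encoded by a family. -/
noncomputable abbrev algOf (A : GradedObject ℤ C) (f : ∀ n, Pow (sV A) n ⟶ sV A) (h0 : f 0 = 0)
    (he : ∀ n, ev (f n) = ev (one (sV A) n)) (hs : ∀ n, sqc f n = 0) : AInfAlg C where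
  obj := A
  m := opsOf f
  m_zero := opsOf_zero f h0
  rel n := (relSum_iff (opsOf f) (opsOf_zero f h0) n).2 (by rw [phi_opsOf f he, hs])

theorem str_algOf (A : GradedObject ℤ C) (f : ∀ n, Pow (sV A) n ⟶ sV A) (h0 : f 0 = 0)
    (he : ∀ n, ev (f n) = ev (one (sV A) n)) (hs : ∀ n, sqc f n = 0) :
    (algOf A f h0 he hs).str = f := phi_opsOf f he

/-- The family encoding a morphism. -/
noncomputable def fm {A B : AInfAlg C} (f : A ⟶ B) : ∀ n, Pow A.V n ⟶ B.V := hat (AInfHom.f f)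

theorem fm_zero {A B : AInfAlg C} (f : A ⟶ B) : fm f 0 = 0 := hat_zero _ (AInfHom.f_zero f)

theorem od_fm {A B : AInfAlg C} (f : A ⟶ B) (n : ℕ) : od (fm f n) = 0 := od_hat _ n

theorem fm_comm {A B : AInfAlg C} (f : A ⟶ B) :
    Abs.comp A.str (fm f) = Abs.comp (fm f) B.str := AInfHom.comm f

theorem fm_comp {A B D : AInfAlg C} (f : A ⟶ B) (g : B ⟶ D) :
    fm (f ≫ g) = Abs.comp (fm f) (fm g) := hat_compFun _ _

theorem fm_id (A : AInfAlg C) : fm (𝟙 A) = one A.V := hat_idFun _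

theorem fm_ext {A B : AInfAlg C} {f g : A ⟶ B} (h : fm f = fm g) : f = g := AInfHom.ext' h

theorem hat_ev_fam {A B : GradedObject ℤ C} (g : ∀ n, Pow (sV A) n ⟶ sV B)
    (go : ∀ n, od (g n) = 0) : hat (fun n => ev (fam g n)) = g :=
  fam_ext (fun n => ev_fam_hat _ n) fun n => by
    rw [od_fam_hat, fam, od_comp_zero _ _ (od_e_inv A n) (go n)]

theorem ev_fam_zero {A B : GradedObject ℤ C} (g : ∀ n, Pow (sV A) n ⟶ sV B) (g0 : g 0 = 0) :
    ev (fam g 0) = 0 := by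
  have h : fam g 0 = 0 := by rw [fam, g0, comp_zero]
  rw [h, ev_zero]

/-- The morphism encoded by a family. -/
noncomputable def homOf {A B : AInfAlg C} (g : ∀ n, Pow A.V n ⟶ B.V) (g0 : g 0 = 0)
    (go : ∀ n, od (g n) = 0) (hc : Abs.comp A.str g = Abs.comp g B.str) : A ⟶ B where
  f n := ev (fam g n)
  f_zero := ev_fam_zero g g0
  rel := (rel_iff A.m A.m_zero B.m (fun n => ev (fam g n)) (ev_fam_zero g g0)).2 (by
      rw [hat_ev_fam g go]; exact hc)

theorem fm_homOf {A B : AInfAlg C} (g : ∀ n, Pow A.V n ⟶ B.V) (g0 : g 0 = 0)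
    (go : ∀ n, od (g n) = 0) (hc : Abs.comp A.str g = Abs.comp g B.str) :
    fm (homOf g g0 go hc) = g := hat_ev_fam g go

/-- The linear part of a morphism, as a morphism of graded objects. -/
noncomputable def linHom {A B : AInfAlg C} (f : A ⟶ B) : A.obj ⟶ B.obj :=
  fun p => (linMap f).f p

/-- A morphism of graded objects as a morphism of shifted ones. -/
def shf {A B : GradedObject ℤ C} (φ : A ⟶ B) : sV A ⟶ sV B := ofH φ (sub_self _)

theorem lin_eq_fam {A B : GradedObject ℤ C} (f : ∀ n, Pow (sV A) n ⟶ sV B) :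
    lin f = ofH (X := sV A) (Y := sP A 1) (ρ_ A).inv
      (by change ((1 : ℕ) : ℤ) - 1 = 0; norm_num) ≫ fam f 1 := by
  have h1 : (e A 1).hom = ofH (X := sV A ⊗ 𝟙_ (Lab C)) (Y := sP A 1) (𝟙 (A ⊗ 𝟙_ _)) (by
      change ((1 : ℕ) : ℤ) - (1 + 0) = 0; norm_num) := by
    change sV A ◁ 𝟙 _ ≫ _ = _
    rw [MonoidalCategory.whiskerLeft_id]
    exact Category.id_comp _
  have h2 : (ρ_ (sV A)).inv ≫ (e A 1).hom = ofH (X := sV A) (Y := sP A 1) (ρ_ A).inv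
      (by change ((1 : ℕ) : ℤ) - 1 = 0; norm_num) := by
    rw [h1]
    refine (ofH_comp (X := sV A) (Y := sV A ⊗ 𝟙_ (Lab C)) (Z := sP A 1) (ρ_ A).inv
      (by change (1 + 0 : ℤ) - 1 = 0; norm_num) _ _).trans ?_
    exact congrArg (fun x => ofH (X := sV A) (Y := sP A 1) x _) (Category.comp_id _)
  rw [← h2, fam, Category.assoc]
  exact congrArg _ (Iso.hom_inv_id_assoc _ _).symm

/-- The three classes of morphisms are defined through `linMap`, while constructions are made on
families; this identity carries information from one side to the other. -/
theorem lin_fm {A B : AInfAlg C} (f : A ⟶ B) : lin (fm f) = shf (linHom f) := by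
  rw [lin_eq_fam]
  refine hom_ext ?_ ?_
  · refine (ev_ofH_comp (X := sV A.obj) (Y := sP A.obj 1) (Z := sV B.obj) _ _ _).trans ?_
    refine GHom.ext fun p q hq => ?_
    obtain rfl : q = p := by
      have : p + ((1 : ℤ) - 1) = q := hq
      omega
    refine Eq.trans ?_ (GHom.ofHom_v (linHom f) (sub_self _) q hq).symm
    change _ = GHom.v (linear (AInfHom.f f 1)) q q (by norm_num)
    rw [linear]
    have h1 : ev (fam (fm f) 1) = AInfHom.f f 1 := ev_fam_hat _ 1
    refine (GHom.comp_v _ _ _ q q q (by change q + (((1 : ℕ) : ℤ) - 1) = q; norm_num)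
      (by change q + ((1 : ℤ) - (1 : ℕ)) = q; norm_num)).trans ?_
    refine Eq.trans ?_ (GHom.comp_v (GHom.ofHom (M := A.obj) (L := pow A.obj 1) _ rfl)
      (AInfHom.f f 1) _ q q q (by norm_num) (by norm_num)).symm
    refine congrArg₂ (· ≫ ·) ((GHom.ofHom_v _ _ _ _).trans (GHom.ofHom_v _ _ _ _).symm) ?_
    exact congrArg (fun x => GHom.v x q q (by norm_num)) h1
  · exact od_comp_zero _ _ rfl (od_fam_hat _ _)

/-- The differential of an algebra. -/
noncomputable def dif (A : AInfAlg C) : GHom A.obj A.obj 1 :=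
  GHom.mk fun p q _ => (toComplex A).d p q

theorem dif_v (A : AInfAlg C) (p q : ℤ) (h : p + 1 = q) : (dif A).v p q h = (toComplex A).d p q :=
  GHom.mk_v _ _ _ _

/-- The counterpart of `lin_fm` for the differential: the linear part of the structure family is 1 +
εm_1. Hence contractions of complexes can be used against `lin A.str`. -/
theorem od_lin_str (A : AInfAlg C) : od (lin A.str) = GHom.recast (by simp) (dif A) := by
  rw [lin_eq_fam]
  refine (od_ofH_comp (X := sV A.obj) (Y := sP A.obj 1) (Z := sV A.obj) _ _ _).trans ?_
  refine GHom.ext fun p q hq => ?_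
  have hq' : p + 1 = q := by
    have : p + ((1 : ℤ) - 1 + 1) = q := hq
    omega
  rw [GHom.recast, GHom.mk_v, dif_v]
  refine Eq.trans ?_ (dif_pos (c := p + 1 = q) hq').symm
  rw [linear]
  refine (GHom.comp_v _ _ _ p p q (by change p + (((1 : ℕ) : ℤ) - 1) = p; norm_num)
    (by change p + ((1 : ℤ) - (1 : ℕ) + 1) = q; push_cast; omega)).trans ?_
  refine Eq.trans ?_ (GHom.comp_v (GHom.ofHom (M := A.obj) (L := pow A.obj 1) _ rfl) (A.m 1) _ p p q
    (by norm_num) (by push_cast; omega)).symm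
  refine congrArg₂ (· ≫ ·) ((GHom.ofHom_v _ _ _ _).trans (GHom.ofHom_v _ _ _ _).symm) ?_
  have h := od_fam_phi A.m 1
  refine (congrArg (fun x => GHom.v x p q
    (by change p + ((1 : ℤ) - (1 : ℕ) + 1) = q; push_cast; omega)) h).trans ?_
  rw [GHom.recast, GHom.mk_v]

theorem ev_lin_str (A : AInfAlg C) : ev (lin A.str) = ev (𝟙 A.V) := by
  have h := congrArg ev (lin_one (V := A.V))
  rw [← h, lin, lin, ev_comp, ev_comp, A.ev_str]

theorem shf_id (A : GradedObject ℤ C) : shf (𝟙 A) = 𝟙 (sV A) := rfl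

theorem shf_comp {A B D : GradedObject ℤ C} (f : A ⟶ B) (g : B ⟶ D) :
    shf f ≫ shf g = shf (f ≫ g) := ofH_comp (X := sV A) (Y := sV B) (Z := sV D) f _ g _

theorem od_shf {A B : GradedObject ℤ C} (f : A ⟶ B) : od (shf f) = 0 := rfl

theorem shf_injective {A B : GradedObject ℤ C} {f g : A ⟶ B} (h : shf f = shf g) : f = g := by
  funext p
  have h1 := congrArg (fun x => GHom.v (ev x) p p (by change p + ((1 : ℤ) - 1) = p; norm_num)) h
  dsimp only [shf] at h1
  rw [ev_ofH, ev_ofH] at h1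
  exact (GHom.ofHom_v _ _ _ _).symm.trans (h1.trans (GHom.ofHom_v _ _ _ _))

theorem linHom_comp {A B D : AInfAlg C} (f : A ⟶ B) (g : B ⟶ D) :
    linHom (f ≫ g) = linHom f ≫ linHom g := by
  apply shf_injective
  rw [← lin_fm, fm_comp, lin_comp, lin_fm, lin_fm, shf_comp]

theorem linHom_id (A : AInfAlg C) : linHom (𝟙 A) = 𝟙 A.obj := by
  apply shf_injective
  rw [← lin_fm, fm_id, lin_one, shf_id]

variable (C) in
/-- The functor sending an algebra to its underlying complex. -/
noncomputable def linFunctor : AInfAlg C ⥤ CochainComplex C ℤ where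
  obj A := toComplex A
  map f := linMap f
  map_id A := by
    ext p
    exact congrFun (linHom_id A) p
  map_comp f g := by
    ext p
    exact congrFun (linHom_comp f g) p

end

end AInf

namespace AInf

/-! ### Transport of structure and reduction to strict morphisms. -/

section

variable {C : Type u} [Category.{v} C] [Preadditive C] [HasFiniteBiproducts C]
  [MonoidalCategory C] [MonoidalPreadditive C] [HasColimits C]
  [∀ X : C, PreservesFilteredColimits (tensorLeft X)]
  [∀ X : C, PreservesFilteredColimits (tensorRight X)]

open Abs Lab

theorem od_rinv {V : Lab C} (f : ∀ n, Pow V n ⟶ V) (hf : ∀ n, od (f n) = 0) (n : ℕ) :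
    od (rinv f n) = 0 := by
  induction n using Nat.strong_induction_on with
  | _ n ih =>
    rw [rinv, od_sub, od_sum, od_one', Finset.sum_eq_zero, sub_zero]
    exact fun r _ => od_comp_zero _ _ (od_F f hf _ _) (ih r r.2)

theorem od_post {V W U : Lab C} (f : ∀ n, Pow V n ⟶ W) (l : W ⟶ U) (hf : ∀ n, od (f n) = 0)
    (hl : od l = 0) (n : ℕ) : od (post f l n) = 0 := od_comp_zero _ _ (hf n) hl

theorem od_st {V W : Lab C} (l : V ⟶ W) (hl : od l = 0) (n : ℕ) : od (st l n) = 0 :=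
  od_post _ _ (od_one' V) hl n

theorem od_fadd {V W : Lab C} (f g : ∀ n, Pow V n ⟶ W) (hf : ∀ n, od (f n) = 0)
    (hg : ∀ n, od (g n) = 0) (n : ℕ) : od ((f + g) n) = 0 := by
  rw [Pi.add_apply, od_add, hf, hg, add_zero]

theorem eq_zero_of_comp_id {X : Lab C} {M : GradedObject ℤ C} {r : ℤ} (x : GHom M X.obj r)
    (h : GHom.comp x (ev (𝟙 X)) rfl = 0) : x = 0 := by
  refine GHom.ext fun p q hq => ?_
  have h3 := congrArg (fun y => GHom.v y p q (by omega)) h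
  exact (GHom.comp_id x (sub_self _) _ p q _).symm.trans (h3.trans
    ((GHom.zero_v _ _ _).trans (GHom.zero_v _ _ _).symm))

theorem ev_comp_str {V : Lab C} (A : AInfAlg C) (f : ∀ n, Pow V n ⟶ A.V) (h0 : f 0 = 0) (n : ℕ) :
    ev (Abs.comp f A.str n) = ev (f n) := by
  rw [ev_comp_fam_congr (fun _ => rfl) A.ev_str, comp_one f h0]

theorem ev_str_comp {W : Lab C} (A : AInfAlg C) (f : ∀ n, Pow A.V n ⟶ W) (n : ℕ) :
    ev (Abs.comp A.str f n) = ev (f n) := by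
  rw [ev_comp_fam_congr A.ev_str (fun _ => rfl), one_comp]

section Transport

variable (A : AInfAlg C) (τ : ∀ n, Pow A.V n ⟶ A.V) (h0 : τ 0 = 0) (h1 : lin τ = 𝟙 A.V)
  (ho : ∀ n, od (τ n) = 0)

/-- The structure transported along a unipotent family. -/
noncomputable def transportStr : ∀ n, Pow A.V n ⟶ A.V := Abs.comp (Abs.comp (rinv τ) A.str) τ

include h0 in
theorem transportStr_zero : transportStr A τ 0 = 0 := comp_zero' _ _ h0

include h0 h1 in
theorem transportStr_comp :
    Abs.comp (transportStr A τ) (rinv τ) = Abs.comp (rinv τ) A.str := by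
  rw [transportStr, Abs.comp_assoc _ _ _ (comp_zero' _ _ A.str_zero) h0, comp_rinv τ h0 h1,
    comp_one _ (comp_zero' _ _ A.str_zero)]

include h0 h1 in
theorem comp_transportStr : Abs.comp τ (transportStr A τ) = Abs.comp A.str τ := by
  rw [transportStr, ← Abs.comp_assoc _ _ _ h0 (comp_zero' _ _ A.str_zero),
    ← Abs.comp_assoc _ _ _ h0 (rinv_zero τ), comp_rinv τ h0 h1, one_comp]

include h0 h1 in
theorem ev_transportStr (n : ℕ) : ev (transportStr A τ n) = ev (one A.V n) := by
  rw [transportStr, ev_comp_fam_congr (fun n => ev_comp_str A _ (rinv_zero τ) n) (fun _ => rfl),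
    rinv_comp τ h0 h1]

-- The inverse of τ intertwines the conjugated structure with that of A and has the identity as
-- linear part, so the relations descend from A.
include h0 h1 ho in
theorem sqc_transportStr (n : ℕ) : sqc (transportStr A τ) n = 0 :=
  sqc_eq_zero_of_mono (ι := Unit) (transportStr A τ) (transportStr_zero A τ h0)
    (ev_transportStr A τ h0 h1) (fun _ => A.V) (fun _ => A.str) (fun _ => A.str_zero)
    (fun _ => A.sqc_str) (fun _ => rinv τ) (fun _ => rinv_zero τ) (fun _ => od_rinv τ ho)
    (fun _ => transportStr_comp A τ h0 h1) (fun M r x hx => by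
      have h2 := hx ()
      rw [lin_rinv] at h2
      exact eq_zero_of_comp_id x h2) n

/-- The algebra transported along a unipotent family. -/
noncomputable abbrev transport : AInfAlg C :=
  algOf A.obj (transportStr A τ) (transportStr_zero A τ h0) (ev_transportStr A τ h0 h1)
    (sqc_transportStr A τ h0 h1 ho)

theorem str_transport : (transport A τ h0 h1 ho).str = transportStr A τ := str_algOf _ _ _ _ _

/-- The morphism to a transported algebra. -/
noncomputable def toTransport : A ⟶ transport A τ h0 h1 ho :=
  homOf (B := transport A τ h0 h1 ho) τ h0 ho (by
    rw [str_transport]; exact (comp_transportStr A τ h0 h1).symm)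

/-- The morphism from a transported algebra. -/
noncomputable def ofTransport : transport A τ h0 h1 ho ⟶ A :=
  homOf (A := transport A τ h0 h1 ho) (rinv τ) (rinv_zero τ) (od_rinv τ ho) (by
    rw [str_transport]; exact transportStr_comp A τ h0 h1)

theorem fm_toTransport : fm (toTransport A τ h0 h1 ho) = τ := fm_homOf _ _ _ _

theorem fm_ofTransport : fm (ofTransport A τ h0 h1 ho) = rinv τ := fm_homOf _ _ _ _

/-- The isomorphism between an algebra and a transported one. -/
noncomputable def transportIso : A ≅ transport A τ h0 h1 ho where
  hom := toTransport A τ h0 h1 ho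
  inv := ofTransport A τ h0 h1 ho
  hom_inv_id := fm_ext (by
    rw [fm_comp, fm_toTransport, fm_ofTransport, fm_id]; exact comp_rinv τ h0 h1)
  inv_hom_id := fm_ext (by
    rw [fm_comp, fm_toTransport, fm_ofTransport, fm_id]; exact rinv_comp τ h0 h1)

theorem fm_transportIso_hom : fm (transportIso A τ h0 h1 ho).hom = τ := fm_toTransport _ _ _ _ _

theorem fm_transportIso_inv : fm (transportIso A τ h0 h1 ho).inv = rinv τ :=
  fm_ofTransport _ _ _ _ _

end Transport

/-- A morphism is strict when its components other than the linear one vanish. -/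
def IsStrict {A B : AInfAlg C} (f : A ⟶ B) : Prop := fm f = st (shf (linHom f))

theorem isStrict_of_eq {A B : AInfAlg C} {f : A ⟶ B} {l : A.V ⟶ B.V} (h : fm f = st l) :
    IsStrict f := by
  rw [IsStrict, ← lin_fm, h, lin_st]

/-- The higher components of i extend along the graded retraction to a unipotent family σ on B
through which i factors as its linear part followed by σ. Undoing σ on the target leaves only the
linear part. -/
theorem exists_iso_strict_right {A B : AInfAlg C} (i : A ⟶ B) (ρ : B.obj ⟶ A.obj)
    (hρ : linHom i ≫ ρ = 𝟙 _) : ∃ (B' : AInfAlg C) (e : B ≅ B'), IsStrict (i ≫ e.hom) := by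
  let ι := shf (linHom i)
  let r := shf ρ
  have hr : ι ≫ r = 𝟙 _ := by rw [shf_comp, hρ, shf_id]
  -- The family agrees with i on the image of ι and is the identity on the complement cut out by r;
  -- the summand 1 - rι makes the linear part exactly the identity.
  let σ : ∀ n, Pow B.V n ⟶ B.V := Abs.comp (st r) (fm i) + st (𝟙 _ - r ≫ ι)
  have h0 : σ 0 = 0 := by
    change Abs.comp (st r) (fm i) 0 + st _ 0 = 0
    rw [comp_zero' _ _ (fm_zero i), st_zero, add_zero]
  have h1 : lin σ = 𝟙 _ := by
    rw [lin_add, lin_comp, lin_st, lin_st, lin_fm]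
    exact add_sub_cancel _ _
  have ho : ∀ n, od (σ n) = 0 := od_fadd _ _
    (od_comp_fam _ _ (od_st _ rfl) (od_fm i)) (od_st _ (by
      rw [od_sub, od_comp_zero _ _ (od_shf _) (od_shf _)]
      exact sub_zero _))
  have hs : Abs.comp (st ι) σ = fm i := by
    have e1 : Abs.comp (st ι) (Abs.comp (st r) (fm i)) = fm i := by
      rw [← Abs.comp_assoc _ _ _ (st_zero _) (st_zero _), st_comp_st, hr, st_id, one_comp]
    have e2 : ι ≫ (𝟙 _ - r ≫ ι) = 0 := by
      rw [Preadditive.comp_sub, reassoc_of% hr, Category.comp_id, sub_self]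
    have e3 : Abs.comp (st ι) (st (𝟙 _ - r ≫ ι)) = 0 := by
      rw [st_comp_st, e2]
      exact funext fun _ => comp_zero
    change Abs.comp (st ι) (_ + _) = _
    rw [comp_add, e1, e3, add_zero]
  -- The isomorphism out of B has to be the inverse of σ, hence the transport along `rinv σ`.
  refine ⟨_, (transportIso B (rinv σ) (rinv_zero σ) (lin_rinv σ) (od_rinv σ ho)), ?_⟩
  refine isStrict_of_eq (l := ι) ?_
  rw [fm_comp, fm_transportIso_hom, ← hs]
  exact (Abs.comp_assoc _ _ _ (st_zero _) h0).trans
    ((congrArg _ (comp_rinv σ h0 h1)).trans (comp_one _ (st_zero _)))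

/-- The dual argument: the higher components of p lift through a graded section, so that p is a
unipotent family σ on E followed by a linear map. Conjugating the structure of E by σ makes p
linear. -/
theorem exists_iso_strict_left {E F : AInfAlg C} (p : E ⟶ F) (s : F.obj ⟶ E.obj)
    (hs : s ≫ linHom p = 𝟙 _) : ∃ (E' : AInfAlg C) (e : E' ≅ E), IsStrict (e.hom ≫ p) := by
  let π := shf (linHom p)
  let t := shf s
  have ht : t ≫ π = 𝟙 _ := by rw [shf_comp, hs, shf_id]
  -- Lift p through the section t and keep the identity on the kernel component; the linear part is
  -- then πt + (1 - πt) = 1.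
  let σ : ∀ n, Pow E.V n ⟶ E.V := post (fm p) t + st (𝟙 _ - π ≫ t)
  have h0 : σ 0 = 0 := by
    change post (fm p) t 0 + st _ 0 = 0
    rw [post_zero _ _ (fm_zero p), st_zero, add_zero]
  have h1 : lin σ = 𝟙 _ := by
    rw [lin_add, lin_post, lin_st, lin_fm]
    exact add_sub_cancel _ _
  have ho : ∀ n, od (σ n) = 0 := od_fadd _ _
    (od_post _ _ (od_fm p) rfl) (od_st _ (by
      rw [od_sub, od_comp_zero _ _ (od_shf _) (od_shf _)]
      exact sub_zero _))
  have hs : Abs.comp σ (st π) = fm p := by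
    have e2 : (𝟙 _ - π ≫ t) ≫ π = 0 := by
      rw [Preadditive.sub_comp, Category.assoc, ht, Category.comp_id, Category.id_comp, sub_self]
    rw [comp_st _ h0]
    change post (_ + _) π = _
    rw [post_add, post_post, ht, post_id, post_st, e2]
    exact (congrArg _ (funext fun _ => comp_zero)).trans (add_zero _)
  refine ⟨_, (transportIso E σ h0 h1 ho).symm, ?_⟩
  refine isStrict_of_eq (l := π) ?_
  rw [fm_comp, Iso.symm_hom, fm_transportIso_inv, ← hs]
  exact (Abs.comp_assoc _ _ _ (rinv_zero _) h0).symm.trans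
    ((congrArg (fun x => Abs.comp x (st π)) (rinv_comp σ h0 h1)).trans (one_comp _))

end

end AInf

namespace AInf

/-! ### Fibre products along strict split epimorphisms. -/

section

variable {C : Type u} [Category.{v} C] [Preadditive C] [HasFiniteBiproducts C]
  [MonoidalCategory C] [MonoidalPreadditive C] [HasColimits C]
  [∀ X : C, PreservesFilteredColimits (tensorLeft X)]
  [∀ X : C, PreservesFilteredColimits (tensorRight X)]

open Abs Lab

theorem post_eq_of_add {V W U T : Lab C} {f g : ∀ n, Pow V n ⟶ W} {a : W ⟶ U} {a' : U ⟶ W}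
    {b : W ⟶ T} {b' : T ⟶ W} (h : a ≫ a' + b ≫ b' = 𝟙 W) (ha : post f a = post g a)
    (hb : post f b = post g b) : f = g := by
  rw [← post_id f, ← post_id g, ← h]
  funext n
  have h1 := congrFun ha n
  have h2 := congrFun hb n
  simp only [post] at h1 h2 ⊢
  rw [Preadditive.comp_add, Preadditive.comp_add, reassoc_of% h1, reassoc_of% h2]

theorem ev_post_congr {V W U : Lab C} {f g : ∀ n, Pow V n ⟶ W} (h : ∀ n, ev (f n) = ev (g n))
    (l : W ⟶ U) (n : ℕ) : ev (post f l n) = ev (post g l n) := by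
  rw [post, post, ev_comp, ev_comp, h]

/-- A complement of the kernel of a split epimorphism. -/
structure SplitData (E B K : GradedObject ℤ C) where
  π : E ⟶ B
  s : B ⟶ E
  κ : E ⟶ K
  j : K ⟶ E
  sπ : shf s ≫ shf π = 𝟙 _
  jκ : shf j ≫ shf κ = 𝟙 _
  sκ : shf s ≫ shf κ = 0
  jπ : shf j ≫ shf π = 0
  add : shf π ≫ shf s + shf κ ≫ shf j = 𝟙 _

section Pullback

variable {E B X : AInfAlg C} {K : GradedObject ℤ C} (q : E ⟶ B) (f : X ⟶ B)
  (S : SplitData E.obj B.obj K) (hq : fm q = st (shf S.π))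
  {P : GradedObject ℤ C} (T : SplitData P X.obj K)

/-- The projection to the total space. -/
noncomputable def pbTop : ∀ n, Pow (sV P) n ⟶ E.V :=
  post (Abs.comp (st (shf T.π)) (fm f)) (shf S.s) + st (shf T.κ ≫ shf S.j)

theorem pbTop_zero : pbTop f S T 0 = 0 := by
  rw [pbTop, Pi.add_apply, st_zero, add_zero]
  exact post_zero _ _ (comp_zero' _ _ (fm_zero f))

theorem od_pbTop (n : ℕ) : od (pbTop f S T n) = 0 :=
  od_fadd _ _ (od_post _ _ (od_comp_fam _ _ (od_st _ rfl) (od_fm f)) rfl)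
    (od_st _ (od_comp_zero _ _ rfl rfl)) n

/-- The family `pbTop` is prescribed by its two components in the splitting of E: over B it must be
f after the projection to X, and in the kernel direction it is the linear projection to K. -/
theorem post_pbTop_π : post (pbTop f S T) (shf S.π) = Abs.comp (st (shf T.π)) (fm f) := by
  rw [pbTop, post_add, post_post, S.sπ, post_id, post_st, Category.assoc, S.jπ, comp_zero]
  exact (congrArg _ (funext fun _ => comp_zero)).trans (add_zero _)

theorem post_pbTop_κ : post (pbTop f S T) (shf S.κ) = st (shf T.κ) := by
  rw [pbTop, post_add, post_post, S.sκ, post_st, Category.assoc, S.jκ, Category.comp_id]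
  exact (congrArg (· + _) (funext fun _ => comp_zero)).trans (zero_add _)

/-- The structure on the fibre product. -/
noncomputable def pbStr : ∀ n, Pow (sV P) n ⟶ sV P :=
  post (Abs.comp (st (shf T.π)) X.str) (shf T.s) +
    post (post (Abs.comp (pbTop f S T) E.str) (shf S.κ)) (shf T.j)

theorem pbStr_zero : pbStr f S T 0 = 0 := by
  exact (congrArg₂ (· + ·) (post_zero _ _ (comp_zero' _ _ X.str_zero))
    (post_zero _ _ (post_zero _ _ (comp_zero' _ _ E.str_zero)))).trans (add_zero _)

theorem post_pbStr_π : post (pbStr f S T) (shf T.π) = Abs.comp (st (shf T.π)) X.str := by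
  rw [pbStr, post_add, post_post, T.sπ, post_id, post_post, T.jπ]
  exact (congrArg _ (funext fun _ => comp_zero)).trans (add_zero _)

theorem post_pbStr_κ : post (pbStr f S T) (shf T.κ) =
    post (Abs.comp (pbTop f S T) E.str) (shf S.κ) := by
  rw [pbStr, post_add, post_post, T.sκ, post_post _ (shf T.j), T.jκ, post_id]
  exact (congrArg (· + _) (funext fun _ => comp_zero)).trans (zero_add _)

-- The equation splits into components. In the kernel direction it is the definition of `pbStr`.
-- Over B strictness of q turns composition with q into composition with π, and the equation follows
-- from f and q being morphisms.
include hq in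
theorem pbStr_comp_pbTop : Abs.comp (pbStr f S T) (pbTop f S T) =
    Abs.comp (pbTop f S T) E.str := by
  refine post_eq_of_add S.add ?_ ?_
  · rw [← comp_post, ← comp_post, post_pbTop_π, ← Abs.comp_assoc _ _ _ (pbStr_zero f S T)
      (st_zero _), comp_st _ (pbStr_zero f S T), post_pbStr_π,
      Abs.comp_assoc _ _ _ (st_zero _) X.str_zero, fm_comm,
      ← comp_st _ E.str_zero, ← hq, fm_comm, hq,
      ← Abs.comp_assoc _ _ _ (pbTop_zero f S T) (st_zero _), comp_st _ (pbTop_zero f S T),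
      post_pbTop_π, Abs.comp_assoc _ _ _ (st_zero _) (fm_zero f)]
  · rw [← comp_post, post_pbTop_κ, comp_st _ (pbStr_zero f S T), post_pbStr_κ]

theorem ev_pbStr (n : ℕ) : ev (pbStr f S T n) = ev (one (sV P) n) := by
  have h1 : ∀ n, ev (pbStr f S T n) = ev ((post (st (shf T.π)) (shf T.s) +
      post (post (pbTop f S T) (shf S.κ)) (shf T.j)) n) := by
    intro n
    rw [pbStr, Pi.add_apply, Pi.add_apply, ev_add, ev_add,
      ev_post_congr (ev_comp_str X _ (st_zero _)),
      ev_post_congr (ev_post_congr (ev_comp_str E _ (pbTop_zero f S T)) _)]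
  rw [h1, post_pbTop_κ, post_st, post_st, ← st_id, ← T.add]
  exact congrArg ev (Preadditive.comp_add _ _ _ (one (sV P) n) _ _).symm

theorem lin_pbTop : lin (pbTop f S T) ≫ shf S.κ = shf T.κ := by
  rw [← lin_post, post_pbTop_κ, lin_st]

theorem eq_zero_of_split {E B K M : GradedObject ℤ C} (T : SplitData E B K) {r : ℤ}
    (x : GHom M E r) (h1 : GHom.comp x (ev (shf T.π)) rfl = 0)
    (h2 : GHom.comp x (ev (shf T.κ)) rfl = 0) : x = 0 := by
  refine eq_zero_of_comp_id (X := sV E) x ?_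
  rw [← T.add, ev_add, ev_comp, ev_comp, GHom.comp_add,
    ← GHom.comp_assoc (bc := (sV E).deg - (sV E).deg) _ _ _ rfl (by ring) (by ring),
    ← GHom.comp_assoc (bc := (sV E).deg - (sV E).deg) _ _ _ rfl (by ring) (by ring), h1, h2,
    GHom.zero_comp, GHom.zero_comp, add_zero]

-- The projections to X and to E intertwine `pbStr` with structures satisfying the relations, and
-- their linear parts are jointly monic: the first sees the X-summand, the second followed by κ sees
-- the K-summand.
include hq in
theorem sqc_pbStr (n : ℕ) : sqc (pbStr f S T) n = 0 :=
  sqc_eq_zero_of_mono (ι := Bool) (pbStr f S T) (pbStr_zero f S T) (ev_pbStr f S T)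
    (fun b => Bool.rec X.V E.V b)
    (fun b => Bool.rec X.str E.str b) (fun b => by cases b; exacts [X.str_zero, E.str_zero])
    (fun b => by cases b; exacts [X.sqc_str, E.sqc_str])
    (fun b => Bool.rec (st (shf T.π)) (pbTop f S T) b)
    (fun b => by cases b; exacts [st_zero _, pbTop_zero f S T])
    (fun b => by cases b; exacts [od_st _ rfl, od_pbTop f S T])
    (fun b => by
      cases b
      · exact (comp_st _ (pbStr_zero f S T) _).trans (post_pbStr_π f S T)
      · exact pbStr_comp_pbTop q f S hq T)
    (fun M r x hx => by
      have h1 : GHom.comp x (ev (lin (st (shf T.π)))) rfl = 0 := hx false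
      have h2 : GHom.comp x (ev (lin (pbTop f S T))) rfl = 0 := hx true
      rw [lin_st] at h1
      refine eq_zero_of_split T x h1 ?_
      rw [← lin_pbTop f S T, ev_comp, ← GHom.comp_assoc _ _ _ rfl (by ring) (by ring), h2,
        GHom.zero_comp]) n

/-- The fibre product of a strict split epimorphism along a morphism. -/
noncomputable abbrev pb : AInfAlg C :=
  algOf P (pbStr f S T) (pbStr_zero f S T) (ev_pbStr f S T) (sqc_pbStr q f S hq T)

theorem str_pb : (pb q f S hq T).str = pbStr f S T := str_algOf _ _ _ _ _

/-- The projection of the fibre product to the total space. -/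
noncomputable def pbFst : pb q f S hq T ⟶ E :=
  homOf (A := pb q f S hq T) (pbTop f S T) (pbTop_zero f S T) (od_pbTop f S T) (by
    rw [str_pb]; exact pbStr_comp_pbTop q f S hq T)

/-- The projection of the fibre product to the new base. -/
noncomputable def pbSnd : pb q f S hq T ⟶ X :=
  homOf (A := pb q f S hq T) (st (shf T.π)) (st_zero _) (od_st _ rfl) (by
    rw [str_pb]; exact (comp_st _ (pbStr_zero f S T) _).trans (post_pbStr_π f S T))

theorem fm_pbFst : fm (pbFst q f S hq T) = pbTop f S T := fm_homOf _ _ _ _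

theorem fm_pbSnd : fm (pbSnd q f S hq T) = st (shf T.π) := fm_homOf _ _ _ _

theorem pb_condition : pbFst q f S hq T ≫ q = pbSnd q f S hq T ≫ f := by
  apply fm_ext
  rw [fm_comp, fm_comp, fm_pbFst, fm_pbSnd, hq]
  exact (comp_st _ (pbTop_zero f S T) _).trans (post_pbTop_π f S T)

section Lift

variable {Z : AInfAlg C} (c : Z ⟶ E) (a : Z ⟶ X) (h : c ≫ q = a ≫ f)

/-- The family of the morphism to the fibre product. -/
noncomputable def pbLiftFam : ∀ n, Pow Z.V n ⟶ sV P :=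
  post (fm a) (shf T.s) + post (post (fm c) (shf S.κ)) (shf T.j)

theorem pbLiftFam_zero : pbLiftFam S T c a 0 = 0 := by
  exact (congrArg₂ (· + ·) (post_zero _ _ (fm_zero a))
    (post_zero _ _ (post_zero _ _ (fm_zero c)))).trans (add_zero _)

theorem post_pbLiftFam_π : post (pbLiftFam S T c a) (shf T.π) = fm a := by
  rw [pbLiftFam, post_add, post_post, T.sπ, post_id, post_post, T.jπ]
  exact (congrArg _ (funext fun _ => comp_zero)).trans (add_zero _)

theorem post_pbLiftFam_κ : post (pbLiftFam S T c a) (shf T.κ) = post (fm c) (shf S.κ) := by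
  rw [pbLiftFam, post_add, post_post, T.sκ, post_post _ (shf T.j), T.jκ, post_id]
  exact (congrArg (· + _) (funext fun _ => comp_zero)).trans (zero_add _)

-- Over B the two sides agree by the commutativity of the square, which is linear in c because q is
-- strict; in the kernel direction the agreement is built into `pbLiftFam`.
include hq h in
theorem pbLiftFam_comp_pbTop : Abs.comp (pbLiftFam S T c a) (pbTop f S T) = fm c := by
  have h' := congrArg fm h
  rw [fm_comp, fm_comp, hq, comp_st _ (fm_zero c)] at h'
  refine post_eq_of_add S.add ?_ ?_
  · rw [← comp_post, post_pbTop_π, ← Abs.comp_assoc _ _ _ (pbLiftFam_zero S T c a) (st_zero _),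
      comp_st _ (pbLiftFam_zero S T c a), post_pbLiftFam_π, h']
  · rw [← comp_post, post_pbTop_κ, comp_st _ (pbLiftFam_zero S T c a), post_pbLiftFam_κ]

include hq h in
theorem pbLiftFam_comm : Abs.comp Z.str (pbLiftFam S T c a) =
    Abs.comp (pbLiftFam S T c a) (pbStr f S T) := by
  refine post_eq_of_add T.add ?_ ?_
  · rw [← comp_post, ← comp_post, post_pbLiftFam_π, post_pbStr_π,
      ← Abs.comp_assoc _ _ _ (pbLiftFam_zero S T c a) (st_zero _),
      comp_st _ (pbLiftFam_zero S T c a), post_pbLiftFam_π, fm_comm]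
  · rw [← comp_post, ← comp_post, post_pbLiftFam_κ, post_pbStr_κ, comp_post, comp_post,
      ← Abs.comp_assoc _ _ _ (pbLiftFam_zero S T c a) (pbTop_zero f S T),
      pbLiftFam_comp_pbTop q f S hq T c a h, fm_comm]

/-- The morphism to the fibre product. -/
noncomputable def pbLift : Z ⟶ pb q f S hq T :=
  homOf (B := pb q f S hq T) (pbLiftFam S T c a) (pbLiftFam_zero S T c a)
    (od_fadd _ _ (od_post _ _ (od_fm a) rfl) (od_post _ _ (od_post _ _ (od_fm c) rfl) rfl)) (by
    rw [str_pb]; exact pbLiftFam_comm q f S hq T c a h)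

theorem fm_pbLift : fm (pbLift q f S hq T c a h) = pbLiftFam S T c a := fm_homOf _ _ _ _

theorem pbLift_fst : pbLift q f S hq T c a h ≫ pbFst q f S hq T = c := by
  apply fm_ext
  rw [fm_comp, fm_pbLift, fm_pbFst]
  exact pbLiftFam_comp_pbTop q f S hq T c a h

theorem pbLift_snd : pbLift q f S hq T c a h ≫ pbSnd q f S hq T = a := by
  apply fm_ext
  rw [fm_comp, fm_pbLift, fm_pbSnd]
  exact (comp_st _ (pbLiftFam_zero S T c a) _).trans (post_pbLiftFam_π S T c a)

end Lift

/-- The component in the direction of X is the composite with the second projection. The component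
in the direction of K is recovered from the composite with the first one, as `pbTop` followed by κ
is linear. -/
theorem pb_hom_ext {Z : AInfAlg C} {k l : Z ⟶ pb q f S hq T}
    (h1 : k ≫ pbFst q f S hq T = l ≫ pbFst q f S hq T)
    (h2 : k ≫ pbSnd q f S hq T = l ≫ pbSnd q f S hq T) : k = l := by
  apply fm_ext
  have h1 := congrArg fm h1
  have h2 := congrArg fm h2
  rw [fm_comp, fm_comp, fm_pbFst] at h1
  rw [fm_comp, fm_comp, fm_pbSnd] at h2
  have hk : ∀ k : Z ⟶ pb q f S hq T, post (Abs.comp (fm k) (pbTop f S T)) (shf S.κ) =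
      post (fm k) (shf T.κ) := fun k => by
    rw [← comp_post, post_pbTop_κ]
    exact comp_st _ (fm_zero k) _
  refine post_eq_of_add T.add ?_ ?_
  · exact (comp_st _ (fm_zero k) _).symm.trans (h2.trans (comp_st _ (fm_zero l) _))
  · rw [← hk k, ← hk l]
    exact congrArg (fun x => post x (shf S.κ)) h1

include S hq T in
theorem hasPullback_of_strict : HasPullback q f :=
  ⟨⟨⟨PullbackCone.mk (pbFst q f S hq T) (pbSnd q f S hq T) (pb_condition q f S hq T),
    PullbackCone.IsLimit.mk _ (fun s => pbLift q f S hq T s.fst s.snd s.condition)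
      (fun _ => pbLift_fst q f S hq T _ _ _) (fun _ => pbLift_snd q f S hq T _ _ _)
      (fun _ _ h1 h2 => pb_hom_ext q f S hq T (h1.trans (pbLift_fst q f S hq T _ _ _).symm)
        (h2.trans (pbLift_snd q f S hq T _ _ _).symm))⟩⟩⟩

end Pullback

end

end AInf

namespace AInf

/-! ### Obstruction theory for lifts. -/

section

variable {C : Type u} [Category.{v} C] [Preadditive C] [HasFiniteBiproducts C]
  [MonoidalCategory C] [MonoidalPreadditive C] [HasColimits C]
  [∀ X : C, PreservesFilteredColimits (tensorLeft X)]
  [∀ X : C, PreservesFilteredColimits (tensorRight X)]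

open Abs Lab

theorem sub_oo {X Y Z : Lab C} (f f' : X ⟶ Y) (g : Y ⟶ Z) : oo (f - f') g = oo f g - oo f' g := by
  rw [eq_sub_iff_add_eq, ← add_oo, sub_add_cancel]

section Obstruction

variable {B E : AInfAlg C} (g : ∀ n, Pow B.V n ⟶ E.V)

/-- The defect of a family from being a morphism. -/
noncomputable def defect (n : ℕ) : Pow B.V n ⟶ E.V :=
  Abs.comp B.str g n - Abs.comp g E.str n

theorem ev_defect (g0 : g 0 = 0) (n : ℕ) : ev (defect g n) = 0 := by
  rw [defect, ev_sub, ev_str_comp, ev_comp_str _ _ g0, sub_self]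

theorem oo_F_one (k : ∀ n, Pow B.V n ⟶ E.V) (n : ℕ) :
    oo (F k 1 n) (E.str 1) = oo (k n) (lin E.str) := by
  rw [F_one, lin]
  exact (oo_even_mid _ _ _ rfl).symm

/-- With structure coderivations D on B and D' on E, both of square zero, the defect Dg - gD'
anticommutes with them in the sense D(Dg - gD') + (Dg - gD')D' = 0. In the lowest arity where the
defect is not zero, only the linear parts of D and D' contribute. The sign is a plus because the
defect is odd. -/
theorem defect_cocycle (g0 : g 0 = 0) (hg : ∀ n, od (g n) = 0) (n : ℕ) (hn : n ≠ 0)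
    (h : ∀ k < n, defect g k = 0) :
    oo (tpow (lin B.str) n) (defect g n) + oo (defect g n) (lin E.str) = 0 := by
  have h1 := sum_oo_comp B.str B.str_zero g hg n
  rw [Finset.sum_eq_zero (s := Finset.range (n + 1)) (f := fun s => GHom.comp _ _ _) fun s _ => ?_]
    at h1
  swap
  · rw [sq_eq_zero _ B.str_zero B.ev_str B.sqc_str, GHom.zero_comp]
  have h2 := sum_oo_comp' B.str B.str_zero g g0 hg E.str n
  have h3 := sum_oo_comp'' g g0 hg E.str E.str_zero n
  rw [Finset.sum_eq_zero (s := Finset.range (n + 1)) (f := fun r => GHom.comp _ _ _) fun s _ => ?_]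
    at h3
  swap
  · rw [E.sqc_str, GHom.comp_zero]
  have hl : ∑ r ∈ Finset.range (n + 1), oo (F B.str r n) (defect g r) =
      oo (tpow (lin B.str) n) (defect g n) := by
    rw [Finset.sum_eq_single n, F_diag _ B.str_zero]
    · intro r hr hrn
      rw [Finset.mem_range] at hr
      rw [h r (by omega)]
      exact oo_zero_right _ _ rfl
    · intro h'
      exact absurd (Finset.mem_range.2 (Nat.lt_succ_self n)) h'
  have hr : ∑ s ∈ Finset.range (n + 1), (oo (F (Abs.comp B.str g) s n) (E.str s) -
      oo (F (Abs.comp g E.str) s n) (E.str s)) = oo (defect g n) (lin E.str) := by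
    rw [Finset.sum_eq_single 1, oo_F_one, oo_F_one, ← sub_oo]
    · rfl
    · intro s _ hs
      rcases Nat.eq_zero_or_pos s with rfl | hs0
      · rw [F_zero_ne _ hn, F_zero_ne _ hn, sub_self]
      -- For s ≥ 2 only the components of arity below n enter, and there the two composites agree
      -- because the lower defects vanish.
      rw [F_congr (Abs.comp B.str g) (Abs.comp g E.str) (comp_zero' _ _ g0)
        (comp_zero' _ _ E.str_zero) s n fun k hk => sub_eq_zero.1 (h k (by omega)), sub_self]
    · intro h'
      exact absurd (Finset.mem_range.2 (by omega)) h'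
  rw [← hl, ← hr, Finset.sum_sub_distrib, h3, sub_zero, ← h2, ← Finset.sum_add_distrib]
  refine (Finset.sum_congr rfl fun r _ => ?_).trans h1
  rw [← oo_add, defect, sub_add_cancel]

/-- A new component of arity n enters the defect of arity n only through the diagonal entry of B and
the linear part of the structure of E. So the defect changes by the boundary of c. -/
theorem defect_update (g' : ∀ n, Pow B.V n ⟶ E.V) (g0 : g 0 = 0) (g0' : g' 0 = 0) (n : ℕ)
    (c : Pow B.V n ⟶ E.V) (hc : g' n = g n + c) (h : ∀ k < n, g' k = g k) :
    defect g' n = defect g n + (tpow (lin B.str) n ≫ c - c ≫ lin E.str) := by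
  rcases Nat.eq_zero_or_pos n with rfl | hn
  · obtain rfl : c = 0 := by rw [g0', g0, zero_add] at hc; exact hc.symm
    rw [defect, defect, comp_apply_zero _ _ g0, comp_apply_zero _ _ g0',
      comp_apply_zero _ _ E.str_zero, comp_apply_zero _ _ E.str_zero, comp_zero, zero_comp]
    simp
  have h1 : Abs.comp B.str g' n = Abs.comp B.str g n + tpow (lin B.str) n ≫ c := by
    rw [Abs.comp, Abs.comp, Finset.sum_range_succ, Finset.sum_range_succ _ n, hc,
      Preadditive.comp_add, F_diag _ B.str_zero, ← add_assoc]
    congr 2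
    exact Finset.sum_congr rfl fun r hr => by rw [h r (Finset.mem_range.1 hr)]
  have h2 : Abs.comp g' E.str n = Abs.comp g E.str n + c ≫ lin E.str := by
    rw [← sub_eq_iff_eq_add', Abs.comp, Abs.comp, ← Finset.sum_sub_distrib,
      Finset.sum_eq_single 1]
    · rw [F_one, F_one, ← Preadditive.sub_comp, ← Preadditive.sub_comp, hc, add_sub_cancel_left,
        Category.assoc]
      rfl
    · intro s _ hs
      rcases Nat.eq_zero_or_pos s with rfl | hs0
      · rw [F_zero_ne _ hn.ne', F_zero_ne _ hn.ne', sub_self]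
      rw [F_congr g' g g0' g0 s n fun k hk => h k (by omega), sub_self]
    · intro h'
      exact absurd (Finset.mem_range.2 (by omega)) h'
  rw [defect, defect, h1, h2]
  abel

end Obstruction

section Lifting

variable {A B E F : AInfAlg C} {i : A ⟶ B} {p : E ⟶ F} {u : A ⟶ E} {v : B ⟶ F}
  {ι : A.obj ⟶ B.obj} {π : E.obj ⟶ F.obj}

/-- The obstructions to lifting in arity `n` vanish. -/
def Solvable (B E : AInfAlg C) {M N : GradedObject ℤ C} (ι : M ⟶ B.obj) (π : E.obj ⟶ N) (n : ℕ) :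
    Prop :=
  ∀ x : Pow B.V n ⟶ E.V, ev x = 0 →
    oo (tpow (lin B.str) n) x + oo x (lin E.str) = 0 → tpow (shf ι) n ≫ x = 0 → x ≫ shf π = 0 →
    ∃ c : Pow B.V n ⟶ E.V, od c = 0 ∧ tpow (shf ι) n ≫ c = 0 ∧ c ≫ shf π = 0 ∧
      x + (tpow (lin B.str) n ≫ c - c ≫ lin E.str) = 0

/-- The families that lift a square and are morphisms up to arity `n`. -/
structure PartialLift (u : A ⟶ E) (v : B ⟶ F) (ι : A.obj ⟶ B.obj) (π : E.obj ⟶ F.obj)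
    (g : ∀ n, Pow B.V n ⟶ E.V) (n : ℕ) : Prop where
  zero : g 0 = 0
  od_eq : ∀ k, od (g k) = 0
  left : ∀ k, tpow (shf ι) k ≫ g k = fm u k
  right : ∀ k, g k ≫ shf π = fm v k
  defect_eq : ∀ k < n, defect g k = 0

/-- As i and p are strict, restriction along i and projection along p act on each arity separately.
Since u and v are morphisms, the defect vanishes on A^{⊗n} and over F, so it is an obstruction of
the kind that `Solvable` kills, and the correction disturbs neither side condition. -/
theorem PartialLift.exists_succ (hi : fm i = st (shf ι)) (hp : fm p = st (shf π))
    {g : ∀ n, Pow B.V n ⟶ E.V} {n : ℕ}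
    (h : PartialLift u v ι π g n) (hn : n ≠ 0) (hs : Solvable B E ι π n) :
    ∃ g', PartialLift u v ι π g' (n + 1) ∧ ∀ k < n, g' k = g k := by
  classical
  have h1 : Abs.comp (st (shf ι)) g = fm u := funext fun k => (st_comp _ _ _).trans (h.left k)
  have h2 : Abs.comp g (st (shf π)) = fm v := (comp_st _ h.zero _).trans (funext h.right)
  obtain ⟨c, hc, hιc, hcπ, hx⟩ := hs (defect g n) (ev_defect g h.zero n)
    (defect_cocycle g h.zero h.od_eq n hn h.defect_eq) (by
      rw [defect, Preadditive.comp_sub, ← st_comp, ← st_comp,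
        ← Abs.comp_assoc _ _ _ (st_zero _) B.str_zero, ← Abs.comp_assoc _ _ _ (st_zero _) h.zero,
        h1, ← hi, ← fm_comm, hi, Abs.comp_assoc _ _ _ A.str_zero (st_zero _), h1, fm_comm,
        sub_self]) (by
      have h3 := congrFun (comp_st (Abs.comp B.str g) (comp_zero' _ _ h.zero) (shf π)) n
      have h4 := congrFun (comp_st (Abs.comp g E.str) (comp_zero' _ _ E.str_zero) (shf π)) n
      rw [Abs.comp_assoc _ _ _ B.str_zero h.zero, h2] at h3
      rw [Abs.comp_assoc _ _ _ h.zero E.str_zero, ← hp, fm_comm, hp,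
        ← Abs.comp_assoc _ _ _ h.zero (st_zero _), h2] at h4
      rw [defect, Preadditive.sub_comp]
      refine (congrArg₂ (· - ·) h3 h4).symm.trans ?_
      rw [fm_comm, sub_self])
  -- Only the component of arity n is altered, so the defects in lower arities are untouched.
  have hlt : ∀ k < n, Function.update g n (g n + c) k = g k := fun k hk =>
    Function.update_of_ne (by omega) _ _
  have hz : Function.update g n (g n + c) 0 = 0 := (hlt 0 (by omega)).trans h.zero
  refine ⟨Function.update g n (g n + c), ⟨hz, ?_, ?_, ?_, ?_⟩, hlt⟩
  · intro k
    by_cases hk : k = n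
    · subst hk
      rw [Function.update_self, od_add, h.od_eq, hc, add_zero]
    · rw [Function.update_of_ne hk, h.od_eq]
  · intro k
    by_cases hk : k = n
    · subst hk
      rw [Function.update_self, Preadditive.comp_add, hιc, add_zero, h.left]
    · rw [Function.update_of_ne hk, h.left]
  · intro k
    by_cases hk : k = n
    · subst hk
      rw [Function.update_self, Preadditive.add_comp, hcπ, add_zero, h.right]
    · rw [Function.update_of_ne hk, h.right]
  · intro k hk
    by_cases hk' : k = n
    · subst hk'
      rw [defect_update g _ h.zero hz k c (Function.update_self _ _ _) hlt, hx]
    · have hd := h.defect_eq k (by omega)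
      rw [defect] at hd ⊢
      rw [← hd]
      congr 1
      · exact comp_congr k B.str_zero B.str_zero (fun _ _ => rfl) fun j hj => hlt j (by omega)
      · exact comp_congr k hz h.zero (fun j hj => hlt j (by omega)) fun _ _ => rfl

/-- The successive corrections are stationary in each arity, so they have a limit. The starting
arity n is left free because one factorization needs a lift with a prescribed linear part. -/
theorem exists_lift (hi : fm i = st (shf ι)) (hp : fm p = st (shf π))
    {g : ∀ n, Pow B.V n ⟶ E.V} {n : ℕ} (h : PartialLift u v ι π g n) (hn : n ≠ 0)
    (hs : ∀ k, n ≤ k → Solvable B E ι π k) :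
    ∃ l : B ⟶ E, i ≫ l = u ∧ l ≫ p = v ∧ ∀ k < n, fm l k = g k := by
  choose s hs1 hs2 using fun (j : ℕ) (g : {g // PartialLift u v ι π g (n + j)}) =>
    g.2.exists_succ hi hp (by omega) (hs _ (by omega))
  let G : ∀ j : ℕ, {g // PartialLift u v ι π g (n + j)} := fun j =>
    Nat.rec (motive := fun j => {g // PartialLift u v ι π g (n + j)}) ⟨g, h⟩
      (fun j x => ⟨s j x, hs1 j x⟩) j
  have hG0 : (G 0).1 = g := rfl
  have hG : ∀ j k, k < n + j → (G (j + 1)).1 k = (G j).1 k := fun j k hk => hs2 j (G j) k hk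
  have hG' : ∀ j m k, k < n + j → (G (j + m)).1 k = (G j).1 k := by
    intro j m k hk
    induction m with
    | zero => rfl
    | succ m ih => exact (hG (j + m) k (by omega)).trans ih
  -- Stage j has its final components in all arities below n + j. As n is positive, the component of
  -- arity k may be read at stage k.
  have hd : ∀ k j, k < n + j → (G j).1 k = (G k).1 k := by
    intro k j hk
    have h1 : ∀ a b, a = b → (G a).1 k = (G b).1 k := fun a b hab => by subst hab; rfl
    rw [← hG' j k k hk, h1 _ _ (add_comm j k), hG' k j k (by omega)]
  let L : ∀ k, Pow B.V k ⟶ E.V := fun k => (G k).1 k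
  have hL0 : L 0 = 0 := (G 0).2.zero
  have hc : Abs.comp B.str L = Abs.comp L E.str := by
    funext k
    have h1 := (G (k + 1)).2.defect_eq k (by omega)
    rw [defect, sub_eq_zero] at h1
    refine (comp_congr k B.str_zero B.str_zero (fun _ _ => rfl) fun j hj => ?_).trans
      (h1.trans (comp_congr k (G (k + 1)).2.zero hL0 (fun j hj => ?_) fun _ _ => rfl))
    · exact (hd j (k + 1) (by omega)).symm
    · exact hd j (k + 1) (by omega)
  refine ⟨homOf L hL0 (fun k => (G k).2.od_eq k) hc, fm_ext ?_, fm_ext ?_, fun k hk => ?_⟩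
  · rw [fm_comp, fm_homOf, hi]
    exact funext fun k => (st_comp _ _ _).trans ((G k).2.left k)
  · rw [fm_comp, fm_homOf, hp, comp_st _ hL0]
    exact funext fun k => (G k).2.right k
  · rw [fm_homOf, ← hG0]
    exact (hd k 0 (by omega)).symm

/-- The initial family for the lifting of a square. -/
noncomputable def startFam (u : A ⟶ E) (v : B ⟶ F) (π : E.obj ⟶ F.obj) (ρ : B.obj ⟶ A.obj)
    (s : F.obj ⟶ E.obj) (n : ℕ) : Pow B.V n ⟶ E.V :=
  tpow (shf ρ) n ≫ fm u n + (fm v n - tpow (shf ρ) n ≫ fm u n ≫ shf π) ≫ shf s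

theorem od_tpow {V W : Lab C} (l : V ⟶ W) (hl : od l = 0) : ∀ n, od (tpow l n) = 0
  | 0 => rfl
  | n + 1 => od_tens_zero _ _ hl (od_tpow l hl n)

/-- The extension of u along the graded retraction has the correct restriction; adding the section
applied to the error over F gives the correct projection. The error vanishes on A^{⊗n} because the
square commutes, so the restriction is not spoiled. -/
theorem startFam_partialLift (hi : fm i = st (shf ι)) (hp : fm p = st (shf π))
    (w : u ≫ p = i ≫ v) (ρ : B.obj ⟶ A.obj) (s : F.obj ⟶ E.obj) (hρ : ι ≫ ρ = 𝟙 _)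
    (hs : s ≫ π = 𝟙 _) : PartialLift u v ι π (startFam u v π ρ s) 1 := by
  have hw : ∀ n, fm u n ≫ shf π = tpow (shf ι) n ≫ fm v n := by
    intro n
    have h := congrArg fm w
    rw [fm_comp, fm_comp, hi, hp, comp_st _ (fm_zero u)] at h
    exact (congrFun h n).trans (st_comp _ _ _)
  have hρ' : ∀ n, tpow (shf ι) n ≫ tpow (shf ρ) n = 𝟙 _ := fun n => by
    rw [tpow_comp, shf_comp, hρ]
    exact tpow_id n
  have hs' : shf s ≫ shf π = 𝟙 _ := by rw [shf_comp, hs]; rfl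
  have hz : startFam u v π ρ s 0 = 0 := by
    rw [startFam, fm_zero, fm_zero]
    simp
  refine ⟨hz, ?_, ?_, ?_, ?_⟩
  · intro k
    have h1 : od (tpow (shf ρ) k ≫ fm u k) = 0 := od_comp_zero _ _ (od_tpow _ rfl k) (od_fm u k)
    rw [startFam, od_add, h1, zero_add]
    refine od_comp_zero _ _ ?_ rfl
    rw [od_sub, od_fm, ← Category.assoc, od_comp_zero _ _ h1 rfl, sub_self]
  · intro k
    rw [startFam, Preadditive.comp_add, Preadditive.sub_comp, Preadditive.comp_sub,
      reassoc_of% (hρ' k)]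
    simp only [Category.assoc]
    rw [reassoc_of% (hρ' k), reassoc_of% (hw k), sub_self, add_zero]
  · intro k
    rw [startFam, Preadditive.add_comp, Category.assoc, Category.assoc, hs', Category.comp_id]
    abel
  · intro k hk
    obtain rfl : k = 0 := by omega
    rw [defect, comp_apply_zero _ _ hz, comp_apply_zero _ _ E.str_zero, sub_self]

end Lifting

end

end AInf

namespace AInf

/-! ### Homotopies on tensor powers and the solution of obstructions. -/

section

variable {C : Type u} [Category.{v} C] [Preadditive C] [HasFiniteBiproducts C]
  [MonoidalCategory C] [MonoidalPreadditive C] [HasColimits C]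
  [∀ X : C, PreservesFilteredColimits (tensorLeft X)]
  [∀ X : C, PreservesFilteredColimits (tensorRight X)]

open Abs Lab

/-- If dH + Hd = 1 - e and likewise with primes, then H ⊗ 1 + e ⊗ H' is a homotopy from 1 to e ⊗ e':
the two pieces give (1 - e) ⊗ 1 and e ⊗ (1 - e'). The cross terms cancel because e commutes with d.
The degrees are variables with equations since differences of shifts reduce to 0 only
propositionally, and α, β stand for the signs coming from those shifts. -/
theorem GHom.tensor_homotopy {M L : GradedObject ℤ C} {z z' o o' : ℤ} (hz : z = 0) (hz' : z' = 0)
    (ho : o = 1) (ho' : o' = 1) (α β : ℤˣ) (d : GHom M M o) (d' : GHom L L o')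
    (H : GHom M M (-1)) (H' : GHom L L (-1)) (e : GHom M M z) (e' : GHom L L z')
    (h : GHom.comp d H (t := z) (by omega) + GHom.comp H d (by omega) + e = GHom.ofHom (𝟙 M) hz)
    (h' : GHom.comp d' H' (t := z') (by omega) + GHom.comp H' d' (by omega) + e' =
      GHom.ofHom (𝟙 L) hz')
    (hc : GHom.comp d e (t := o) (by omega) = GHom.comp e d (by omega)) {w wo : ℤ} (hw : w = 0)
    (hwo : wo = 1) :
    GHom.comp (α • GHom.tensor (GHom.ofHom (𝟙 M) hz) d' (t := wo) (by omega) +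
          β • GHom.tensor d (GHom.ofHom (𝟙 L) hz') (by omega))
        (β • GHom.tensor H (GHom.ofHom (𝟙 L) hz') (t := -1) (by omega) +
          α • GHom.tensor e H' (by omega)) (t := w) (by omega) +
      GHom.comp (β • GHom.tensor H (GHom.ofHom (𝟙 L) hz') (t := -1) (by omega) +
          α • GHom.tensor e H' (by omega))
        (α • GHom.tensor (GHom.ofHom (𝟙 M) hz) d' (t := wo) (by omega) +
          β • GHom.tensor d (GHom.ofHom (𝟙 L) hz') (by omega)) (by omega) +
      GHom.tensor e e' (by omega) =
      GHom.tensor (GHom.ofHom (𝟙 M) hz) (GHom.ofHom (𝟙 L) hz') (by omega) := by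
  subst hz hz' ho ho' hw hwo
  simp only [GHom.add_comp, GHom.comp_add, GHom.smul_comp, GHom.comp_smul]
  rw [GHom.tensor_comp_tensor _ _ _ _ _ _ _ (a := -1) (b := 1) (by norm_num) (by norm_num),
    GHom.tensor_comp_tensor _ _ _ _ _ _ _ (a := 0) (b := 0) (by norm_num) (by norm_num),
    GHom.tensor_comp_tensor _ _ _ _ _ _ _ (a := 0) (b := 0) (by norm_num) (by norm_num),
    GHom.tensor_comp_tensor _ _ _ _ _ _ _ (a := 1) (b := -1) (by norm_num) (by norm_num),
    GHom.tensor_comp_tensor _ _ _ _ _ _ _ (a := -1) (b := 1) (by norm_num) (by norm_num),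
    GHom.tensor_comp_tensor _ _ _ _ _ _ _ (a := 0) (b := 0) (by norm_num) (by norm_num),
    GHom.tensor_comp_tensor _ _ _ _ _ _ _ (a := 0) (b := 0) (by norm_num) (by norm_num),
    GHom.tensor_comp_tensor _ _ _ _ _ _ _ (a := 1) (b := -1) (by norm_num) (by norm_num)]
  simp only [GHom.ofHom_id_comp, GHom.comp_ofHom_id, GHom.recast_rfl]
  have hd : GHom.comp d' H' (t := 0) (by omega) = GHom.ofHom (𝟙 L) rfl - e' -
    GHom.comp H' d' (by omega) := by rw [← h']; abel
  have hd1 : GHom.comp d H (t := 0) (by omega) = GHom.ofHom (𝟙 M) rfl - e -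
    GHom.comp H d (by omega) := by rw [← h]; abel
  have hs1 : ∀ {M M' L L' : GradedObject ℤ C} {r s t : ℤ} (f f' : GHom M M' r) (g : GHom L L' s)
      (h : r + s = t), GHom.tensor (f - f') g h = GHom.tensor f g h - GHom.tensor f' g h := by
    intro M M' L L' r s t f f' g h
    rw [eq_sub_iff_add_eq, ← GHom.add_tensor, sub_add_cancel]
  have hs2 : ∀ {M M' L L' : GradedObject ℤ C} {r s t : ℤ} (f : GHom M M' r) (g g' : GHom L L' s)
      (h : r + s = t), GHom.tensor f (g - g') h = GHom.tensor f g h - GHom.tensor f g' h := by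
    intro M M' L L' r s t f g g' h
    rw [eq_sub_iff_add_eq, ← GHom.tensor_add, sub_add_cancel]
  rw [hc, hd, hd1, hs1, hs1, hs2, hs2]
  have e0 : ((0 : ℤ) * (0 : ℤ)).negOnePow = 1 := rfl
  have e1 : ((0 : ℤ) * (-1 : ℤ)).negOnePow = 1 := rfl
  have e2 : ((1 : ℤ) * (0 : ℤ)).negOnePow = 1 := rfl
  have e3 : ((1 : ℤ) * (-1 : ℤ)).negOnePow = -1 := by simp
  have e4 : ((-1 : ℤ) * (1 : ℤ)).negOnePow = -1 := by simp
  have e5 : ((-1 : ℤ) * (0 : ℤ)).negOnePow = 1 := rfl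
  have e6 : ((0 : ℤ) * (1 : ℤ)).negOnePow = 1 := rfl
  simp only [e0, e1, e2, e3, e4, e5, e6, one_smul, Units.neg_smul, smul_neg]
  -- For each of the four choices of signs the remaining identity is one of abelian groups.
  obtain rfl | rfl := Int.units_eq_one_or α <;> obtain rfl | rfl := Int.units_eq_one_or β <;>
    simp only [one_smul, Units.neg_smul, neg_neg] <;> abel

/-- A null homotopy of the difference between the identity and an idempotent-like endomorphism. -/
structure Htpy (X : Lab C) (D E : X ⟶ X) (H : GHom X.obj X.obj (-1)) : Prop where
  ev_eq : ev D = ev (𝟙 X)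
  od_eq : od E = 0
  comm : GHom.comp (od D) (ev E) (t := X.deg - X.deg + 1) (by ring) =
    GHom.comp (ev E) (od D) (by ring)
  htpy : GHom.comp (od D) H (t := X.deg - X.deg) (by ring) + GHom.comp H (od D) (by ring) + ev E =
    ev (𝟙 X)

/-- The homotopy on a tensor product. -/
noncomputable def tensorH {X Y : Lab C} (H : GHom X.obj X.obj (-1)) (E : X ⟶ X)
    (H' : GHom Y.obj Y.obj (-1)) : GHom (X ⊗ Y).obj (X ⊗ Y).obj (-1) :=
  Y.deg.negOnePow • GHom.tensor H (GHom.ofHom (𝟙 Y.obj) (sub_self Y.deg)) (by ring) +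
    X.deg.negOnePow • GHom.tensor (ev E) H' (by ring)

theorem Htpy.tensor {X Y : Lab C} {D E : X ⟶ X} {H : GHom X.obj X.obj (-1)} {D' E' : Y ⟶ Y}
    {H' : GHom Y.obj Y.obj (-1)} (h : Htpy X D E H) (h' : Htpy Y D' E' H') :
    Htpy (X ⊗ Y) (D ⊗ₘ D') (E ⊗ₘ E') (tensorH H E H') where
  ev_eq := by
    rw [ev_tensorHom, h.ev_eq, h'.ev_eq, ← ev_tensorHom]
    exact congrArg ev (id_tensorHom_id X Y)
  od_eq := od_tens_zero _ _ h.od_eq h'.od_eq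
  comm := by
    have h1 : ∀ {X : Lab C} {D E : X ⟶ X} {H : GHom X.obj X.obj (-1)}, Htpy X D E H →
        D ≫ E = E ≫ D := by
      intro X D E H h
      refine hom_ext ?_ ?_
      · rw [ev_comp, ev_comp, h.ev_eq, ← ev_comp, ← ev_comp, Category.id_comp, Category.comp_id]
      · rw [od_comp_even _ _ h.od_eq, od_even_comp _ _ h.od_eq, h.comm]
    have h2 : (D ⊗ₘ D') ≫ (E ⊗ₘ E') = (E ⊗ₘ E') ≫ (D ⊗ₘ D') := by
      rw [tensorHom_comp_tensorHom, tensorHom_comp_tensorHom, h1 h, h1 h']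
    have h3 : od (E ⊗ₘ E') = 0 := od_tens_zero _ _ h.od_eq h'.od_eq
    have h4 := congrArg od h2
    rw [od_comp_even _ _ h3, od_even_comp _ _ h3] at h4
    exact h4
  htpy := by
    have h1 := GHom.tensor_homotopy (sub_self X.deg) (sub_self Y.deg) (by ring) (by ring)
      X.deg.negOnePow Y.deg.negOnePow (od D) (od D') H H' (ev E) (ev E') h.htpy h'.htpy h.comm
      (w := (X ⊗ Y).deg - (X ⊗ Y).deg) (wo := (X ⊗ Y).deg - (X ⊗ Y).deg + 1) (by ring) (by ring)
    have h2 : od (D ⊗ₘ D') = X.deg.negOnePow • GHom.tensor (GHom.ofHom (𝟙 X.obj) (sub_self X.deg))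
          (od D') (t := (X ⊗ Y).deg - (X ⊗ Y).deg + 1) (by ring) +
        Y.deg.negOnePow • GHom.tensor (od D) (GHom.ofHom (𝟙 Y.obj) (sub_self Y.deg))
          (by ring) := by
      have s1 : (X.deg * (Y.deg - Y.deg + 1)).negOnePow = X.deg.negOnePow := congrArg _ (by ring)
      have s2 : (X.deg * (Y.deg - Y.deg) + Y.deg).negOnePow = Y.deg.negOnePow :=
        congrArg _ (by ring)
      rw [od_tensorHom, h.ev_eq, h'.ev_eq, s1, s2]
      rfl
    have s0 : (X.deg * (Y.deg - Y.deg)).negOnePow = 1 := by simp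
    have h3 : ev (E ⊗ₘ E') = GHom.tensor (ev E) (ev E') (t := (X ⊗ Y).deg - (X ⊗ Y).deg)
        (by ring) := by
      rw [ev_tensorHom, s0, one_smul]
    have h4 : ev (𝟙 (X ⊗ Y)) = GHom.tensor (GHom.ofHom (𝟙 X.obj) (sub_self X.deg))
        (GHom.ofHom (𝟙 Y.obj) (sub_self Y.deg)) (t := (X ⊗ Y).deg - (X ⊗ Y).deg) (by ring) := by
      rw [← id_tensorHom_id, ev_tensorHom, s0, one_smul]
      rfl
    rw [h2, h3, h4]
    exact h1

/-- The homotopy on tensor powers. -/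
noncomputable def powH {X : Lab C} (E : X ⟶ X) (H : GHom X.obj X.obj (-1)) :
    ∀ n, GHom (Pow X n).obj (Pow X n).obj (-1)
  | 0 => 0
  | n + 1 => tensorH (X := X) (Y := Pow X n) H E (powH E H n)

theorem Htpy.pow {X : Lab C} {D E : X ⟶ X} {H : GHom X.obj X.obj (-1)} (h : Htpy X D E H) :
    ∀ n, Htpy (Pow X n) (tpow D n) (tpow E n) (powH E H n)
  | 0 => ⟨rfl, rfl, by
      rw [show od (tpow D 0) = 0 from rfl, GHom.zero_comp, GHom.comp_zero], by
      rw [show powH E H 0 = 0 from rfl, GHom.zero_comp, GHom.comp_zero, add_zero]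
      exact zero_add _⟩
  | n + 1 => h.tensor (h.pow n)

/-- Each summand of the homotopy on a tensor power applies H to one factor, and the tensor power of
l applies l to every factor, so l followed by H occurs. This keeps the corrections zero on A^{⊗n}.
-/
theorem comp_powH {X Y : Lab C} (l : X ⟶ Y) {E : Y ⟶ Y} {H : GHom Y.obj Y.obj (-1)}
    (h : GHom.comp (ev l) H rfl = 0) : ∀ n, GHom.comp (ev (tpow l n)) (powH E H n) rfl = 0
  | 0 => GHom.comp_zero _ _
  | n + 1 => by
    refine (GHom.comp_add _ _ _ _).trans ?_
    rw [GHom.comp_smul, GHom.comp_smul, tpow_succ, ev_tensorHom, GHom.smul_comp, GHom.smul_comp,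
      GHom.tensor_comp_tensor _ _ _ _ _ _ _ rfl rfl,
      GHom.tensor_comp_tensor _ _ _ _ _ _ _ rfl rfl, h, comp_powH l h n, GHom.zero_tensor,
      GHom.tensor_zero]
    simp

theorem GHom.neg_comp {M L N : GradedObject ℤ C} {r s t : ℤ} (f : GHom M L r) (g : GHom L N s)
    (h : r + s = t) : GHom.comp (-f) g h = -GHom.comp f g h := by
  rw [eq_neg_iff_add_eq_zero, ← GHom.add_comp, neg_add_cancel, GHom.zero_comp]

theorem GHom.comp_neg {M L N : GradedObject ℤ C} {r s t : ℤ} (f : GHom M L r) (g : GHom L N s)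
    (h : r + s = t) : GHom.comp f (-g) h = -GHom.comp f g h := by
  rw [eq_neg_iff_add_eq_zero, ← GHom.comp_add, neg_add_cancel, GHom.comp_zero]

/-- With c = xH one has Dc - cd = DxH - xHd = -x(dH + Hd) = -x + xπσ, and xπ = 0. -/
theorem GHom.solve_right {P E N : GradedObject ℤ C} {a r o o' z w t : ℤ} (hr : r = a + 1)
    (ho : o = 1) (ho' : o' = 1) (hz : z = 0) (hw : w = 0) (ht : t = a + 2) (D : GHom P P o)
    (x : GHom P E r)
    (d : GHom E E o') (H : GHom E E (-1)) (π : GHom E N z) (σ : GHom N E 0)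
    (hx : GHom.comp D x (t := t) (by omega) + GHom.comp x d (by omega) = 0)
    (hπ : GHom.comp x π (t := r) (by omega) = 0)
    (hH : GHom.comp d H (t := w) (by omega) + GHom.comp H d (by omega) +
      GHom.comp π σ (by omega) = GHom.ofHom (𝟙 E) hw) :
    x + (GHom.comp D (GHom.comp x H (t := a) (by omega)) (t := r) (by omega) -
      GHom.comp (GHom.comp x H (t := a) (by omega)) d (by omega)) = 0 := by
  subst hr ho ho' hz hw ht
  have h1 := congrArg (fun y => GHom.comp y H (t := a + 1) (by omega)) hx
  have h2 := congrArg (fun y => GHom.comp x y (t := a + 1) (by omega)) hH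
  rw [GHom.add_comp, GHom.comp_assoc _ _ _ (by omega) (bc := a) (by omega),
    GHom.comp_assoc _ _ _ (by omega) (bc := 0) (by omega), GHom.zero_comp] at h1
  rw [GHom.comp_add, GHom.comp_add, ← GHom.comp_assoc x H d (ab := a) (by omega) (by omega)
    (by omega), ← GHom.comp_assoc x π σ (ab := a + 1) (by omega) (by omega) (by omega), hπ,
    GHom.zero_comp, add_zero, GHom.comp_ofHom_id, GHom.recast_rfl] at h2
  rw [eq_neg_of_add_eq_zero_left h1, ← neg_add', h2, add_neg_cancel]

/-- With c = -Hx one has Dc - cd = -DHx + Hxd = -(DH + HD)x = -x + ex, and ex = 0. -/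
theorem GHom.solve_left {P E : GradedObject ℤ C} {a r o o' w t : ℤ} (hr : r = a + 1)
    (ho : o = 1) (ho' : o' = 1) (hw : w = 0) (ht : t = a + 2) (D : GHom P P o)
    (x : GHom P E r) (d : GHom E E o') (H : GHom P P (-1)) (e : GHom P P w)
    (hx : GHom.comp D x (t := t) (by omega) + GHom.comp x d (by omega) = 0)
    (he : GHom.comp e x (t := r) (by omega) = 0)
    (hH : GHom.comp D H (t := w) (by omega) + GHom.comp H D (by omega) + e =
      GHom.ofHom (𝟙 P) hw) :
    x + (GHom.comp D (-GHom.comp H x (t := a) (by omega)) (t := r) (by omega) -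
      GHom.comp (-GHom.comp H x (t := a) (by omega)) d (by omega)) = 0 := by
  subst hr ho ho' hw ht
  have h1 := congrArg (fun y => GHom.comp H y (t := a + 1) (by omega)) hx
  have h2 := congrArg (fun y => GHom.comp y x (t := a + 1) (by omega)) hH
  rw [GHom.comp_add, ← GHom.comp_assoc H D x (ab := 0) (by omega) (by omega) (by omega),
    ← GHom.comp_assoc H x d (ab := a) (by omega) (by omega) (by omega), GHom.comp_zero] at h1
  rw [GHom.add_comp, GHom.add_comp, GHom.comp_assoc D H x _ (bc := a) (by omega), he, add_zero,
    GHom.ofHom_id_comp, GHom.recast_rfl] at h2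
  rw [GHom.comp_neg, GHom.neg_comp, ← eq_neg_of_add_eq_zero_left h1, ← neg_add', h2,
    add_neg_cancel]

theorem dif_comp_dif (A : AInfAlg C) : GHom.comp (dif A) (dif A) (t := 2) (by norm_num) = 0 := by
  refine GHom.ext fun p q hq => ?_
  rw [GHom.comp_v _ _ _ p (p + 1) q rfl (by omega), dif_v, dif_v, GHom.zero_v]
  exact (toComplex A).d_comp_d _ _ _

section Solve

variable {B E : AInfAlg C}

theorem ev_tpow_id {V : Lab C} {l : V ⟶ V} (h : ev l = ev (𝟙 V)) : ∀ n, ev (tpow l n) = ev (𝟙 _)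
  | 0 => rfl
  | n + 1 => by
    rw [tpow_succ, ev_tensorHom, h, ev_tpow_id h n, ← ev_tensorHom]
    exact congrArg ev (id_tensorHom_id _ _)

theorem ev_solution {n : ℕ} {x : Pow B.V n ⟶ E.V} (hx : ev x = 0) (c : Pow B.V n ⟶ E.V) :
    ev (x + (tpow (lin B.str) n ≫ c - c ≫ lin E.str)) = 0 := by
  rw [ev_add, ev_sub, hx, ev_comp, ev_comp, ev_tpow_id (ev_lin_str B), ev_lin_str, ← ev_comp,
    ← ev_comp, Category.id_comp, Category.comp_id, sub_self, add_zero]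

/-- Composing the obstruction with a homotopy on the target solves the equation. The result stays
zero on the source because x is, and zero over the base because H is killed by π. -/
theorem solvable_of_homotopy_right {M N : GradedObject ℤ C} (ι : M ⟶ B.obj) (π : E.obj ⟶ N) (n : ℕ)
    (H : GHom E.obj E.obj (-1)) (hπ : GHom.comp H (GHom.ofHom π rfl) (add_zero _) = 0)
    (σ : GHom N E.obj 0)
    (hH : GHom.comp (dif E) H (t := 0) (by norm_num) + GHom.comp H (dif E) (by norm_num) +
      GHom.comp (GHom.ofHom π rfl) σ (add_zero 0) = GHom.ofHom (𝟙 E.obj) rfl) :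
    Solvable B E ι π n := by
  intro x hx hc hι hxπ
  have hH' : GHom.comp (od (lin E.str)) H (t := E.V.deg - E.V.deg) (by ring) +
      GHom.comp H (od (lin E.str)) (by ring) +
      GHom.comp (ev (shf π)) σ (by change (1 : ℤ) - 1 + 0 = 1 - 1; norm_num) = ev (𝟙 E.V) := by
    rw [od_lin_str, GHom.recast_comp', GHom.comp_recast]
    exact hH
  have h1 : od (tpow (shf ι) n ≫ x) = 0 := by rw [hι]; rfl
  rw [od_even_comp _ _ (od_tpow _ rfl n)] at h1
  have h2 : od (x ≫ shf π) = 0 := by rw [hxπ]; rfl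
  rw [od_comp_even _ _ rfl] at h2
  refine ⟨evenL (GHom.comp (od x) H (by ring)), rfl, hom_ext ?_ ?_, hom_ext ?_ ?_,
    hom_ext (ev_solution hx _) ?_⟩
  · refine (GHom.comp_assoc (abc := E.V.deg - (Pow (sV M) n).deg) (ev (tpow (shf ι) n)) (od x) H
      (ab := E.V.deg - (Pow (sV M) n).deg + 1) (by ring) (by ring) (by ring)).symm.trans ?_
    rw [h1, GHom.zero_comp]
    rfl
  · exact od_comp_zero _ _ (od_tpow _ rfl n) rfl
  · refine (GHom.comp_assoc (od x) H (GHom.ofHom π rfl) (by ring) (add_zero _) (by ring)).trans ?_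
    rw [hπ, GHom.comp_zero]
    rfl
  · exact od_comp_zero _ _ rfl rfl
  · rw [od_add, od_sub, od_comp_even _ _ rfl, od_even_comp _ _ rfl]
    exact GHom.solve_right rfl (by ring) (by ring) (sub_self _) (sub_self _) rfl _ _ _ _
      (ev (X := sV E.obj) (Y := sV N) (shf π)) σ hc h2 hH'

/-- Here the homotopy acts on the source, so it has to be extended to the tensor powers of B. The
error term is the tensor power of σι, which factors through A^{⊗n}, where the obstruction vanishes.
-/
theorem solvable_of_homotopy_left {M N : GradedObject ℤ C} (ι : M ⟶ B.obj) (π : E.obj ⟶ N) (n : ℕ)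
    (H : GHom B.obj B.obj (-1)) (hι : GHom.comp (GHom.ofHom ι rfl) H (zero_add _) = 0)
    (σ : B.obj ⟶ M)
    (hH : GHom.comp (dif B) H (t := 0) (by norm_num) + GHom.comp H (dif B) (by norm_num) +
      GHom.ofHom (σ ≫ ι) rfl = GHom.ofHom (𝟙 B.obj) rfl) :
    Solvable B E ι π n := by
  intro x hx hc hιx hxπ
  -- The endomorphism σι commutes with the differential because it equals 1 - (dH + Hd); σ itself
  -- need not be a morphism of complexes.
  have hd : GHom.comp (dif B) (GHom.ofHom (σ ≫ ι) rfl) (add_zero 1) =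
      GHom.comp (GHom.ofHom (σ ≫ ι) rfl) (dif B) (zero_add 1) := by
    have h1 := congrArg (fun y => GHom.comp (dif B) y (add_zero 1)) hH
    have h2 := congrArg (fun y => GHom.comp y (dif B) (zero_add 1)) hH
    rw [GHom.comp_add, GHom.comp_add, ← GHom.comp_assoc (ab := 2) (dif B) (dif B) H (by norm_num)
      (by norm_num) (by norm_num), dif_comp_dif, GHom.zero_comp, zero_add, GHom.comp_ofHom_id,
      GHom.recast_rfl] at h1
    rw [GHom.add_comp, GHom.add_comp, GHom.comp_assoc (bc := 2) H (dif B) (dif B) _ (by norm_num)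
      (by norm_num), dif_comp_dif, GHom.comp_zero, add_zero, GHom.ofHom_id_comp, GHom.recast_rfl,
      GHom.comp_assoc (bc := 0) (dif B) H (dif B) _ (by norm_num) (by norm_num)] at h2
    exact add_left_cancel (h1.trans h2.symm)
  have hP : Htpy B.V (lin B.str) (shf (σ ≫ ι)) H := by
    refine ⟨ev_lin_str B, rfl, ?_, ?_⟩
    · rw [od_lin_str, GHom.recast_comp', GHom.comp_recast]
      exact hd
    · rw [od_lin_str, GHom.recast_comp', GHom.comp_recast]
      exact hH
  have h1 : od (tpow (shf (σ ≫ ι)) n ≫ x) = 0 := by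
    rw [← shf_comp, ← tpow_comp, Category.assoc, hιx, comp_zero]
    rfl
  rw [od_even_comp _ _ (od_tpow _ rfl n)] at h1
  have h2 : od (x ≫ shf π) = 0 := by rw [hxπ]; rfl
  rw [od_comp_even _ _ rfl] at h2
  have h3 := comp_powH (E := shf (σ ≫ ι)) (shf ι) (H := H) hι n
  refine ⟨evenL (-GHom.comp (powH (shf (σ ≫ ι)) H n) (od x) (by ring)), rfl, hom_ext ?_ ?_,
    hom_ext ?_ ?_, hom_ext (ev_solution hx _) ?_⟩
  · refine (GHom.comp_neg (t := E.V.deg - (Pow (sV M) n).deg) (ev (tpow (shf ι) n))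
      (GHom.comp (powH (shf (σ ≫ ι)) H n) (od x)
        (t := E.V.deg - (Pow (sV B.obj) n).deg) (by ring)) (by ring)).trans ?_
    rw [← GHom.comp_assoc (ev (tpow (shf ι) n)) (powH (shf (σ ≫ ι)) H n) (od x) rfl _
      (by ring), h3, GHom.zero_comp, neg_zero]
    rfl
  · exact od_comp_zero _ _ (od_tpow _ rfl n) rfl
  · refine (GHom.neg_comp (t := (sV N).deg - (Pow (sV B.obj) n).deg)
      (GHom.comp (powH (shf (σ ≫ ι)) H n) (od x)
        (t := E.V.deg - (Pow (sV B.obj) n).deg) (by ring)) (ev (shf π)) (by ring)).trans ?_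
    rw [GHom.comp_assoc (powH (shf (σ ≫ ι)) H n) (od x) (ev (shf π)) _
      (bc := (sV N).deg - (Pow (sV B.obj) n).deg + 1) (by ring) (by ring), h2,
      GHom.comp_zero, neg_zero]
    rfl
  · exact od_comp_zero _ _ rfl rfl
  · rw [od_add, od_sub, od_comp_even _ _ rfl, od_even_comp _ _ rfl]
    exact GHom.solve_left rfl (by ring) (by ring) (sub_self _) rfl _ _ _ _ _ hc h1
      (hP.pow n).htpy

end Solve

end

end AInf

namespace AInf

/-! ### Contractions in a semisimple abelian category. -/

section Semisimple

variable {C : Type u} [Category.{v} C] [Abelian C] [SplitMonoCategory C]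

theorem exists_retraction {X Y : C} (f : X ⟶ Y) [Mono f] : ∃ r : Y ⟶ X, f ≫ r = 𝟙 X :=
  have := isSplitMono_of_mono f
  ⟨retraction f, IsSplitMono.id f⟩

theorem exists_section {X Y : C} (f : X ⟶ Y) [Epi f] : ∃ s : Y ⟶ X, s ≫ f = 𝟙 Y := by
  obtain ⟨r, hr⟩ := exists_retraction (kernel.ι f)
  have h : kernel.ι f ≫ (𝟙 X - r ≫ kernel.ι f) = 0 := by
    rw [Preadditive.comp_sub, reassoc_of% hr, Category.comp_id, sub_self]
  have hs := Abelian.comp_epiDesc f (𝟙 X - r ≫ kernel.ι f) h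
  refine ⟨Abelian.epiDesc f _ h, ?_⟩
  rw [← cancel_epi f, reassoc_of% hs, Preadditive.sub_comp, Category.assoc, kernel.condition,
    comp_zero, sub_zero, Category.id_comp, Category.comp_id]

/-- Retract onto the image and lift back along the epimorphism onto it: a semisimple category is von
Neumann regular. -/
theorem exists_regular {X Y : C} (f : X ⟶ Y) : ∃ s : Y ⟶ X, f ≫ s ≫ f = f := by
  obtain ⟨r, hr⟩ := exists_retraction (Abelian.image.ι f)
  obtain ⟨s, hs⟩ := exists_section (Abelian.factorThruImage f)
  refine ⟨r ≫ s, ?_⟩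
  have h := Abelian.image.fac f
  calc f ≫ (r ≫ s) ≫ f = (Abelian.factorThruImage f ≫ Abelian.image.ι f) ≫ (r ≫ s) ≫
        Abelian.factorThruImage f ≫ Abelian.image.ι f := by rw [h]
    _ = f := by
      simp only [Category.assoc]
      rw [reassoc_of% hr, reassoc_of% hs, h]

/-- With quasi-inverses s of the differentials, 1 - ds projects onto cycles. By acyclicity these are
boundaries, and s chooses primitives of them. -/
theorem exists_contraction (K : CochainComplex C ℤ) (hK : K.Acyclic) :
    ∃ h : ∀ p q : ℤ, p + 1 = q → (K.X q ⟶ K.X p), ∀ p q r (hpq : p + 1 = q) (hqr : q + 1 = r),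
      h p q hpq ≫ K.d p q + K.d q r ≫ h q r hqr = 𝟙 _ := by
  choose s hs using fun p q => exists_regular (K.d p q)
  have hex : ∀ p q r (hpq : p + 1 = q) (hqr : q + 1 = r) {X Y : C} (a : X ⟶ K.X q)
      (b : K.X q ⟶ Y), a ≫ K.d q r = 0 → K.d p q ≫ b = 0 → a ≫ b = 0 := by
    intro p q r hpq hqr X Y a b ha hb
    have h := hK q
    rw [HomologicalComplex.exactAt_iff' K p q r (by simp; omega) (by simp; omega)] at h
    exact h.comp_eq_zero ha hb
  -- The map 1 - ds takes values in cycles and 1 - sd kills boundaries, so their composite is zero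
  -- by exactness.
  have he : ∀ p q r (hpq : p + 1 = q) (hqr : q + 1 = r),
      (𝟙 _ - K.d q r ≫ s q r) ≫ s p q ≫ K.d p q = 𝟙 _ - K.d q r ≫ s q r := by
    intro p q r hpq hqr
    have h := hex p q r hpq hqr (𝟙 _ - K.d q r ≫ s q r) (𝟙 _ - s p q ≫ K.d p q) (by
      rw [Preadditive.sub_comp, Category.assoc, hs, Category.id_comp, sub_self]) (by
      rw [Preadditive.comp_sub, hs, Category.comp_id, sub_self])
    rw [Preadditive.comp_sub, Category.comp_id, sub_eq_zero] at h
    exact h.symm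
  refine ⟨fun p q _ => (𝟙 _ - K.d q (q + 1) ≫ s q (q + 1)) ≫ s p q, fun p q r hpq hqr => ?_⟩
  subst hqr
  dsimp only
  rw [Category.assoc, he p q _ hpq rfl, Preadditive.sub_comp, Preadditive.comp_sub,
    Category.id_comp, Category.assoc, HomologicalComplex.d_comp_d_assoc, zero_comp, sub_zero,
    sub_add_cancel]

/-- The kernel of φ is acyclic, hence contractible; the contraction is carried to K by a graded
splitting, so H takes values in the kernel. The splitting κ is not a morphism of complexes, but its
failure factors through φ and is absorbed in σ, which is only a graded map. -/
theorem exists_homotopy_of_epi {K L : CochainComplex C ℤ} (φ : K ⟶ L) [QuasiIso φ]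
    (hφ : ∀ p, Epi (φ.f p)) :
    ∃ (H : ∀ p q : ℤ, p + 1 = q → (K.X q ⟶ K.X p)) (σ : ∀ p, L.X p ⟶ K.X p),
      (∀ p q h, H p q h ≫ φ.f p = 0) ∧ ∀ p q r (hpq : p + 1 = q) (hqr : q + 1 = r),
        K.d q r ≫ H q r hqr + H p q hpq ≫ K.d p q + φ.f q ≫ σ q = 𝟙 _ := by
  have : Epi φ := HomologicalComplex.epi_of_epi_f _ hφ
  let S : ShortComplex (CochainComplex C ℤ) := ShortComplex.mk (kernel.ι φ) φ (kernel.condition φ)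
  have hS : S.ShortExact := { exact := ShortComplex.exact_kernel φ }
  obtain ⟨h, hh⟩ := exists_contraction _ (hS.acyclic_X₁ ‹_›)
  have hSp : ∀ p, (S.map (HomologicalComplex.eval C _ p)).ShortExact :=
    fun p => hS.map_of_exact (HomologicalComplex.eval C _ p)
  choose s hs using fun p => exists_section (φ.f p)
  let i : S.X₁ ⟶ K := kernel.ι φ
  have hi : ∀ p, Mono (i.f p) := fun p => (hSp p).mono_f
  have hiφ : ∀ p, i.f p ≫ φ.f p = 0 := fun p => (S.map (HomologicalComplex.eval C _ p)).zero
  have hκ : ∀ p, ∃ κ : K.X p ⟶ S.X₁.X p, κ ≫ i.f p = 𝟙 _ - φ.f p ≫ s p := fun p => by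
    have := (hSp p).mono_f
    refine ⟨(hSp p).exact.lift (𝟙 _ - φ.f p ≫ s p) ?_, (hSp p).exact.lift_f _ _⟩
    change (𝟙 (K.X p) - φ.f p ≫ s p) ≫ φ.f p = 0
    rw [Preadditive.sub_comp, Category.assoc, hs, Category.id_comp, Category.comp_id, sub_self]
  choose κ hκ using hκ
  have hd : ∀ q r, K.d q r ≫ κ r = κ q ≫ S.X₁.d q r + φ.f q ≫ s q ≫ K.d q r ≫ κ r := by
    intro q r
    have := hi r
    rw [← cancel_mono (i.f r)]
    simp only [Preadditive.add_comp, Category.assoc]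
    rw [hκ r, ← i.comm q r, reassoc_of% (hκ q)]
    simp only [Preadditive.sub_comp, Preadditive.comp_sub, Category.assoc, Category.comp_id,
      Category.id_comp]
    rw [← φ.comm_assoc q r, reassoc_of% (hs q)]
    abel
  refine ⟨fun p q hpq => κ q ≫ h p q hpq ≫ i.f p,
    -- The second term is the error of κ from `hd` followed by h and the inclusion; the first comes
    -- from κi = 1 - φs.
    fun q => s q - s q ≫ K.d q (q + 1) ≫ κ (q + 1) ≫ h q (q + 1) rfl ≫ i.f q, ?_, ?_⟩
  · intro p q hpq
    simp only [Category.assoc, hiφ, comp_zero]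
  · intro p q r hpq hqr
    subst hqr
    have h1 := congrArg (fun x => κ q ≫ x ≫ i.f q) (hh p q _ hpq rfl)
    have h2 := congrArg (fun x => x ≫ h q (q + 1) rfl ≫ i.f q) (hd q (q + 1))
    simp only [Preadditive.add_comp, Preadditive.comp_add, Category.assoc, Category.id_comp] at h1 h2
    have h3 := i.comm p q
    rw [hκ] at h1
    simp only [Preadditive.comp_sub, Category.assoc]
    rw [h3, ← eq_sub_iff_add_eq.1 h1, ← sub_eq_iff_eq_add.2 h2]
    abel

/-- Dual argument: contract the cokernel and carry the contraction to L by a graded section τ of the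
projection. Then H vanishes on the image of φ, and the error of τ against the differentials lies in
that image. -/
theorem exists_homotopy_of_mono {K L : CochainComplex C ℤ} (φ : K ⟶ L) [QuasiIso φ]
    (hφ : ∀ p, Mono (φ.f p)) :
    ∃ (H : ∀ p q : ℤ, p + 1 = q → (L.X q ⟶ L.X p)) (σ : ∀ p, L.X p ⟶ K.X p),
      (∀ p q h, φ.f q ≫ H p q h = 0) ∧ ∀ p q r (hpq : p + 1 = q) (hqr : q + 1 = r),
        L.d q r ≫ H q r hqr + H p q hpq ≫ L.d p q + σ q ≫ φ.f q = 𝟙 _ := by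
  have : Mono φ := HomologicalComplex.mono_of_mono_f _ hφ
  let S : ShortComplex (CochainComplex C ℤ) :=
    ShortComplex.mk φ (cokernel.π φ) (cokernel.condition φ)
  have hS : S.ShortExact := { exact := ShortComplex.exact_cokernel φ }
  obtain ⟨h, hh⟩ := exists_contraction _ (hS.acyclic_X₃ ‹_›)
  have hSp : ∀ p, (S.map (HomologicalComplex.eval C _ p)).ShortExact :=
    fun p => hS.map_of_exact (HomologicalComplex.eval C _ p)
  choose ρ hρ using fun p => exists_retraction (φ.f p)
  let π : L ⟶ S.X₃ := cokernel.π φ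
  have hπ : ∀ p, Epi (π.f p) := fun p => (hSp p).epi_g
  have hφπ : ∀ p, φ.f p ≫ π.f p = 0 := fun p => (S.map (HomologicalComplex.eval C _ p)).zero
  have hτ : ∀ p, ∃ τ : S.X₃.X p ⟶ L.X p, π.f p ≫ τ = 𝟙 _ - ρ p ≫ φ.f p := fun p => by
    have := (hSp p).epi_g
    refine ⟨(hSp p).exact.desc (𝟙 _ - ρ p ≫ φ.f p) ?_, (hSp p).exact.g_desc _ _⟩
    change φ.f p ≫ (𝟙 (L.X p) - ρ p ≫ φ.f p) = 0
    rw [Preadditive.comp_sub, reassoc_of% (hρ p), Category.comp_id, sub_self]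
  choose τ hτ using hτ
  have hd : ∀ p q, τ p ≫ L.d p q = S.X₃.d p q ≫ τ q + τ p ≫ L.d p q ≫ ρ q ≫ φ.f q := by
    intro p q
    have := hπ p
    rw [← cancel_epi (π.f p)]
    simp only [Preadditive.comp_add]
    rw [reassoc_of% (hτ p), reassoc_of% (hτ p), π.comm_assoc p q, hτ q]
    simp only [Preadditive.sub_comp, Preadditive.comp_sub, Category.assoc, Category.comp_id,
      Category.id_comp]
    rw [φ.comm p q, φ.comm_assoc p q, reassoc_of% (hρ q)]
    abel
  refine ⟨fun p q hpq => π.f q ≫ h p q hpq ≫ τ p,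
    fun q => ρ q - π.f q ≫ h (q - 1) q (by omega) ≫ τ (q - 1) ≫ L.d (q - 1) q ≫ ρ q, ?_, ?_⟩
  · intro p q hpq
    rw [reassoc_of% (hφπ q), zero_comp]
  · intro p q r hpq hqr
    obtain rfl : p = q - 1 := by omega
    have h1 := congrArg (fun x => π.f q ≫ x ≫ τ q) (hh _ q r hpq hqr)
    have h2 := congrArg (fun x => π.f q ≫ h (q - 1) q hpq ≫ x) (hd (q - 1) q)
    simp only [Preadditive.add_comp, Preadditive.comp_add, Category.assoc, Category.id_comp] at h1 h2
    have h3 := π.comm_assoc q r (h q r hqr ≫ τ q)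
    rw [hτ] at h1
    simp only [Preadditive.sub_comp, Category.assoc]
    rw [← h3, ← eq_sub_iff_add_eq.1 h1, ← sub_eq_iff_eq_add.2 h2]
    abel

end Semisimple

end AInf

namespace AInf

/-! ### The lifting property. -/

section

variable {C : Type u} [Category.{v} C] [Abelian C] [MonoidalCategory C] [MonoidalPreadditive C]
  [HasColimits C] [∀ X : C, PreservesFilteredColimits (tensorLeft X)]
  [∀ X : C, PreservesFilteredColimits (tensorRight X)]

open Abs Lab

theorem linMap_comp {A B D : AInfAlg C} (f : A ⟶ B) (g : B ⟶ D) :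
    linMap (f ≫ g) = linMap f ≫ linMap g := (linFunctor C).map_comp f g

instance {A B : AInfAlg C} (f : A ⟶ B) [IsIso f] : IsIso (linMap f) :=
  inferInstanceAs (IsIso ((linFunctor C).map f))

theorem weq_comp {A B D : AInfAlg C} {f : A ⟶ B} {g : B ⟶ D} (hf : weq C f) (hg : weq C g) :
    weq C (f ≫ g) := by
  have : QuasiIso (linMap f) := hf
  have : QuasiIso (linMap g) := hg
  change QuasiIso (linMap (f ≫ g))
  rw [linMap_comp]
  infer_instance

theorem weq_of_isIso {A B : AInfAlg C} (f : A ⟶ B) [IsIso f] : weq C f := by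
  change QuasiIso (linMap f)
  infer_instance

theorem cof_comp {A B D : AInfAlg C} {f : A ⟶ B} {g : B ⟶ D} (hf : cof C f) (hg : cof C g) :
    cof C (f ≫ g) := by
  intro p
  have := hf p
  have := hg p
  rw [linMap_comp, HomologicalComplex.comp_f]
  infer_instance

theorem cof_of_isIso {A B : AInfAlg C} (f : A ⟶ B) [IsIso f] : cof C f := fun _ => inferInstance

theorem fib_comp {A B D : AInfAlg C} {f : A ⟶ B} {g : B ⟶ D} (hf : fib C f) (hg : fib C g) :
    fib C (f ≫ g) := by
  intro p
  have := hf p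
  have := hg p
  rw [linMap_comp, HomologicalComplex.comp_f]
  infer_instance

theorem fib_of_isIso {A B : AInfAlg C} (f : A ⟶ B) [IsIso f] : fib C f := fun _ => inferInstance

section Semisimple

variable [SplitMonoCategory C]

theorem cof.exists_retraction {A B : AInfAlg C} {i : A ⟶ B} (hi : cof C i) :
    ∃ ρ : B.obj ⟶ A.obj, linHom i ≫ ρ = 𝟙 _ := by
  choose ρ hρ using fun p => have := hi p; AInf.exists_retraction ((linMap i).f p)
  exact ⟨ρ, funext hρ⟩

theorem fib.exists_section {E B : AInfAlg C} {q : E ⟶ B} (hq : fib C q) :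
    ∃ s : B.obj ⟶ E.obj, s ≫ linHom q = 𝟙 _ := by
  choose s hs using fun p => have := hq p; AInf.exists_section ((linMap q).f p)
  exact ⟨s, funext hs⟩

theorem solvable_of_fib {B E F : AInfAlg C} {p : E ⟶ F} (hp : fib C p) (hw : weq C p)
    {M : GradedObject ℤ C} (ι : M ⟶ B.obj) (n : ℕ) : Solvable B E ι (linHom p) n := by
  have : QuasiIso (linMap p) := hw
  obtain ⟨H, σ, h1, h2⟩ := exists_homotopy_of_epi (linMap p) hp
  obtain ⟨H', hH⟩ : ∃ H' : GHom E.obj E.obj (-1), ∀ a b h, H'.v a b h = H b a (by omega) :=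
    ⟨GHom.mk fun a b h => H b a (by omega), fun a b h => GHom.mk_v _ _ _ _⟩
  let σ' : F.obj ⟶ E.obj := σ
  refine solvable_of_homotopy_right ι (linHom p) n H' ?_ (GHom.ofHom σ' rfl) ?_
  · refine GHom.ext fun a b h => ?_
    rw [GHom.comp_v _ _ _ a b b h (by omega), hH, GHom.ofHom_v, GHom.zero_v]
    exact h1 b a _
  · refine GHom.ext fun a b h => ?_
    obtain rfl : b = a := by omega
    rw [GHom.add_v, GHom.add_v, GHom.comp_v _ _ _ b (b + 1) b rfl (by omega),
      GHom.comp_v _ _ _ b (b - 1) b (by omega) (by omega), GHom.ofHom_comp, hH, hH,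
      GHom.ofHom_v, GHom.ofHom_v, dif_v, dif_v]
    exact h2 _ _ _ (by omega) rfl

theorem solvable_of_cof {A B E : AInfAlg C} {i : A ⟶ B} (hi : cof C i) (hw : weq C i)
    {N : GradedObject ℤ C} (π : E.obj ⟶ N) (n : ℕ) : Solvable B E (linHom i) π n := by
  have : QuasiIso (linMap i) := hw
  obtain ⟨H, σ, h1, h2⟩ := exists_homotopy_of_mono (linMap i) hi
  obtain ⟨H', hH⟩ : ∃ H' : GHom B.obj B.obj (-1), ∀ a b h, H'.v a b h = H b a (by omega) :=
    ⟨GHom.mk fun a b h => H b a (by omega), fun a b h => GHom.mk_v _ _ _ _⟩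
  refine solvable_of_homotopy_left (linHom i) π n H' ?_ σ ?_
  · refine GHom.ext fun a b h => ?_
    rw [GHom.comp_v _ _ _ a a b (by omega) h, hH, GHom.ofHom_v, GHom.zero_v]
    exact h1 b a _
  · refine GHom.ext fun a b h => ?_
    obtain rfl : b = a := by omega
    rw [GHom.add_v, GHom.add_v, GHom.comp_v _ _ _ b (b + 1) b rfl (by omega),
      GHom.comp_v _ _ _ b (b - 1) b (by omega) (by omega), hH, hH,
      GHom.ofHom_v, GHom.ofHom_v, dif_v, dif_v]
    exact h2 _ _ _ (by omega) rfl

theorem hasLiftingProperty_of_strict {A B E F : AInfAlg C} {i : A ⟶ B} {p : E ⟶ F}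
    (hi : IsStrict i) (hp : IsStrict p) (ci : cof C i) (fp : fib C p)
    (h : weq C i ∨ weq C p) : HasLiftingProperty i p := by
  obtain ⟨ρ, hρ⟩ := ci.exists_retraction
  obtain ⟨s, hs⟩ := fp.exists_section
  refine ⟨fun {u v} sq => ?_⟩
  obtain ⟨l, h1, h2, -⟩ := exists_lift hi hp (startFam_partialLift hi hp sq.w ρ s hρ hs)
    one_ne_zero fun n _ => h.elim (fun h => solvable_of_cof ci h _ n)
      fun h => solvable_of_fib fp h _ n
  exact ⟨⟨⟨l, h1, h2⟩⟩⟩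

/-- Lifting properties are invariant under isomorphisms of the two arrows, and semisimplicity makes
a cofibration strict by changing its target and a fibration strict by changing its source. -/
theorem hasLiftingProperty_of_cof_fib {A B E F : AInfAlg C} (i : A ⟶ B) (p : E ⟶ F)
    (ci : cof C i) (fp : fib C p) (h : weq C i ∨ weq C p) : HasLiftingProperty i p := by
  obtain ⟨ρ, hρ⟩ := ci.exists_retraction
  obtain ⟨s, hs⟩ := fp.exists_section
  obtain ⟨B', e, he⟩ := exists_iso_strict_right i ρ hρ
  obtain ⟨E', e', he'⟩ := exists_iso_strict_left p s hs
  have hl := hasLiftingProperty_of_strict he he' (cof_comp ci (cof_of_isIso _))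
    (fib_comp (fib_of_isIso _) fp) (h.imp (fun h => weq_comp h (weq_of_isIso _))
      fun h => weq_comp (weq_of_isIso _) h)
  refine ⟨fun {u v} sq => ?_⟩
  have sq' : CommSq (u ≫ e'.inv) (i ≫ e.hom) (e'.hom ≫ p) (e.inv ≫ v) :=
    ⟨by simp [sq.w]⟩
  have := hl.sq_hasLift sq'
  refine ⟨⟨⟨e.hom ≫ sq'.lift ≫ e'.hom, ?_, ?_⟩⟩⟩
  · have := sq'.fac_left
    rw [Category.assoc] at this
    rw [reassoc_of% this, e'.inv_hom_id, Category.comp_id]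
  · have := sq'.fac_right
    rw [Category.assoc, Category.assoc, this, Iso.hom_inv_id_assoc]

end Semisimple

end

end AInf

namespace AInf

/-! ### Two out of three and retracts. -/

section

variable {C : Type u} [Category.{v} C] [Abelian C] [MonoidalCategory C] [MonoidalPreadditive C]
  [HasColimits C] [∀ X : C, PreservesFilteredColimits (tensorLeft X)]
  [∀ X : C, PreservesFilteredColimits (tensorRight X)]

open Abs Lab

-- Weak equivalences are the inverse image of quasi-isomorphisms under a functor, and two out of
-- three and stability under retracts pass to inverse images.
variable (C) in
theorem weq_eq : weq C = (HomologicalComplex.quasiIso C _).inverseImage (linFunctor C) := rfl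

variable (C) in
theorem weq_hasTwoOutOfThree : (weq C).HasTwoOutOfThreeProperty := by
  rw [weq_eq]
  infer_instance

variable (C) in
theorem weq_isStableUnderRetracts : (weq C).IsStableUnderRetracts := by
  rw [weq_eq]
  infer_instance

theorem linMap_retract (W : MorphismProperty C) [W.IsStableUnderRetracts] {A B A' B' : AInfAlg C}
    {f : A ⟶ B} {g : A' ⟶ B'} (h : RetractArrow f g) (hg : ∀ p, W ((linMap g).f p)) (p : ℤ) :
    W ((linMap f).f p) :=
  W.of_retract (h.map (linFunctor C ⋙ HomologicalComplex.eval C _ p)) (hg p)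

variable (C) in
theorem cof_isStableUnderRetracts : (cof C).IsStableUnderRetracts :=
  ⟨fun h hg => linMap_retract (.monomorphisms C) h hg⟩

variable (C) in
theorem fib_isStableUnderRetracts : (fib C).IsStableUnderRetracts :=
  ⟨fun h hg => linMap_retract (.epimorphisms C) h hg⟩

/-! ### The zero algebra as initial and terminal object. -/

section Zero

theorem od_zero_fam {V W : Lab C} (n : ℕ) : od ((0 : ∀ n, Pow V n ⟶ W) n) = 0 := rfl

theorem F_zero_fam {V W : Lab C} {r : ℕ} (n : ℕ) (h : r ≠ 0) :
    F (0 : ∀ n, Pow V n ⟶ W) r n = 0 := by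
  obtain ⟨r, rfl⟩ := Nat.exists_eq_succ_of_ne_zero h
  rw [Nat.succ_eq_add_one, F_succ]
  refine Finset.sum_eq_zero fun x _ => ?_
  rw [Pi.zero_apply, zero_tensor', comp_zero]

/-- The zero morphism between two algebras. -/
noncomputable def zeroHom (A B : AInfAlg C) : A ⟶ B :=
  homOf 0 rfl od_zero_fam (by
    funext n
    refine (Finset.sum_eq_zero fun r _ => ?_).trans (Finset.sum_eq_zero fun r _ => ?_).symm
    · exact comp_zero
    · rcases eq_or_ne r 0 with rfl | hr
      · rw [B.str_zero, comp_zero]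
      · rw [F_zero_fam n hr, zero_comp])

theorem fm_zeroHom (A B : AInfAlg C) : fm (zeroHom A B) = 0 := fm_homOf _ _ _ _

theorem shf_zero (X Y : GradedObject ℤ C) : shf (fun p => (0 : X p ⟶ Y p)) = 0 := by
  refine hom_ext (GHom.ext fun a b h => ?_) rfl
  obtain rfl : b = a := by
    have : a + ((1 : ℤ) - 1) = b := h
    omega
  exact (GHom.ofHom_v (fun p => (0 : X p ⟶ Y p)) (sub_self _) _ h).trans (GHom.zero_v _ _ _).symm

theorem shf_add {X Y : GradedObject ℤ C} (φ ψ : X ⟶ Y) :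
    shf φ + shf ψ = shf (fun p => φ p + ψ p) := by
  refine hom_ext (GHom.ext fun a b h => ?_) (add_zero _)
  obtain rfl : b = a := by
    have : a + ((1 : ℤ) - 1) = b := h
    omega
  refine (GHom.add_v _ _ _ _ _).trans (Eq.trans ?_ (GHom.ofHom_v (fun p => φ p + ψ p) (sub_self _) _ h).symm)
  exact congrArg₂ (· + ·) (GHom.ofHom_v φ (sub_self _) _ h) (GHom.ofHom_v ψ (sub_self _) _ h)

theorem linHom_zeroHom (A B : AInfAlg C) (p : ℤ) : linHom (zeroHom A B) p = 0 := by
  have h : linHom (zeroHom A B) = fun p => (0 : A.obj p ⟶ B.obj p) := by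
    apply shf_injective
    rw [← lin_fm, fm_zeroHom, shf_zero]
    exact comp_zero
  exact congrFun h p

open ZeroObject in
variable (C) in
/-- The zero algebra. -/
noncomputable def zeroAlg : AInfAlg C where
  obj := fun _ => 0
  m := 0
  m_zero := rfl
  rel _ := funext fun _ => (isZero_zero C).eq_of_tgt _ _

theorem id_zeroAlg : 𝟙 (zeroAlg C).V = 0 :=
  hom_ext (funext fun _ => (isZero_zero C).eq_of_tgt _ _) (funext fun _ =>
    (isZero_zero C).eq_of_tgt _ _)

theorem to_zeroAlg_ext {A : AInfAlg C} (f g : A ⟶ zeroAlg C) : f = g := by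
  apply fm_ext
  funext n
  rw [← Category.comp_id (fm f n), ← Category.comp_id (fm g n)]
  exact (congrArg (fun x => fm f n ≫ x) id_zeroAlg).trans
    (comp_zero.trans (comp_zero.symm.trans (congrArg (fun x => fm g n ≫ x) id_zeroAlg.symm)))

theorem from_zeroAlg_ext {A : AInfAlg C} (f g : zeroAlg C ⟶ A) : f = g := by
  apply fm_ext
  funext n
  -- Arity zero is separate: the zeroth tensor power of the zero algebra is the unit object, which
  -- need not be zero, but components of morphisms vanish there by convention.
  obtain _ | n := n
  · rw [fm_zero, fm_zero]
  · have h : 𝟙 (Pow (zeroAlg C).V (n + 1)) = 0 := by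
      refine (id_tensorHom_id (zeroAlg C).V (Pow (zeroAlg C).V n)).symm.trans ?_
      exact (congrArg (fun x => x ⊗ₘ 𝟙 _) id_zeroAlg).trans (zero_tensor' _)
    rw [← Category.id_comp (fm f _), ← Category.id_comp (fm g _), h, zero_comp, zero_comp]

variable (C) in
theorem hasTerminal : HasTerminal (AInfAlg C) :=
  (IsTerminal.ofUniqueHom (fun A => zeroHom A (zeroAlg C)) fun _ _ => to_zeroAlg_ext _ _).hasTerminal

variable (C) in
theorem hasInitial : HasInitial (AInfAlg C) :=
  (IsInitial.ofUniqueHom (fun A => zeroHom (zeroAlg C) A) fun _ _ => from_zeroAlg_ext _ _).hasInitial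

/-- For any initial or terminal object the identity coincides with the zero morphism, so no
comparison with the zero algebra is needed. -/
theorem isZero_obj_of_id_eq {T : AInfAlg C} (h : 𝟙 T = zeroHom T T) (p : ℤ) : IsZero (T.obj p) := by
  rw [IsZero.iff_id_eq_zero]
  have h1 := congrFun (congrArg linHom h) p
  rw [linHom_id, linHom_zeroHom] at h1
  exact h1

theorem fib_of_isTerminal {A T : AInfAlg C} (hT : IsTerminal T) (f : A ⟶ T) : fib C f := fun p =>
  ⟨fun _ _ _ => (isZero_obj_of_id_eq (hT.hom_ext _ _) p).eq_of_src _ _⟩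

theorem cof_of_isInitial {A I : AInfAlg C} (hI : IsInitial I) (f : I ⟶ A) : cof C f := fun p =>
  ⟨fun _ _ _ => (isZero_obj_of_id_eq (hI.hom_ext _ _) p).eq_of_tgt _ _⟩

end Zero

/-! ### Pullbacks of fibrations. -/

section Pullback

/-- The splitting of a biproduct. -/
noncomputable def SplitData.biprod (X K : GradedObject ℤ C) :
    SplitData (fun p => X p ⊞ K p) X K where
  π _ := biprod.fst
  s _ := biprod.inl
  κ _ := biprod.snd
  j _ := biprod.inr
  sπ := (shf_comp _ _).trans (congrArg shf (funext fun _ => biprod.inl_fst))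
  jκ := (shf_comp _ _).trans (congrArg shf (funext fun _ => biprod.inr_snd))
  sκ := (shf_comp _ _).trans ((congrArg shf (funext fun _ => biprod.inl_snd)).trans (shf_zero _ _))
  jπ := (shf_comp _ _).trans ((congrArg shf (funext fun _ => biprod.inr_fst)).trans (shf_zero _ _))
  add := by
    rw [shf_comp, shf_comp, shf_add]
    exact congrArg shf (funext fun _ => biprod.total)

/-- The splitting attached to a section of a morphism. -/
noncomputable def SplitData.ofSection {E B : GradedObject ℤ C} (π : E ⟶ B) (s : B ⟶ E)
    (h : s ≫ π = 𝟙 B) : SplitData E B (fun p => kernel (π p)) :=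
  have h' : ∀ p, s p ≫ π p = 𝟙 _ := fun p => congrFun h p
  { π := π
    s := s
    κ := fun p => kernel.lift (π p) (𝟙 _ - π p ≫ s p) (by simp [h'])
    j := fun p => kernel.ι (π p)
    sπ := (shf_comp _ _).trans (congrArg shf h)
    jκ := (shf_comp _ _).trans (congrArg shf (funext fun p =>
      (cancel_mono (kernel.ι (π p))).1 (by simp)))
    sκ := (shf_comp _ _).trans ((congrArg shf (funext fun p =>
      (cancel_mono (kernel.ι (π p))).1 (by simp [reassoc_of% h']))).trans (shf_zero _ _))
    jπ := (shf_comp _ _).trans ((congrArg shf (funext fun p => kernel.condition _)).trans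
      (shf_zero _ _))
    add := by
      rw [shf_comp, shf_comp, shf_add]
      exact congrArg shf (funext fun p => by simp) }

/-- Replacing the total space by an isomorphic one makes q strict, so the explicit fibre product
applies, and a pullback square is carried back along the isomorphism. -/
theorem hasPullback_of_fib [SplitMonoCategory C] {E B X : AInfAlg C} (q : E ⟶ B) (f : X ⟶ B)
    (hq : fib C q) : HasPullback q f := by
  obtain ⟨s, hs⟩ := hq.exists_section
  obtain ⟨E', e, he⟩ := exists_iso_strict_left q s hs
  obtain ⟨s', hs'⟩ := fib.exists_section (fib_comp (fib_of_isIso e.hom) hq)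
  have := hasPullback_of_strict (e.hom ≫ q) f (SplitData.ofSection _ s' hs') he
    (SplitData.biprod _ _)
  exact (IsPullback.of_iso (IsPullback.of_hasPullback (e.hom ≫ q) f) (Iso.refl _) e (Iso.refl _)
    (Iso.refl _) (fst' := pullback.fst (e.hom ≫ q) f ≫ e.hom) (by simp) (snd' := pullback.snd (e.hom ≫ q) f)
    (by simp) (by simp) (by simp)).hasPullback

end Pullback

end

end AInf

namespace AInf

/-! ### Complexes with zero products, and disks. -/

section

variable {C : Type u} [Category.{v} C] [Abelian C] [MonoidalCategory C] [MonoidalPreadditive C]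
  [HasColimits C] [∀ X : C, PreservesFilteredColimits (tensorLeft X)]
  [∀ X : C, PreservesFilteredColimits (tensorRight X)]

open Abs Lab

section Linear

variable {M : GradedObject ℤ C} (d : GHom M M 1)

/-- The identity plus a differential, as the odd part. -/
def difLab : sV M ⟶ sV M :=
  mkHom ⟨GHom.ofHom (𝟙 M) (sub_self _), GHom.recast (by change (1 : ℤ) = 1 - 1 + 1; norm_num) d⟩

theorem ev_difLab : ev (difLab d) = ev (𝟙 (sV M)) := rfl

theorem od_difLab : od (difLab d) = GHom.recast (by change (1 : ℤ) = 1 - 1 + 1; norm_num) d := rfl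

theorem ev_comp_difLab {X : Lab C} (f : X ⟶ sV M) : ev (f ≫ difLab d) = ev f := by
  rw [ev_comp, ev_difLab, ← ev_comp, Category.comp_id]

theorem ev_difLab_comp {X : Lab C} (f : sV M ⟶ X) : ev (difLab d ≫ f) = ev f := by
  rw [ev_comp, ev_difLab, ← ev_comp, Category.id_comp]

/-- The family has no component outside arity one, so the square reduces to that of d. -/
theorem sqc_st_difLab (hd : GHom.comp d d (t := 2) (by norm_num) = 0) (n : ℕ) :
    sqc (st (difLab d)) n = 0 := by
  have h : oo (difLab d) (difLab d) = 0 := by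
    rw [oo, od_difLab, GHom.comp_recast, GHom.recast_comp']
    have h1 := congrArg (GHom.recast (s := (sV M).deg - (sV M).deg + 2) (by norm_num)) hd
    rw [GHom.recast_comp, GHom.recast_zero] at h1
    exact h1
  refine Finset.sum_eq_zero fun r _ => ?_
  rcases eq_or_ne r 1 with rfl | hr
  · rw [F_one, st_one]
    refine (oo_even_mid _ _ _ rfl).trans ?_
    rw [Category.assoc, Iso.inv_hom_id, Category.comp_id, st, post,
      even_comp_oo _ _ _ (od_one' _ n), h, GHom.comp_zero]
  · rw [st_ne _ hr]
    exact oo_zero_right _ _ rfl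

/-- A complex as an algebra with vanishing products. -/
noncomputable abbrev linAlg (hd : GHom.comp d d (t := 2) (by norm_num) = 0) : AInfAlg C :=
  algOf M (st (difLab d)) (st_zero _)
    (fun n => (ev_comp_difLab d (one (sV M) n))) (sqc_st_difLab d hd)

theorem str_linAlg (hd : GHom.comp d d (t := 2) (by norm_num) = 0) :
    (linAlg d hd).str = st (difLab d) := str_algOf _ _ _ _ _

theorem dif_linAlg (hd : GHom.comp d d (t := 2) (by norm_num) = 0) : dif (linAlg d hd) = d := by
  have h := od_lin_str (linAlg d hd)
  rw [str_linAlg, lin_st, od_difLab] at h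
  have h1 := congrArg (GHom.recast (s := 1) (by change (1 : ℤ) - 1 + 1 = 1; norm_num)) h
  exact (GHom.recast_cancel _ _ _).symm.trans (h1.symm.trans (GHom.recast_cancel _ _ _))

end Linear

/-- A decomposition of a graded object as the sum of another one and its shift. -/
structure Disk (M D : GradedObject ℤ C) where
  i : M ⟶ D
  π : D ⟶ M
  j : GHom M D (-1)
  ϖ : GHom D M 1
  iπ : i ≫ π = 𝟙 _
  iϖ : GHom.comp (GHom.ofHom i rfl) ϖ (zero_add 1) = 0
  jπ : GHom.comp j (GHom.ofHom π rfl) (add_zero (-1)) = 0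
  jϖ : GHom.comp j ϖ (neg_add_cancel 1) = GHom.ofHom (𝟙 M) rfl
  add : GHom.ofHom (π ≫ i) rfl + GHom.comp ϖ j (add_neg_cancel 1) = GHom.ofHom (𝟙 D) rfl

/-- The sum of a graded object and its shift. -/
noncomputable def disk (M : GradedObject ℤ C) : Disk M (fun p => M p ⊞ M (p + 1)) where
  i _ := biprod.inl
  π _ := biprod.fst
  j := GHom.mk fun p q h => eqToHom (by rw [← h]; simp) ≫ biprod.inr
  ϖ := GHom.mk fun p q h => biprod.snd ≫ eqToHom (by rw [h])
  iπ := funext fun _ => biprod.inl_fst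
  iϖ := GHom.ext fun p q h => by
    rw [GHom.comp_v _ _ _ p p q (add_zero p) h, GHom.ofHom_v, GHom.mk_v, GHom.zero_v,
      biprod.inl_snd_assoc, zero_comp]
  jπ := GHom.ext fun p q h => by
    rw [GHom.comp_v _ _ _ p q q h (add_zero q), GHom.ofHom_v, GHom.mk_v, GHom.zero_v,
      Category.assoc, biprod.inr_fst, comp_zero]
  jϖ := GHom.ext fun p q h => by
    obtain rfl : q = p := by omega
    rw [GHom.comp_v _ _ _ q (q + -1) q rfl (by omega), GHom.ofHom_v, GHom.mk_v, GHom.mk_v,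
      Category.assoc, biprod.inr_snd_assoc, eqToHom_trans]
    rfl
  add := GHom.ext fun p q h => by
    obtain rfl : q = p := by omega
    rw [GHom.add_v, GHom.comp_v _ _ _ q (q + 1) q rfl (by omega), GHom.ofHom_v, GHom.ofHom_v,
      GHom.mk_v, GHom.mk_v, Category.assoc, eqToHom_trans_assoc]
    simp only [eqToHom_refl, Category.id_comp]
    exact biprod.total

namespace Disk

variable {M D : GradedObject ℤ C} (S : Disk M D)

/-- The differential of a disk. -/
def d : GHom D D 1 := GHom.comp S.ϖ (GHom.ofHom S.i rfl) (add_zero 1)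

theorem ofHom_i_d : GHom.comp (GHom.ofHom S.i rfl) S.d (zero_add 1) = 0 := by
  rw [d, ← GHom.comp_assoc _ _ _ (zero_add 1) (add_zero 1) (add_zero 1), S.iϖ, GHom.zero_comp]

theorem j_d : GHom.comp S.j S.d (neg_add_cancel 1) = GHom.ofHom S.i rfl := by
  rw [d, ← GHom.comp_assoc _ _ _ (neg_add_cancel 1) (add_zero 1) (add_zero 0), S.jϖ,
    GHom.ofHom_comp, Category.id_comp]

theorem d_d : GHom.comp S.d S.d (t := 2) (by norm_num) = 0 := by
  conv_lhs => arg 1; rw [d]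
  rw [GHom.comp_assoc _ _ _ (add_zero 1) (zero_add 1) (by norm_num), S.ofHom_i_d, GHom.comp_zero]

/-- With h equal to π followed by j one finds dh = ϖj and hd = πi, which add up to the identity. -/
theorem contraction : GHom.comp S.d (GHom.comp (GHom.ofHom S.π rfl) S.j (zero_add (-1)))
      (add_neg_cancel 1) + GHom.comp (GHom.comp (GHom.ofHom S.π rfl) S.j (zero_add (-1))) S.d
      (neg_add_cancel 1) = GHom.ofHom (𝟙 D) rfl := by
  rw [GHom.comp_assoc (GHom.ofHom S.π rfl) S.j S.d (zero_add (-1)) (neg_add_cancel 1)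
    (neg_add_cancel 1), S.j_d, GHom.ofHom_comp, d,
    ← GHom.comp_assoc _ _ _ (add_zero 1) (zero_add (-1)) (add_neg_cancel 1),
    GHom.comp_assoc S.ϖ _ _ (add_zero 1) (add_zero 0) (add_zero 1), GHom.ofHom_comp, S.iπ,
    GHom.comp_ofHom_id, GHom.recast_rfl, add_comm, S.add]

/-- The acyclic algebra attached to a disk. -/
noncomputable abbrev alg : AInfAlg C := linAlg S.d S.d_d

end Disk

end

end AInf

namespace AInf

/-! ### The morphism from an algebra to its disk, and products. -/

section

variable {C : Type u} [Category.{v} C] [Abelian C] [MonoidalCategory C] [MonoidalPreadditive C]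
  [HasColimits C] [∀ X : C, PreservesFilteredColimits (tensorLeft X)]
  [∀ X : C, PreservesFilteredColimits (tensorRight X)]

open Abs Lab

section ToDisk

variable (A : AInfAlg C) {D : GradedObject ℤ C} (S : Disk A.obj D)

/-- The odd part of the structure followed by a shift. -/
noncomputable def strShift (n : ℕ) : Pow A.V n ⟶ sV D :=
  evenL (GHom.comp (od (A.str n)) S.j (by change (1 : ℤ) - _ + 1 + -1 = 1 - _; ring))

theorem strShift_zero : strShift A S 0 = 0 := by
  rw [strShift, A.str_zero, od_zero, GHom.zero_comp]
  rfl

/-- The odd part of this composite is the square of the structure coderivation followed by the shift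
j, and the square is zero. -/
theorem od_comp_strShift (n : ℕ) : od (Abs.comp A.str (strShift A S) n) = 0 := by
  have h : od (Abs.comp A.str (strShift A S) n) = GHom.comp (sqc A.str n) S.j
      (by change (1 : ℤ) - _ + 2 + -1 = 1 - _ + 1; ring) := by
    rw [Abs.comp, od_sum, sqc, GHom.sum_comp]
    refine Finset.sum_congr rfl fun r _ => ?_
    rw [od_comp_even _ _ rfl, oo]
    exact (GHom.comp_assoc (bc := (sV D).deg - (Pow A.V r).deg) _ _ _ (by ring)
      (by change (1 : ℤ) - _ + 1 + -1 = 1 - _; ring)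
      (by change (1 : ℤ) - _ + 2 + -1 = 1 - _ + 1; ring)).symm
  rw [h, A.sqc_str, GHom.zero_comp]

/-- The family of the morphism to the disk of an algebra. -/
noncomputable def toDiskFam : ∀ n, Pow A.V n ⟶ sV D := st (shf S.i) + strShift A S

theorem toDiskFam_zero : toDiskFam A S 0 = 0 := by
  rw [toDiskFam, Pi.add_apply, st_zero, strShift_zero, add_zero]

theorem od_toDiskFam (n : ℕ) : od (toDiskFam A S n) = 0 :=
  od_fadd _ _ (od_st _ rfl) (fun _ => rfl) n

theorem ev_shf {X Y : GradedObject ℤ C} (φ : X ⟶ Y) :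
    ev (shf φ) = GHom.recast (by change (0 : ℤ) = 1 - 1; norm_num) (GHom.ofHom φ rfl) :=
  (GHom.recast_ofHom φ rfl _).symm

theorem od_st_i_difLab (n : ℕ) : od (st (shf S.i) n ≫ difLab S.d) = 0 := by
  have h : od (shf S.i ≫ difLab S.d) = 0 := by
    rw [od_even_comp _ _ rfl, od_difLab, ev_shf, GHom.comp_recast, GHom.recast_comp']
    have h1 := congrArg (GHom.recast (s := (sV D).deg - (sV A.obj).deg + 1)
      (by change (1 : ℤ) = 1 - 1 + 1; norm_num)) S.ofHom_i_d
    rw [GHom.recast_comp, GHom.recast_zero] at h1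
    exact h1
  rw [st, post, Category.assoc, od_even_comp _ _ (od_one' _ n), h, GHom.comp_zero]

theorem od_strShift_difLab (n : ℕ) : od (strShift A S n ≫ difLab S.d) =
    od (A.str n ≫ shf S.i) := by
  rw [od_even_comp _ _ rfl, od_comp_even _ _ rfl, od_difLab, ev_shf, GHom.comp_recast,
    GHom.comp_recast, ← S.j_d]
  exact GHom.comp_assoc (od (A.str n)) S.j S.d
    (by change (1 : ℤ) - _ + 1 + -1 = 1 - _; ring) (neg_add_cancel 1) rfl

/-- The linear inclusion i is completed by m followed by j. Since jd = i and id = 0, applying the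
differential of the disk yields m followed by i. Precomposing with the structure yields the same,
because the contribution of j is the square of m, which vanishes. -/
theorem toDiskFam_comm : Abs.comp A.str (toDiskFam A S) =
    Abs.comp (toDiskFam A S) (st (difLab S.d)) := by
  rw [comp_st _ (toDiskFam_zero A S)]
  funext n
  refine hom_ext ?_ ?_
  · rw [ev_str_comp, post, ev_comp_difLab]
  · rw [toDiskFam, comp_add, Pi.add_apply, od_add, od_comp_strShift, add_zero,
      comp_st _ A.str_zero, post_add, Pi.add_apply, od_add]
    exact ((zero_add _).symm.trans (congrArg₂ (· + ·) (od_st_i_difLab A S n).symm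
      (od_strShift_difLab A S n).symm))

/-- The morphism from an algebra to its disk. -/
noncomputable def toDisk : A ⟶ S.alg :=
  homOf (B := S.alg) (toDiskFam A S) (toDiskFam_zero A S) (od_toDiskFam A S) (by
    rw [str_linAlg]; exact toDiskFam_comm A S)

end ToDisk

/-- The components of the contraction of a disk. -/
noncomputable def Disk.hom {M D : GradedObject ℤ C} (S : Disk M D) (p q : ℤ) :
    (toComplex S.alg).X p ⟶ (toComplex S.alg).X q :=
  if h : p + -1 = q then (GHom.comp (GHom.ofHom S.π rfl) S.j (zero_add (-1))).v p q h else 0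

/-- The contraction of a disk. -/
noncomputable def Disk.homotopy {M D : GradedObject ℤ C} (S : Disk M D) :
    Homotopy (𝟙 (toComplex S.alg)) 0 where
  hom := S.hom
  zero p q h := dif_neg fun h' => h (show q + 1 = p by omega)
  comm p := by
    rw [dNext_eq _ (show (ComplexShape.up ℤ).Rel p (p + 1) from rfl),
      prevD_eq _ (show (ComplexShape.up ℤ).Rel (p - 1) p by simp)]
    have h := congrArg (fun x => GHom.v x p p (add_zero p)) S.contraction
    rw [GHom.add_v, GHom.comp_v _ _ _ p (p + 1) p rfl (by ring),
      GHom.comp_v _ _ _ p (p - 1) p (by ring) (by ring), GHom.ofHom_v] at h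
    have h1 : ∀ a b h, (toComplex S.alg).d a b = S.d.v a b h := fun a b h =>
      (dif_v _ _ _ h).symm.trans (congrArg (fun x => GHom.v x a b h) (dif_linAlg _ _))
    have h2 : ∀ a b h, S.hom a b =
      (GHom.comp (GHom.ofHom S.π rfl) S.j (zero_add (-1))).v a b h := fun a b h => dif_pos h
    refine Eq.trans ?_ (add_zero _).symm
    refine h.symm.trans (congrArg₂ (· + ·) (congrArg₂ (· ≫ ·) (h1 _ _ _).symm (h2 _ _ _).symm)
      (congrArg₂ (· ≫ ·) (h2 _ _ _).symm (h1 _ _ _).symm))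

section Prod

/-- The splitting of the morphism to the zero algebra. -/
noncomputable def zeroSplit (E : AInfAlg C) : SplitData E.obj (zeroAlg C).obj E.obj where
  π := fun _ => 0
  s := fun _ => 0
  κ := 𝟙 _
  j := 𝟙 _
  sπ := (congrArg (_ ≫ ·) (shf_zero _ _)).trans (comp_zero.trans id_zeroAlg.symm)
  jκ := Category.comp_id _
  sκ := (Category.comp_id _).trans (shf_zero _ _)
  jπ := (Category.id_comp _).trans (shf_zero _ _)
  add := by
    rw [shf_zero, shf_id, zero_comp, zero_add, Category.comp_id]

theorem fm_zeroHom_eq_st (E : AInfAlg C) :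
    fm (zeroHom E (zeroAlg C)) = st (shf (zeroSplit E).π) := by
  rw [fm_zeroHom]
  exact funext fun n => ((congrArg (one E.V n ≫ ·) (shf_zero _ _)).trans comp_zero).symm

variable (X E : AInfAlg C)

/-- The product of two algebras. -/
noncomputable abbrev prod : AInfAlg C :=
  pb (zeroHom E (zeroAlg C)) (zeroHom X (zeroAlg C)) (zeroSplit E) (fm_zeroHom_eq_st E)
    (SplitData.biprod X.obj E.obj)

/-- The first projection. -/
noncomputable def prodFst : prod X E ⟶ X := pbSnd _ _ _ _ _

/-- The second projection. -/
noncomputable def prodSnd : prod X E ⟶ E := pbFst _ _ _ _ _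

variable {X E} in
/-- The morphism to a product. -/
noncomputable def prodLift {Z : AInfAlg C} (a : Z ⟶ X) (c : Z ⟶ E) : Z ⟶ prod X E :=
  pbLift _ _ _ _ _ c a (to_zeroAlg_ext _ _)

theorem prodLift_fst {Z : AInfAlg C} (a : Z ⟶ X) (c : Z ⟶ E) :
    prodLift a c ≫ prodFst X E = a := pbLift_snd _ _ _ _ _ _ _ _

theorem prodLift_snd {Z : AInfAlg C} (a : Z ⟶ X) (c : Z ⟶ E) :
    prodLift a c ≫ prodSnd X E = c := pbLift_fst _ _ _ _ _ _ _ _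

theorem linHom_prodFst : linHom (prodFst X E) = fun _ => biprod.fst := by
  apply shf_injective
  rw [← lin_fm, prodFst, fm_pbSnd, lin_st]
  rfl

theorem linHom_prodSnd : linHom (prodSnd X E) = fun _ => biprod.snd := by
  apply shf_injective
  rw [← lin_fm, prodSnd, fm_pbFst]
  exact (Category.comp_id _).symm.trans
    (lin_pbTop (zeroHom X (zeroAlg C)) (zeroSplit E) (SplitData.biprod X.obj E.obj))

variable {X E} in
theorem prod_linHom_ext {N : GradedObject ℤ C} {φ ψ : N ⟶ (prod X E).obj}
    (h1 : φ ≫ linHom (prodFst X E) = ψ ≫ linHom (prodFst X E))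
    (h2 : φ ≫ linHom (prodSnd X E) = ψ ≫ linHom (prodSnd X E)) : φ = ψ := by
  rw [linHom_prodFst] at h1
  rw [linHom_prodSnd] at h2
  exact funext fun p => biprod.hom_ext _ _ (congrFun h1 p) (congrFun h2 p)

theorem isStrict_prodLift_id_zero : IsStrict (prodLift (𝟙 X) (zeroHom X E)) := by
  refine isStrict_of_eq (l := shf (SplitData.biprod X.obj E.obj).s) ?_
  rw [prodLift, fm_pbLift, pbLiftFam, fm_id, fm_zeroHom]
  refine (congrArg (_ + ·) (funext fun n => ?_)).trans (add_zero _)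
  exact (congrArg (· ≫ _) zero_comp).trans zero_comp

/-- This is the biproduct identity of complexes. Both injections are linear parts of morphisms of
algebras, so they commute with the differentials, and the identity may be tested on the graded
biproduct. -/
theorem prod_add : linMap (prodFst X E) ≫ linMap (prodLift (𝟙 X) (zeroHom X E)) +
    linMap (prodSnd X E) ≫ linMap (prodLift (zeroHom E X) (𝟙 E)) = 𝟙 _ := by
  have h : (fun p => (linHom (prodFst X E) ≫ linHom (prodLift (𝟙 X) (zeroHom X E))) p +
      (linHom (prodSnd X E) ≫ linHom (prodLift (zeroHom E X) (𝟙 E))) p) =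
      𝟙 (prod X E).obj := by
    refine prod_linHom_ext ?_ ?_
    · funext p
      refine (Preadditive.add_comp _ _ _ _ _ _).trans ?_
      have h1 := congrFun (congrArg linHom (prodLift_fst X E (𝟙 X) (zeroHom X E))) p
      have h2 := congrFun (congrArg linHom (prodLift_fst X E (zeroHom E X) (𝟙 E))) p
      rw [linHom_comp] at h1 h2
      rw [linHom_id] at h1
      rw [linHom_zeroHom] at h2
      refine (congrArg₂ (· + ·) ((Category.assoc _ _ _).trans (congrArg _ h1))
        ((Category.assoc _ _ _).trans (congrArg _ h2))).trans ?_
      refine (congrArg₂ (· + ·) (Category.comp_id _) comp_zero).trans ?_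
      exact (add_zero _).trans (Category.id_comp _).symm
    · funext p
      refine (Preadditive.add_comp _ _ _ _ _ _).trans ?_
      have h1 := congrFun (congrArg linHom (prodLift_snd X E (𝟙 X) (zeroHom X E))) p
      have h2 := congrFun (congrArg linHom (prodLift_snd X E (zeroHom E X) (𝟙 E))) p
      rw [linHom_comp] at h1 h2
      rw [linHom_zeroHom] at h1
      rw [linHom_id] at h2
      refine (congrArg₂ (· + ·) ((Category.assoc _ _ _).trans (congrArg _ h1))
        ((Category.assoc _ _ _).trans (congrArg _ h2))).trans ?_
      refine (congrArg₂ (· + ·) comp_zero (Category.comp_id _)).trans ?_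
      exact (zero_add _).trans (Category.id_comp _).symm
  ext p
  exact congrFun h p

-- On complexes the product is a direct sum, and a contractible summand may be dropped up to
-- homotopy equivalence.
variable {X E} in
theorem weq_prodFst (h : Homotopy (𝟙 (toComplex E)) 0) : weq C (prodFst X E) := by
  let e : HomotopyEquiv (toComplex (prod X E)) (toComplex X) :=
    { hom := linMap (prodFst X E)
      inv := linMap (prodLift (𝟙 X) (zeroHom X E))
      homotopyHomInvId := ((Homotopy.ofEq (prod_add X E).symm).trans
        ((Homotopy.ofEq (by rw [Category.id_comp])).trans
        (((Homotopy.refl _).add ((h.compRight (linMap (prodLift (zeroHom E X) (𝟙 E)))).compLeft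
          (linMap (prodSnd X E)))).trans
          (Homotopy.ofEq (by rw [zero_comp, comp_zero, add_zero]))))).symm
      homotopyInvHomId := Homotopy.ofEq (by
        rw [← linMap_comp, prodLift_fst]
        exact (linFunctor C).map_id X) }
  exact e.quasiIso_hom

end Prod

end

end AInf

namespace AInf

/-! ### Factorizations. -/

section

variable {C : Type u} [Category.{v} C] [Abelian C] [MonoidalCategory C] [MonoidalPreadditive C]
  [HasColimits C] [∀ X : C, PreservesFilteredColimits (tensorLeft X)]
  [∀ X : C, PreservesFilteredColimits (tensorRight X)]

open Abs Lab

theorem cof_of_retraction {A B : AInfAlg C} {i : A ⟶ B} (ρ : B.obj ⟶ A.obj)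
    (h : linHom i ≫ ρ = 𝟙 _) : cof C i := fun p => by
  have h1 : (linMap i).f p ≫ ρ p = 𝟙 _ := congrFun h p
  exact (SplitMono.mk (ρ p) h1).mono

theorem fib_of_section {E B : AInfAlg C} {q : E ⟶ B} (s : B.obj ⟶ E.obj)
    (h : s ≫ linHom q = 𝟙 _) : fib C q := fun p => by
  have h1 : s p ≫ (linMap q).f p = 𝟙 _ := congrFun h p
  exact (SplitEpi.mk (s p) h1).epi

theorem fib_prodFst (X E : AInfAlg C) : fib C (prodFst X E) :=
  fib_of_section (linHom (prodLift (𝟙 X) (zeroHom X E))) (by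
    rw [← linHom_comp, prodLift_fst, linHom_id])

theorem cof_prodLift_id (X E : AInfAlg C) : cof C (prodLift (𝟙 X) (zeroHom X E)) :=
  cof_of_retraction (linHom (prodFst X E)) (by rw [← linHom_comp, prodLift_fst, linHom_id])

theorem strShift_π (A : AInfAlg C) {D : GradedObject ℤ C} (S : Disk A.obj D) (n : ℕ) :
    strShift A S n ≫ shf S.π = 0 := by
  refine hom_ext ?_ (od_comp_zero _ _ rfl rfl)
  rw [ev_comp, ev_shf, GHom.comp_recast]
  refine (GHom.comp_assoc (od (A.str n)) S.j (GHom.ofHom S.π rfl)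
    (by change (1 : ℤ) - _ + 1 + -1 = 1 - _; ring) (add_zero (-1)) (add_zero _)).trans ?_
  rw [S.jπ, GHom.comp_zero]
  rfl

/-- The correcting term takes values in the shifted summand, which π kills, so the linear part is
split by π. -/
theorem linHom_toDisk (A : AInfAlg C) {D : GradedObject ℤ C} (S : Disk A.obj D) :
    linHom (toDisk A S) ≫ S.π = 𝟙 _ := by
  apply shf_injective
  rw [← shf_comp, ← lin_fm, toDisk, fm_homOf, ← lin_post, toDiskFam, post_add, post_st, shf_comp,
    S.iπ, shf_id, st_id]
  exact (congrArg lin ((congrArg (one A.V + ·) (funext (strShift_π A S))).trans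
    (add_zero _))).trans lin_one

-- Pair f with the morphism to the disk on A. The second component makes the linear part a split
-- monomorphism, and projecting away a contractible factor is an acyclic fibration.
variable (C) in
theorem hasFactorization_cof_fib_weq :
    MorphismProperty.HasFactorization (cof C) (fib C ⊓ weq C) where
  nonempty_mapFactorizationData {A B} f := ⟨
    { Z := prod B (disk A.obj).alg
      i := prodLift f (toDisk A (disk A.obj))
      p := prodFst _ _
      fac := prodLift_fst _ _ _ _
      hi := cof_of_retraction (linHom (prodSnd B (disk A.obj).alg) ≫ (disk A.obj).π) (by
        refine (Category.assoc _ _ _).symm.trans ?_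
        rw [← linHom_comp, prodLift_snd, linHom_toDisk])
      hp := ⟨fib_prodFst _ _, weq_prodFst (disk A.obj).homotopy⟩ }⟩

theorem GHom.exists_ofHom {M L : GradedObject ℤ C} (f : GHom M L 0) :
    ∃ φ : M ⟶ L, GHom.ofHom φ rfl = f :=
  ⟨fun p => f.v p p (add_zero p), GHom.ext fun p q h => by
    obtain rfl : q = p := by omega
    rw [GHom.ofHom_v]⟩

theorem GHom.ofHom_injective {M L : GradedObject ℤ C} {φ ψ : M ⟶ L}
    (h : GHom.ofHom φ rfl = GHom.ofHom ψ rfl) : φ = ψ := by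
  funext p
  have h1 := congrArg (fun x => GHom.v x p p (add_zero p)) h
  rwa [GHom.ofHom_v, GHom.ofHom_v] at h1

theorem exists_shift (B : GradedObject ℤ C) : ∃ (M : GradedObject ℤ C) (t : GHom M B (-1))
    (t' : GHom B M 1), GHom.comp t' t (add_neg_cancel 1) = GHom.ofHom (𝟙 B) rfl :=
  ⟨fun p => B (p - 1), GHom.mk fun p q h => eqToHom (by rw [← h]; rfl),
    GHom.mk fun p q h => eqToHom (by rw [← h]; simp), GHom.ext fun p q h => by
      obtain rfl : q = p := by omega
      rw [GHom.comp_v _ _ _ q (q + 1) q rfl (by omega), GHom.mk_v, GHom.mk_v, GHom.ofHom_v,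
        eqToHom_trans]
      rfl⟩

/-- Every complex is a quotient of a disk. -/
theorem exists_disk_cover (B : AInfAlg C) : ∃ (M D : GradedObject ℤ C) (S : Disk M D)
    (τ : D ⟶ B.obj) (σ : B.obj ⟶ D), σ ≫ τ = 𝟙 _ ∧
    GHom.comp S.d (GHom.ofHom τ rfl) (add_zero 1) =
      GHom.comp (GHom.ofHom τ rfl) (dif B) (zero_add 1) := by
  obtain ⟨M, t, t', ht⟩ := exists_shift B.obj
  let S := disk M
  -- In degree p the disk is B^{p-1} ⊕ B^p up to identifications, and τ sends (b', b) to db' + b: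
  -- the choice on the second summand forces the first, if τ is to respect the differentials.
  obtain ⟨τ, hτ⟩ := GHom.exists_ofHom (GHom.comp S.ϖ t (add_neg_cancel 1) +
    GHom.comp (GHom.ofHom S.π rfl) (GHom.comp t (dif B) (neg_add_cancel 1)) (add_zero 0))
  -- The section places B in the second summand; it does not commute with the differentials, and it
  -- need not.
  obtain ⟨σ, hσ⟩ := GHom.exists_ofHom (GHom.comp t' S.j (add_neg_cancel 1))
  refine ⟨M, _, S, τ, σ, GHom.ofHom_injective ?_, ?_⟩
  · rw [← GHom.ofHom_comp σ τ rfl rfl (add_zero 0), hτ, hσ, GHom.comp_add,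
      GHom.comp_assoc t' S.j (GHom.comp S.ϖ t _) (add_neg_cancel 1) (add_zero (-1)) (add_zero 0),
      GHom.comp_assoc t' S.j (GHom.comp (GHom.ofHom S.π rfl) _ _) (add_neg_cancel 1)
        (add_zero (-1)) (add_zero 0),
      ← GHom.comp_assoc S.j S.ϖ t (neg_add_cancel 1) (add_neg_cancel 1) (zero_add (-1)),
      ← GHom.comp_assoc S.j (GHom.ofHom S.π rfl) _ (add_zero (-1)) (add_zero 0)
        (add_zero (-1)), S.jϖ, S.jπ, GHom.zero_comp, GHom.comp_zero, add_zero,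
      GHom.ofHom_id_comp, GHom.recast_rfl, ht]
  · have h1 : GHom.comp S.d (GHom.ofHom τ rfl) (add_zero 1) =
        GHom.comp S.ϖ (GHom.comp t (dif B) (neg_add_cancel 1)) (add_zero 1) := by
      rw [hτ, GHom.comp_add, Disk.d,
        GHom.comp_assoc S.ϖ (GHom.ofHom S.i rfl) (GHom.comp S.ϖ t _) (add_zero 1) (add_zero 0)
          (add_zero 1),
        GHom.comp_assoc S.ϖ (GHom.ofHom S.i rfl) (GHom.comp (GHom.ofHom S.π rfl) _ _)
          (add_zero 1) (add_zero 0) (add_zero 1),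
        ← GHom.comp_assoc (GHom.ofHom S.i rfl) S.ϖ t (zero_add 1) (add_neg_cancel 1)
          (add_neg_cancel 1),
        ← GHom.comp_assoc (GHom.ofHom S.i rfl) (GHom.ofHom S.π rfl) _ (add_zero 0) (add_zero 0)
          (add_zero 0), S.iϖ, GHom.ofHom_comp, S.iπ, GHom.zero_comp, GHom.comp_zero, zero_add,
        GHom.ofHom_id_comp, GHom.recast_rfl]
    rw [h1, hτ, GHom.add_comp,
      GHom.comp_assoc S.ϖ t (dif B) (add_neg_cancel 1) (neg_add_cancel 1) (zero_add 1),
      GHom.comp_assoc (GHom.ofHom S.π rfl) _ (dif B) (add_zero 0) (zero_add 1) (zero_add 1),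
      GHom.comp_assoc t (dif B) (dif B) (neg_add_cancel 1) (bc := 2) (by norm_num) (zero_add 1),
      dif_comp_dif, GHom.comp_zero, GHom.comp_zero, add_zero]

theorem difLab_comp_shf {M D : GradedObject ℤ C} (S : Disk M D) (B : AInfAlg C) (τ : D ⟶ B.obj)
    (h : GHom.comp S.d (GHom.ofHom τ rfl) (add_zero 1) =
      GHom.comp (GHom.ofHom τ rfl) (dif B) (zero_add 1)) :
    difLab S.d ≫ shf τ = shf τ ≫ lin B.str := by
  refine hom_ext ?_ ?_
  · rw [ev_difLab_comp, ev_comp, ev_lin_str, ← ev_comp, Category.comp_id]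
  · rw [od_comp_even _ _ rfl, od_even_comp _ _ rfl, od_lin_str, od_difLab, ev_shf,
      GHom.comp_recast, GHom.comp_recast, GHom.recast_comp', GHom.recast_comp']
    have h1 := congrArg (GHom.recast (s := (sV B.obj).deg - (sV D).deg + 1)
      (by change (1 : ℤ) = 1 - 1 + 1; norm_num)) h
    rw [GHom.recast_comp, GHom.recast_comp] at h1
    exact h1

section Extend

variable {A B : AInfAlg C} (f : A ⟶ B) {M D : GradedObject ℤ C} (S : Disk M D) (τ : D ⟶ B.obj)

/-- The family extending a morphism to a product with a disk. -/
noncomputable def extendFam : ∀ n, Pow (prod A S.alg).V n ⟶ B.V :=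
  fm (prodFst A S.alg ≫ f) + post (fm (prodSnd A S.alg)) (shf τ)

theorem extendFam_zero : extendFam f S τ 0 = 0 :=
  (congrArg₂ (· + ·) (fm_zero _) (post_zero _ _ (fm_zero _))).trans (add_zero _)

theorem lin_extendFam : lin (extendFam f S τ) =
    lin (fm (prodFst A S.alg ≫ f)) + lin (fm (prodSnd A S.alg)) ≫ shf τ := by
  rw [extendFam, lin_add, lin_post]

theorem lin_fm_comm {X Y : AInfAlg C} (f : X ⟶ Y) :
    lin X.str ≫ lin (fm f) = lin (fm f) ≫ lin Y.str := by
  rw [← lin_comp, fm_comm, lin_comp]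

theorem lin_str_extendFam (h : GHom.comp S.d (GHom.ofHom τ rfl) (add_zero 1) =
      GHom.comp (GHom.ofHom τ rfl) (dif B) (zero_add 1)) :
    lin (prod A S.alg).str ≫ lin (extendFam f S τ) = lin (extendFam f S τ) ≫ lin B.str := by
  have h1 := lin_fm_comm (prodSnd A S.alg)
  rw [str_linAlg, lin_st] at h1
  rw [lin_extendFam, Preadditive.comp_add, Preadditive.add_comp, lin_fm_comm]
  refine congrArg (_ + ·) ?_
  refine (Category.assoc _ _ _).symm.trans ((congrArg (· ≫ shf τ) h1).trans ?_)
  rw [Category.assoc, Category.assoc]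
  exact congrArg (_ ≫ ·) (difLab_comp_shf S B τ h)

/-- The square has the inclusion A → A × D on the left and B → 0 on the right. The family is a sum
of two maps, so it need not be a morphism, but its linear part is a sum of morphisms of complexes.
Its defects therefore vanish through arity one and the correction can start at arity two. -/
theorem extendFam_partialLift (h : GHom.comp S.d (GHom.ofHom τ rfl) (add_zero 1) =
      GHom.comp (GHom.ofHom τ rfl) (dif B) (zero_add 1)) :
    PartialLift f (zeroHom (prod A S.alg) (zeroAlg C))
      (linHom (prodLift (𝟙 A) (zeroHom A S.alg))) (zeroSplit B).π (extendFam f S τ) 2 where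
  zero := extendFam_zero f S τ
  od_eq k := od_fadd _ _ (od_fm _) (od_post _ _ (od_fm _) rfl) k
  left k := by
    have h1 : Abs.comp (fm (prodLift (𝟙 A) (zeroHom A S.alg))) (extendFam f S τ) = fm f := by
      rw [extendFam, comp_add, ← fm_comp, comp_post, ← fm_comp, prodLift_snd,
        ← Category.assoc, prodLift_fst, Category.id_comp, fm_zeroHom]
      refine (congrArg (fm f + ·) (a₂ := 0) ?_).trans (add_zero (fm f))
      exact funext fun _ => zero_comp
    rw [isStrict_prodLift_id_zero] at h1
    exact (st_comp _ _ _).symm.trans (congrFun h1 k)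
  right k := by
    rw [fm_zeroHom]
    exact (congrArg (_ ≫ ·) (shf_zero _ _)).trans comp_zero
  defect_eq k hk := by
    change _ - _ = _
    obtain rfl | rfl : k = 0 ∨ k = 1 := by omega
    · rw [comp_apply_zero _ _ (extendFam_zero f S τ), comp_apply_zero _ _ B.str_zero, sub_self]
    · refine (congrArg₂ (· - ·) (eq_lin _) (eq_lin _)).trans ?_
      rw [lin_comp, lin_comp, lin_str_extendFam f S τ h, sub_self]

end Extend

-- Enlarge A by a contractible disk covering B. The inclusion of A in the product is an acyclic
-- cofibration, and the extension of f to the product is an epimorphism on linear parts as soon as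
-- its linear part restricts to the cover on the disk.
variable (C) in
theorem hasFactorization_cof_weq_fib [SplitMonoCategory C] :
    MorphismProperty.HasFactorization (cof C ⊓ weq C) (fib C) where
  nonempty_mapFactorizationData {A B} f := by
    obtain ⟨M, D, S, τ, σ, hσ, hτ⟩ := exists_disk_cover B
    have hc := cof_prodLift_id A S.alg
    have hw : weq C (prodLift (𝟙 A) (zeroHom A S.alg)) := by
      have := weq_hasTwoOutOfThree C
      -- The inclusion is a section of a projection that is a weak equivalence.
      refine (weq C).of_postcomp _ (prodFst A S.alg) (weq_prodFst S.homotopy) ?_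
      rw [prodLift_fst]
      exact weq_of_isIso _
    obtain ⟨l, hl, _, hg⟩ := exists_lift (isStrict_prodLift_id_zero A S.alg) (fm_zeroHom_eq_st B)
      (extendFam_partialLift f S τ hτ) two_ne_zero
      fun k _ => solvable_of_cof hc hw (zeroSplit B).π k
    refine ⟨⟨_, _, l, hl, ⟨hc, hw⟩, fib_of_section
      (σ ≫ linHom (prodLift (zeroHom S.alg A) (𝟙 S.alg))) (Eq.trans ?_ hσ)⟩⟩
    refine (Category.assoc _ _ _).trans (congrArg (σ ≫ ·) (shf_injective ?_))
    -- The corrections begin in arity two, so the linear part of the lift is the prescribed one,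
    -- which restricts to τ on the disk.
    have h1 : lin (fm l) = lin (extendFam f S τ) := congrArg (_ ≫ ·) (hg 1 one_lt_two)
    have e1 : lin (fm (prodLift (zeroHom S.alg A) (𝟙 S.alg))) ≫ lin (fm (prodFst A S.alg)) = 0 := by
      rw [← lin_comp, ← fm_comp, prodLift_fst, fm_zeroHom]
      exact comp_zero
    have e2 : lin (fm (prodLift (zeroHom S.alg A) (𝟙 S.alg))) ≫ lin (fm (prodSnd A S.alg)) =
        𝟙 _ := by
      rw [← lin_comp, ← fm_comp, prodLift_snd, fm_id, lin_one]
    rw [← shf_comp, ← lin_fm, ← lin_fm, h1, lin_extendFam, Preadditive.comp_add, fm_comp, lin_comp,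
      ← Category.assoc, ← Category.assoc, e1, e2, zero_comp, zero_add, Category.id_comp]

end

end AInf
-- Semisimplicity is expressed by the splitting of monomorphisms, which in an abelian category
-- splits every short exact sequence. Fibrancy and cofibrancy are stated for arbitrary terminal and
-- initial objects rather than for the zero algebra.
theorem mainTheorem3 {K : Type*} [Field K] (C : Type u) [Category.{v} C] [Abelian C] [Linear K C]
    [SplitMonoCategory C] [HasColimits C] [AB5 C]
    [MonoidalCategory C] [MonoidalPreadditive C] [MonoidalLinear K C]
    [∀ X : C, PreservesFiniteLimits (tensorLeft X)]
    [∀ X : C, PreservesFiniteColimits (tensorLeft X)]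
    [∀ X : C, PreservesFiniteLimits (tensorRight X)]
    [∀ X : C, PreservesFiniteColimits (tensorRight X)]
    [∀ X : C, PreservesFilteredColimits (tensorLeft X)]
    [∀ X : C, PreservesFilteredColimits (tensorRight X)] :
    -- (A): pullbacks along fibrations exist
    (∀ {E B X : AInf.AInfAlg C} (q : E ⟶ B) (f : X ⟶ B), AInf.fib C q → HasPullback q f) ∧
    -- CM2
    (AInf.weq C).HasTwoOutOfThreeProperty ∧
    -- CM3
    ((AInf.weq C).IsStableUnderRetracts ∧ (AInf.cof C).IsStableUnderRetracts ∧
      (AInf.fib C).IsStableUnderRetracts) ∧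
    -- CM4
    (∀ {A B E F : AInf.AInfAlg C} (i : A ⟶ B) (p : E ⟶ F), AInf.cof C i → AInf.fib C p →
      (AInf.weq C i ∨ AInf.weq C p) → HasLiftingProperty i p) ∧
    -- CM5
    (MorphismProperty.HasFactorization (AInf.cof C ⊓ AInf.weq C) (AInf.fib C) ∧
      MorphismProperty.HasFactorization (AInf.cof C) (AInf.fib C ⊓ AInf.weq C)) ∧
    -- all objects are fibrant and cofibrant
    (HasTerminal (AInf.AInfAlg C) ∧ HasInitial (AInf.AInfAlg C) ∧
      ∀ A : AInf.AInfAlg C,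
        (∀ (T : AInf.AInfAlg C), IsTerminal T → ∀ f : A ⟶ T, AInf.fib C f) ∧
        (∀ (I : AInf.AInfAlg C), IsInitial I → ∀ f : I ⟶ A, AInf.cof C f)) :=
  ⟨fun q f hq => AInf.hasPullback_of_fib q f hq, AInf.weq_hasTwoOutOfThree C,
    ⟨AInf.weq_isStableUnderRetracts C, AInf.cof_isStableUnderRetracts C,
      AInf.fib_isStableUnderRetracts C⟩,
    fun i p hi hp h => AInf.hasLiftingProperty_of_cof_fib i p hi hp h,
    ⟨AInf.hasFactorization_cof_weq_fib C, AInf.hasFactorization_cof_fib_weq C⟩,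
    AInf.hasTerminal C, AInf.hasInitial C, fun _ =>
      ⟨fun _ hT f => AInf.fib_of_isTerminal hT f, fun _ hI f => AInf.cof_of_isInitial hI f⟩⟩
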